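/- Let $\epsilon>0$, $a\neq 0$, $b\in\mathbb{R}$, $x_0\in[0,1]$, and consider, for $x\in[0,1]$ and $t\ge t_0\ge 0$, the viscous Hamilton--Jacobi equation with two boundary inputs $$u_t=\epsilon u_{xx}-a\,u_x(b+u_x),\qquad u_x(0,t)=U_0(t),\qquad u_x(1,t)=U_1(t).\tag{P}$$ For $1\le\gamma<2$ and $F,M>0$, let $G_{F,M,\gamma}$ be the set of all $f\in C^\infty([0,\infty))$ with $\sup_{t\ge0}|f^{(n)}(t)|\le F M^n (n!)^\gamma$ for all $n\ge 0$. For reference outputs $y_1,y_2$ put $$y_{1,v}=e^{-\frac{ab}{2\epsilon}x_0}\bigl(e^{-\frac a\epsilon y_1}-1\bigr),\qquad y_{2,v}=e^{-\frac{ab}{2\epsilon}x_0}\Bigl(-\tfrac a\epsilon e^{-\frac a\epsilon y_1}y_2-\tfrac{ab}{2\epsilon}\bigl(e^{-\frac a\epsilon y_1}-1\bigr)\Bigr),$$ $$v^{\rm r}(x,t)=\sum_{k\ge0}\frac{(x-x_0)^{2k}}{\epsilon^k(2k)!}\sum_{m=0}^k\binom km\Bigl(\frac{a^2b^2}{4\epsilon}\Bigr)^{k-m}y_{1,v}^{(m)}(t)+\sum_{k\ge0}\frac{(x-x_0)^{2k+1}}{\epsilon^k(2k+1)!}\sum_{m=0}^k\binom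 km\Bigl(\frac{a^2b^2}{4\epsilon}\Bigr)^{k-m}y_{2,v}^{(m)}(t),$$ $$u^{\rm r}(x,t)=-\frac\epsilon a\ln\bigl(e^{\frac{ab}{2\epsilon}x}v^{\rm r}(x,t)+1\bigr),\qquad U_0^{\rm r}(t)=-\frac{\epsilon}{a}\,\frac{v^{\rm r}_x(0,t)+\frac{ab}{2\epsilon}v^{\rm r}(0,t)}{1+v^{\rm r}(0,t)},\qquad U_1^{\rm r}(t)=-\frac{\epsilon e^{\frac{ab}{2\epsilon}}}{a}\,\frac{v^{\rm r}_x(1,t)+\frac{ab}{2\epsilon}v^{\rm r}(1,t)}{1+e^{\frac{ab}{2\epsilon}}v^{\rm r}(1,t)}.$$ For $c_1>0$ let $$k(x,\xi)=-\frac12\sqrt{\frac{c_1}{\epsilon}}\;\frac{{\rm I}_1\Bigl(\sqrt{\tfrac{c_1}{\epsilon}\bigl((x-\frac12)^2-(\xi-\frac12)^2\bigr)}\Bigr)}{\sqrt{(x-\frac12)^2-(\xi-\frac12)^2}}\,(x+\xi-1)$$ (extended continuously where $(x-\frac12)^2=(\xi-\frac12)^2$), ${\rm I}_1$ being the modified Bessel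 function of the first kind of order one. With the tracking error $\tilde u=u-u^{\rm r}$, the full-state feedback laws are $$U_0(t)=-\frac\epsilon a e^{\frac a\epsilon\tilde u(0,t)}\Bigl(\bigl(k(0,0)+\tfrac{ab}{2\epsilon}\bigr)\bigl(e^{-\frac a\epsilon\tilde u(0,t)}-1\bigr)-e^{\frac a\epsilon u^{\rm r}(0,t)}\int_0^1k_x(0,\xi)e^{-\frac{ab}{2\epsilon}\xi-\frac a\epsilon u^{\rm r}(\xi,t)}\bigl(e^{-\frac a\epsilon\tilde u(\xi,t)}-1\bigr)d\xi\Bigr)+U_0^{\rm r}(t)e^{\frac a\epsilon\tilde u(0,t)},$$ $$U_1(t)=-\frac\epsilon a e^{\frac a\epsilon\tilde u(1,t)}\Bigl(\bigl(k(1,1)+\tfrac{ab}{2\epsilon}\bigr)\bigl(e^{-\frac a\epsilon\tilde u(1,t)}-1\bigr)+e^{\frac{ab}{2\epsilon}+\frac a\epsilon u^{\rm r}(1,t)}\int_0^1k_x(1,\xi)e^{-\frac{ab}{2\epsilon}\xi-\frac a\epsilon u^{\rm r}(\xi,t)}\bigl(e^{-\frac a\epsilon\tilde u(\xi,t)}-1\bigr)d\xi\Bigr)+U_1^{\rm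 r}(t)e^{\frac a\epsilon\tilde u(1,t)}.$$ Write $\|f\|_{H^1}=\|f\|_{L^2(0,1)}+\|f'\|_{L^2(0,1)}$. **Theorem.** Given $\epsilon,a,b,x_0,M,\gamma$ as above, there is $\mu_1>0$ such that for all $F\in(0,\mu_1]$ and all $y_1,y_2\in G_{F,M,\gamma}$ the following holds. The two series converge and $e^{\frac{ab}{2\epsilon}x}v^{\rm r}(x,t)+1>0$ for $x\in[0,1]$, $t\ge0$, and $u^{\rm r}\in C([0,\infty);H^2(0,1))\cap C^{2,1}([0,1]\times(0,\infty))$ solves (P) on $[0,\infty)$ with $U_0=U_0^{\rm r}$, $U_1=U_1^{\rm r}$ and satisfies $u^{\rm r}(x_0,t)=y_1(t)$, $u^{\rm r}_x(x_0,t)=y_2(t)$ for $t\ge0$. Moreover, for every $c_1>0$ there exist $\mu>0$ and a class $\mathcal{KL}$ function $\beta$ of the form $\beta(s,\tau)=\alpha(s)e^{-\left(c_1+\frac{a^2b^2}{4\epsilon}\right)\tau}$ with $\alpha$ of class $\mathcal K$ (so that the decay rate can be made arbitrarily large by the choice of $c_1$) such that, for every $t_0\ge0$ and every $u_0\in H^2(0,1)$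 which is compatible with the feedback laws (that is, $u_0'(0)$ and $u_0'(1)$ equal the values of the two feedback laws at the time $t_0$ and the state $u_0$) and satisfies $\|u_0-u^{\rm r}(\cdot,t_0)\|_{H^1}<\mu$, the closed-loop system consisting of (P), the two feedback laws and the initial condition $u(\cdot,t_0)=u_0$ has a unique solution $u$ in $C([t_0,\infty);H^2(0,1))\cap C^{2,1}([0,1]\times(t_0,\infty))$, and $$\|\tilde u(t)\|_{H^1}\le\beta\bigl(\|\tilde u(t_0)\|_{H^1},\,t-t_0\bigr)\qquad\text{for all }t\ge t_0.$$ -/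

import Mathlib

open Set Filter Topology MeasureTheory
open scoped Nat ContDiff

noncomputable section

namespace ViscousHJ

/-! ### Comparison functions -/

/-- Class `𝒦`: continuous and strictly increasing on `[0,∞)`, vanishing at `0`. -/
def IsClassK (α : ℝ → ℝ) : Prop :=
  ContinuousOn α (Ici 0) ∧ StrictMonoOn α (Ici 0) ∧ α 0 = 0

/-- Class `𝒦ℒ`: continuous on `[0,∞)²`, of class `𝒦` in the first argument, decreasing to `0`
in the second one. -/
def IsClassKL (β : ℝ → ℝ → ℝ) : Prop :=
  ContinuousOn (fun p : ℝ × ℝ => β p.1 p.2) (Ici 0 ×ˢ Ici 0) ∧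
  (∀ s, 0 ≤ s → IsClassK (fun r => β r s)) ∧
  (∀ r, 0 ≤ r → AntitoneOn (β r) (Ici 0) ∧ Tendsto (β r) atTop (𝓝 0))

/-! ### Gevrey functions -/

/-- `f` belongs to the Gevrey class of order `γ` on `S` with constants `F`, `M`. -/
def IsGevrey (F M γ : ℝ) (S : Set ℝ) (f : ℝ → ℝ) : Prop :=
  0 < F ∧ 0 < M ∧ ContDiffOn ℝ ∞ f S ∧
  ∀ n : ℕ, ∀ t ∈ S, |iteratedDerivWithin n f S t| ≤ F * M ^ n * (n ! : ℝ) ^ γ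

/-! ### Sobolev spaces on the interval `(0,1)`

Functions are identified with their continuous representatives on `[0,1]`. -/

/-- Derivative on `[0,1]`, one-sided at the end points. -/
def dx (f : ℝ → ℝ) : ℝ → ℝ := derivWithin f (Icc 0 1)

/-- The `L²(0,1)` norm. -/
def l2Norm (f : ℝ → ℝ) : ℝ := √(∫ x in (0 : ℝ)..1, f x ^ 2)

/-- `f ∈ H²(0,1)`: `f` is differentiable on `[0,1]`, its derivative is absolutely continuous, and
the (almost everywhere defined) second derivative is square integrable. -/
def MemH2 (f : ℝ → ℝ) : Prop :=
  DifferentiableOn ℝ f (Icc 0 1) ∧ AbsolutelyContinuousOnInterval (dx f) 0 1 ∧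
  MemLp (dx (dx f)) 2 (volume.restrict (Ioo 0 1))

/-- The `H¹(0,1)` norm `‖f‖_{L²} + ‖f'‖_{L²}`. -/
def h1Norm (f : ℝ → ℝ) : ℝ := l2Norm f + l2Norm (dx f)

/-- The `H²(0,1)` norm `‖f‖_{L²} + ‖f'‖_{L²} + ‖f''‖_{L²}`. -/
def h2Norm (f : ℝ → ℝ) : ℝ := l2Norm f + l2Norm (dx f) + l2Norm (dx (dx f))

/-- `u ∈ C([t₀,∞); H²(0,1))`, where `u x t` is the value at the position `x` and the time `t`. -/
def ContinuousH2 (t₀ : ℝ) (u : ℝ → ℝ → ℝ) : Prop :=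
  (∀ t, t₀ ≤ t → MemH2 (fun x => u x t)) ∧
  ∀ t, t₀ ≤ t →
    Tendsto (fun s => h2Norm (fun x => u x s - u x t)) (𝓝[Ici t₀] t) (𝓝 0)

/-- `u ∈ C^{2,1}([0,1] × (t₀,∞))`: the derivatives `u_x`, `u_xx`, `u_t` exist on
`[0,1] × (t₀,∞)` and, together with `u`, are jointly continuous there. -/
def IsC21 (t₀ : ℝ) (u : ℝ → ℝ → ℝ) : Prop :=
  (∀ t, t₀ < t → DifferentiableOn ℝ (fun x => u x t) (Icc 0 1)) ∧
  (∀ t, t₀ < t → DifferentiableOn ℝ (dx (fun x => u x t)) (Icc 0 1)) ∧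
  (∀ x ∈ Icc (0 : ℝ) 1, DifferentiableOn ℝ (u x) (Ioi t₀)) ∧
  ContinuousOn (fun p : ℝ × ℝ => u p.1 p.2) (Icc 0 1 ×ˢ Ioi t₀) ∧
  ContinuousOn (fun p : ℝ × ℝ => dx (fun x => u x p.2) p.1) (Icc 0 1 ×ˢ Ioi t₀) ∧
  ContinuousOn (fun p : ℝ × ℝ => dx (dx (fun x => u x p.2)) p.1) (Icc 0 1 ×ˢ Ioi t₀) ∧
  ContinuousOn (fun p : ℝ × ℝ => deriv (u p.1) p.2) (Icc 0 1 ×ˢ Ioi t₀)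

/-! ### The plant -/

/-- `u` is a solution, of class `C^{2,1}([0,1] × (t₀,∞)) ∩ C([t₀,∞); H²(0,1))`, of
`u_t = ε u_xx - a u_x (b + u_x)`, `u_x(0,t) = U₀(t)`, `u_x(1,t) = U₁(t)`. -/
def SolvesPlant (ε a b t₀ : ℝ) (U₀ U₁ : ℝ → ℝ) (u : ℝ → ℝ → ℝ) : Prop :=
  ContinuousH2 t₀ u ∧ IsC21 t₀ u ∧
  (∀ x ∈ Icc (0 : ℝ) 1, ∀ t, t₀ < t →
    deriv (u x) t = ε * dx (dx (fun z => u z t)) x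
      - a * dx (fun z => u z t) x * (b + dx (fun z => u z t) x)) ∧
  (∀ t, t₀ ≤ t → dx (fun z => u z t) 0 = U₀ t ∧ dx (fun z => u z t) 1 = U₁ t)

/-! ### The reference trajectory -/

/-- `y_{1,v}^r`, the first output in the linearizing coordinates. -/
def y1v (ε a b x₀ : ℝ) (y₁ : ℝ → ℝ) (t : ℝ) : ℝ :=
  Real.exp (-(a * b / (2 * ε)) * x₀) * (Real.exp (-(a / ε) * y₁ t) - 1)

/-- `y_{2,v}^r`, the second output in the linearizing coordinates. -/
def y2v (ε a b x₀ : ℝ) (y₁ y₂ : ℝ → ℝ) (t : ℝ) : ℝ :=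
  Real.exp (-(a * b / (2 * ε)) * x₀) *
    (-(a / ε) * Real.exp (-(a / ε) * y₁ t) * y₂ t
      - a * b / (2 * ε) * (Real.exp (-(a / ε) * y₁ t) - 1))

/-- `∑_{m=0}^{k} binom(k,m) (a²b²/(4ε))^{k-m} y^{(m)}(t)`, for `y` a function on `[0,∞)`. -/
def refCoeff (ε a b : ℝ) (y : ℝ → ℝ) (k : ℕ) (t : ℝ) : ℝ :=
  ∑ m ∈ Finset.range (k + 1),
    (k.choose m : ℝ) * (a ^ 2 * b ^ 2 / (4 * ε)) ^ (k - m) * iteratedDerivWithin m y (Ici 0) t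

/-- The `k`-th term of the even part of the series of `v^r`. -/
def vRefEven (ε a b x₀ : ℝ) (y₁ : ℝ → ℝ) (x t : ℝ) (k : ℕ) : ℝ :=
  1 / ε ^ k * ((x - x₀) ^ (2 * k) / ((2 * k)! : ℝ)) * refCoeff ε a b (y1v ε a b x₀ y₁) k t

/-- The `k`-th term of the odd part of the series of `v^r`. -/
def vRefOdd (ε a b x₀ : ℝ) (y₁ y₂ : ℝ → ℝ) (x t : ℝ) (k : ℕ) : ℝ :=
  1 / ε ^ k * ((x - x₀) ^ (2 * k + 1) / ((2 * k + 1)! : ℝ)) *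
    refCoeff ε a b (y2v ε a b x₀ y₁ y₂) k t

/-- `v^r`. -/
def vRef (ε a b x₀ : ℝ) (y₁ y₂ : ℝ → ℝ) (x t : ℝ) : ℝ :=
  ∑' k, vRefEven ε a b x₀ y₁ x t k + ∑' k, vRefOdd ε a b x₀ y₁ y₂ x t k

/-- The reference trajectory `u^r`. -/
def uRef (ε a b x₀ : ℝ) (y₁ y₂ : ℝ → ℝ) (x t : ℝ) : ℝ :=
  -(ε / a) * Real.log (Real.exp (a * b / (2 * ε) * x) * vRef ε a b x₀ y₁ y₂ x t + 1)

/-- The reference input `U_0^r`. -/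
def uRef0 (ε a b x₀ : ℝ) (y₁ y₂ : ℝ → ℝ) (t : ℝ) : ℝ :=
  -(ε / a) *
    ((dx (fun x => vRef ε a b x₀ y₁ y₂ x t) 0 + a * b / (2 * ε) * vRef ε a b x₀ y₁ y₂ 0 t) /
      (1 + vRef ε a b x₀ y₁ y₂ 0 t))

/-- The reference input `U_1^r`. -/
def uRef1 (ε a b x₀ : ℝ) (y₁ y₂ : ℝ → ℝ) (t : ℝ) : ℝ :=
  -(ε * Real.exp (a * b / (2 * ε)) / a) *
    ((dx (fun x => vRef ε a b x₀ y₁ y₂ x t) 1 + a * b / (2 * ε) * vRef ε a b x₀ y₁ y₂ 1 t) /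
      (1 + Real.exp (a * b / (2 * ε)) * vRef ε a b x₀ y₁ y₂ 1 t))

/-- The reference trajectory is well defined (the two series converge and the argument of the
logarithm is positive), it solves the plant on `[0,∞)` under the reference inputs, and it produces
the reference outputs `u^r(x₀,t) = y₁(t)`, `u_x^r(x₀,t) = y₂(t)`. -/
def GeneratesReference (ε a b x₀ : ℝ) (y₁ y₂ : ℝ → ℝ) : Prop :=
  (∀ x ∈ Icc (0 : ℝ) 1, ∀ t, 0 ≤ t →
    Summable (vRefEven ε a b x₀ y₁ x t) ∧ Summable (vRefOdd ε a b x₀ y₁ y₂ x t) ∧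
    0 < Real.exp (a * b / (2 * ε) * x) * vRef ε a b x₀ y₁ y₂ x t + 1) ∧
  SolvesPlant ε a b 0 (uRef0 ε a b x₀ y₁ y₂) (uRef1 ε a b x₀ y₁ y₂) (uRef ε a b x₀ y₁ y₂) ∧
  (∀ t, 0 ≤ t → uRef ε a b x₀ y₁ y₂ x₀ t = y₁ t ∧
    dx (fun x => uRef ε a b x₀ y₁ y₂ x t) x₀ = y₂ t)

/-! ### The feedback laws -/

/-- The modified Bessel function of the first kind of order one. -/
def besselI1 (z : ℝ) : ℝ := ∑' m : ℕ, (z / 2) ^ (2 * m + 1) / ((m ! : ℝ) * ((m + 1)! : ℝ))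

/-- `(x - 1/2)² - (ξ - 1/2)²`, nonnegative on the domain of the backstepping kernel. -/
def kernelArg (x ξ : ℝ) : ℝ := (x - 1 / 2) ^ 2 - (ξ - 1 / 2) ^ 2

/-- The backstepping kernel. At `kernelArg x ξ = 0` the quotient is extended continuously,
by `I₁(√(c₁/ε) r) / r → √(c₁/ε) / 2` as `r → 0`. -/
def kernel (ε c₁ x ξ : ℝ) : ℝ :=
  -(1 / 2) * √(c₁ / ε) *
    (if kernelArg x ξ = 0 then √(c₁ / ε) / 2
      else besselI1 (√(c₁ / ε * kernelArg x ξ)) / √(kernelArg x ξ)) *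
    (x + ξ - 1)

/-- The derivative `k_x(x,ξ)`, used for `x ∈ {0,1}` and `0 < ξ < 1`, where the kernel is smooth. -/
def kernelDx (ε c₁ x ξ : ℝ) : ℝ := deriv (fun z => kernel ε c₁ z ξ) x

/-- The feedback law at `x = 0`, at time `t` and for the state `f = u(·,t)`. -/
def feedback0 (ε a b x₀ c₁ : ℝ) (y₁ y₂ : ℝ → ℝ) (t : ℝ) (f : ℝ → ℝ) : ℝ :=
  -(ε / a) * Real.exp (a / ε * (f 0 - uRef ε a b x₀ y₁ y₂ 0 t)) *
    ((kernel ε c₁ 0 0 + a * b / (2 * ε)) *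
        (Real.exp (-(a / ε) * (f 0 - uRef ε a b x₀ y₁ y₂ 0 t)) - 1)
      - Real.exp (a / ε * uRef ε a b x₀ y₁ y₂ 0 t) *
        ∫ ξ in (0 : ℝ)..1, kernelDx ε c₁ 0 ξ *
          Real.exp (-(a * b / (2 * ε)) * ξ - a / ε * uRef ε a b x₀ y₁ y₂ ξ t) *
          (Real.exp (-(a / ε) * (f ξ - uRef ε a b x₀ y₁ y₂ ξ t)) - 1))
    + uRef0 ε a b x₀ y₁ y₂ t * Real.exp (a / ε * (f 0 - uRef ε a b x₀ y₁ y₂ 0 t))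

/-- The feedback law at `x = 1`, at time `t` and for the state `f = u(·,t)`. -/
def feedback1 (ε a b x₀ c₁ : ℝ) (y₁ y₂ : ℝ → ℝ) (t : ℝ) (f : ℝ → ℝ) : ℝ :=
  -(ε / a) * Real.exp (a / ε * (f 1 - uRef ε a b x₀ y₁ y₂ 1 t)) *
    ((kernel ε c₁ 1 1 + a * b / (2 * ε)) *
        (Real.exp (-(a / ε) * (f 1 - uRef ε a b x₀ y₁ y₂ 1 t)) - 1)
      + Real.exp (a * b / (2 * ε) + a / ε * uRef ε a b x₀ y₁ y₂ 1 t) *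
        ∫ ξ in (0 : ℝ)..1, kernelDx ε c₁ 1 ξ *
          Real.exp (-(a * b / (2 * ε)) * ξ - a / ε * uRef ε a b x₀ y₁ y₂ ξ t) *
          (Real.exp (-(a / ε) * (f ξ - uRef ε a b x₀ y₁ y₂ ξ t)) - 1))
    + uRef1 ε a b x₀ y₁ y₂ t * Real.exp (a / ε * (f 1 - uRef ε a b x₀ y₁ y₂ 1 t))

/-- The initial state `u₀` is compatible with the feedback laws at the initial time `t₀`. -/
def Compatible (ε a b x₀ c₁ : ℝ) (y₁ y₂ : ℝ → ℝ) (t₀ : ℝ) (u₀ : ℝ → ℝ) : Prop :=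
  dx u₀ 0 = feedback0 ε a b x₀ c₁ y₁ y₂ t₀ u₀ ∧ dx u₀ 1 = feedback1 ε a b x₀ c₁ y₁ y₂ t₀ u₀

/-- `u` solves the closed-loop system (the plant under the two feedback laws) on `[t₀,∞)` with
initial state `u₀`, in the class `C([t₀,∞); H²(0,1)) ∩ C^{2,1}([0,1] × (t₀,∞))`. -/
def SolvesClosedLoop (ε a b x₀ c₁ : ℝ) (y₁ y₂ : ℝ → ℝ) (t₀ : ℝ) (u₀ : ℝ → ℝ)
    (u : ℝ → ℝ → ℝ) : Prop :=
  (∀ x ∈ Icc (0 : ℝ) 1, u x t₀ = u₀ x) ∧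
  SolvesPlant ε a b t₀ (fun t => feedback0 ε a b x₀ c₁ y₁ y₂ t (fun x => u x t))
    (fun t => feedback1 ε a b x₀ c₁ y₁ y₂ t (fun x => u x t)) u

end ViscousHJ

end

open ViscousHJ

noncomputable section

namespace ViscousHJ

open scoped Real

/-! The substitution v = e^{-abx/(2ε)}(e^{-au/ε} - 1) of Hopf–Cole type turns the plant into the
linear equation v_t = ε v_xx - (a²b²/(4ε)) v (`LinSol.hopfCole`, `IsC21.linSol_coleHopf`). Returning
to u requires e^{abx/(2ε)} v + 1 > 0. Smallness of the reference and of the initial error keeps this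
quantity away from zero and makes the errors in u and in v comparable in H¹ (`exists_vErr_le`,
`exists_hopfCole_le`).

Reference: the linear equation is read as a second order equation in x with Cauchy data at x₀. Its
power series solution has the coefficients ε^{-k} (∂_t + a²b²/(4ε))^k applied to the two outputs.
For outputs of Gevrey order γ < 2 these grow like (k!)^γ against the denominators (2k)! and (2k+1)!,
so the series is entire in x. All bounds are linear in F, so a small F makes the argument of the
logarithm at least 1/2 (`exists_smallReference`).

Error: ṽ = v - v^r solves the same linear equation. In terms of w = ṽ - ∫_{1-x}^x k(x,ξ) ṽ(ξ) dξ the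
two feedback laws say exactly that w_x = 0 at both ends (`feedback0_iff`, `feedback1_iff`). The
kernel satisfies a wave equation with suitable values on ξ = x and ξ = 1 - x, so the transformation
with parameter c = c₁/(4ε) carries ∂ₓ² to ∂ₓ² - 4c up to conjugation (`trans_intertwine`); changing
the sign of c gives its inverse (`trans_neg_trans`). Hence w solves a Neumann heat equation with
damping c₁ + a²b²/(4ε). A cosine series solves it, and Parseval's identity gives the decay of the H¹
energy as well as continuity in H² down to t₀ (`exists_neumann_heat`). Pulling w back gives
existence and decay (`exists_closedLoop`).

Uniqueness needs no smallness: the Hopf–Cole images of two solutions differ by a solution of the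
linear problem, and the L² energy of its backstepping transform is nonincreasing and starts at 0
(`closedLoop_unique`). -/

/-! ### Entire series `∑ cₙ zⁿ / n!` -/

/-- The exponential generating function of the sequence `c`. -/
def egf (c : ℕ → ℝ) (z : ℝ) : ℝ := ∑' n, c n * (z ^ n / (n ! : ℝ))

/-- `B` is a nonnegative sequence whose exponential generating function is entire. -/
structure EntireBound (B : ℕ → ℝ) : Prop where
  nonneg : ∀ n, 0 ≤ B n
  summable : ∀ R : ℝ, 0 ≤ R → Summable fun n => B n * (R ^ n / (n ! : ℝ))

/-- Differentiation shifts the coefficients of an exponential generating function, so this gives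
entire derivatives of every order. Convergence at radius R is compared with that at 2(R+1): the
power 2^{n+1} absorbs the factor n+1 lost in the factorial. -/
theorem EntireBound.shift {B : ℕ → ℝ} (h : EntireBound B) : EntireBound fun n => B (n + 1) := by
  refine ⟨fun n => h.nonneg _, fun R hR => ?_⟩
  have h1 := (summable_nat_add_iff 1).2 (h.summable (2 * (R + 1)) (by positivity))
  refine Summable.of_nonneg_of_le (fun n => ?_) (fun n => ?_) h1
  · have := h.nonneg (n + 1); positivity
  · refine mul_le_mul_of_nonneg_left ?_ (h.nonneg _)
    rw [Nat.factorial_succ, div_le_div_iff₀ (by positivity) (by positivity)]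
    push_cast
    have h2 : ((n : ℝ) + 1) ≤ 2 ^ (n + 1) := by
      have := (Nat.lt_two_pow_self (n := n + 1)).le
      exact_mod_cast this
    have h3 : R ^ n ≤ (R + 1) ^ (n + 1) := by
      calc R ^ n ≤ (R + 1) ^ n := by gcongr; linarith
        _ ≤ (R + 1) ^ (n + 1) := pow_le_pow_right₀ (by linarith) (by omega)
    calc R ^ n * (((n : ℝ) + 1) * (n ! : ℝ)) = (((n : ℝ) + 1) * R ^ n) * (n ! : ℝ) := by ring
      _ ≤ (2 ^ (n + 1) * (R + 1) ^ (n + 1)) * (n ! : ℝ) := by gcongr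
      _ = (2 * (R + 1)) ^ (n + 1) * (n ! : ℝ) := by rw [mul_pow]

theorem EntireBound.shift_iter {B : ℕ → ℝ} (h : EntireBound B) (j : ℕ) :
    EntireBound fun n => B (n + j) := by
  induction j with
  | zero => simpa using h
  | succ j ih =>
    have := ih.shift
    refine (funext fun n => ?_ : (fun n => B (n + (j + 1))) = fun n => B (n + 1 + j)) ▸ this
    congr 1; omega

theorem EntireBound.const_mul {B : ℕ → ℝ} (h : EntireBound B) {r : ℝ} (hr : 0 ≤ r) :
    EntireBound fun n => r * B n :=
  ⟨fun n => mul_nonneg hr (h.nonneg n), fun R hR => by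
    simpa only [mul_assoc] using (h.summable R hR).mul_left r⟩

theorem EntireBound.add {B C : ℕ → ℝ} (h : EntireBound B) (h' : EntireBound C) :
    EntireBound fun n => B n + C n :=
  ⟨fun n => add_nonneg (h.nonneg n) (h'.nonneg n), fun R hR => by
    simpa only [add_mul] using (h.summable R hR).add (h'.summable R hR)⟩

theorem abs_egf_term_le {B c : ℕ → ℝ} (hc : ∀ n, |c n| ≤ B n) {z R : ℝ}
    (hz : |z| ≤ R) (n : ℕ) : ‖c n * (z ^ n / (n ! : ℝ))‖ ≤ B n * (R ^ n / (n ! : ℝ)) := by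
  have hB : 0 ≤ B n := (abs_nonneg _).trans (hc n)
  rw [norm_mul, norm_div, norm_pow, Real.norm_eq_abs, Real.norm_eq_abs, Real.norm_natCast]
  gcongr
  exact hc n

theorem summable_egf {B c : ℕ → ℝ} (h : EntireBound B) (hc : ∀ n, |c n| ≤ B n) (z : ℝ) :
    Summable fun n => c n * (z ^ n / (n ! : ℝ)) :=
  Summable.of_norm_bounded (h.summable |z| (abs_nonneg z)) fun n => abs_egf_term_le hc le_rfl n

theorem abs_egf_le {B c : ℕ → ℝ} (h : EntireBound B) (hc : ∀ n, |c n| ≤ B n) {z R : ℝ}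
    (hz : |z| ≤ R) : |egf c z| ≤ egf B R :=
  tsum_of_norm_bounded (h.summable R ((abs_nonneg z).trans hz)).hasSum
    fun n => abs_egf_term_le hc hz n

theorem hasDerivAt_egf {B c : ℕ → ℝ} (h : EntireBound B) (hc : ∀ n, |c n| ≤ B n) (z : ℝ) :
    HasDerivAt (egf c) (egf (fun n => c (n + 1)) z) z := by
  set R := |z| + 1
  have hR : 0 ≤ R := by positivity
  have hzR : z ∈ Ioo (-R) R := by
    rw [mem_Ioo, ← abs_lt]; exact lt_add_one _
  -- The constant term has derivative zero; with index 0 set to 0, the remaining majorants are those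
  -- of the shifted sequence.
  let u : ℕ → ℝ := fun n => if n = 0 then 0 else B n * (R ^ (n - 1) / ((n - 1)! : ℝ))
  have hu : Summable u := by
    rw [← summable_nat_add_iff 1]
    simpa [u] using h.shift.summable R hR
  have key := hasDerivAt_tsum_of_isPreconnected (𝕜 := ℝ) (F := ℝ)
    (g := fun n z => c n * (z ^ n / (n ! : ℝ)))
    (g' := fun n z => c n * ((n : ℝ) * z ^ (n - 1) / (n ! : ℝ))) (y₀ := z) (y := z)
    hu (isOpen_Ioo (a := -R) (b := R)) isPreconnected_Ioo ?_ ?_ hzR (summable_egf h hc z) hzR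
  · have e : ∑' n, c n * ((n : ℝ) * z ^ (n - 1) / (n ! : ℝ)) = egf (fun n => c (n + 1)) z := by
      rw [egf, tsum_eq_zero_add']
      · simp only [Nat.cast_zero, zero_mul, zero_div, mul_zero, zero_add]
        refine tsum_congr fun n => ?_
        rw [Nat.factorial_succ, Nat.add_sub_cancel]
        push_cast
        congr 1
        field_simp
      · refine (summable_egf h.shift (fun n => hc (n + 1)) z).congr fun n => ?_
        rw [Nat.factorial_succ, Nat.add_sub_cancel]
        push_cast
        congr 1
        field_simp
    rw [e] at key
    exact key
  · intro n y _
    exact ((hasDerivAt_pow n y).div_const _).const_mul _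
  · intro n y hy
    rcases n with _ | n
    · simp [u]
    · have := abs_egf_term_le (fun n => hc (n + 1)) (abs_le.2 ⟨hy.1.le, hy.2.le⟩) n
      refine le_trans (le_of_eq ?_) (this.trans (le_of_eq (by simp [u])))
      congr 1
      rw [Nat.factorial_succ, Nat.add_sub_cancel]
      push_cast
      congr 1
      field_simp

theorem continuousOn_egf {B : ℕ → ℝ} {c : ℕ → ℝ → ℝ} {S : Set ℝ} (h : EntireBound B)
    (hc : ∀ n, ContinuousOn (c n) S) (hB : ∀ n, ∀ t ∈ S, |c n t| ≤ B n) {R : ℝ} (hR : 0 ≤ R) :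
    ContinuousOn (fun p : ℝ × ℝ => egf (fun n => c n p.2) p.1) (Icc (-R) R ×ˢ S) := by
  refine continuousOn_tsum (u := fun n => B n * (R ^ n / (n ! : ℝ))) (fun n => ?_)
    (h.summable R hR) ?_
  · refine ContinuousOn.mul ((hc n).comp continuousOn_snd fun p hp => hp.2) ?_
    fun_prop
  · intro n p hp
    exact abs_egf_term_le (c := fun n => c n p.2) (B := B) (fun n => hB n p.2 hp.2)
      (abs_le.2 hp.1) n

/-- Serves to differentiate v^r in time under the sum; the derivatives of the coefficients get a
majorant `B'` of their own, since they involve coefficients of higher index. -/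
theorem hasDerivAt_egf_param {B B' : ℕ → ℝ} {c c' : ℕ → ℝ → ℝ} {S : Set ℝ} (hS : IsOpen S)
    (hS' : IsPreconnected S) (h : EntireBound B) (h' : EntireBound B')
    (hd : ∀ n, ∀ t ∈ S, HasDerivAt (c n) (c' n t) t) (hB : ∀ n, ∀ t ∈ S, |c n t| ≤ B n)
    (hB' : ∀ n, ∀ t ∈ S, |c' n t| ≤ B' n) (z : ℝ) {t : ℝ} (ht : t ∈ S) :
    HasDerivAt (fun s => egf (fun n => c n s) z) (egf (fun n => c' n t) z) t := by
  refine hasDerivAt_tsum_of_isPreconnected (h'.summable |z| (abs_nonneg z)) hS hS'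
    (fun n s hs => (hd n s hs).mul_const _) (fun n s hs => ?_) ht
    (summable_egf h (fun n => hB n t ht) z) ht
  exact abs_egf_term_le (c := fun n => c' n s) (B := B') (fun n => hB' n s hs) le_rfl n

/-! ### The backstepping kernel -/

/-- `∑ zⁿ / (n! (n+j)!)`. -/
def bessPhi (j : ℕ) : ℝ → ℝ := egf fun n => 1 / ((n + j)! : ℝ)

theorem entireBound_one : EntireBound fun _ => 1 :=
  ⟨fun _ => zero_le_one, fun R _ => by simpa using Real.summable_pow_div_factorial R⟩

theorem abs_one_div_factorial_le (j n : ℕ) : |1 / ((n + j)! : ℝ)| ≤ 1 := by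
  rw [abs_of_nonneg (by positivity)]
  refine (div_le_one (by positivity)).2 ?_
  exact_mod_cast Nat.succ_le_of_lt (Nat.factorial_pos _)

theorem hasDerivAt_bessPhi (j : ℕ) (z : ℝ) : HasDerivAt (bessPhi j) (bessPhi (j + 1) z) z := by
  have := hasDerivAt_egf entireBound_one (abs_one_div_factorial_le j) z
  have e : (fun n : ℕ => 1 / ((n + 1 + j)! : ℝ)) = fun n : ℕ => 1 / ((n + (j + 1))! : ℝ) := by
    funext n; congr 3; ring
  rw [e] at this
  exact this

@[fun_prop]
theorem continuous_bessPhi (j : ℕ) : Continuous (bessPhi j) :=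
  continuous_iff_continuousAt.2 fun z => (hasDerivAt_bessPhi j z).continuousAt

/-- Bessel's equation in the variable r²/4, and the only analytic property of I₁ that the wave
equation of the kernel uses. Coefficientwise it is (2 + n)/(n+2)! = 1/(n+1)!. -/
theorem bessPhi_ode (z : ℝ) : 2 * bessPhi 2 z + z * bessPhi 3 z = bessPhi 1 z := by
  have hs := fun j => summable_egf entireBound_one (abs_one_div_factorial_le j) z
  have h1 : z * bessPhi 3 z = ∑' n : ℕ, (n : ℝ) * (1 / ((n + 2)! : ℝ) * (z ^ n / (n ! : ℝ))) := by
    rw [bessPhi, egf, ← tsum_mul_left, tsum_eq_zero_add' (f := fun n : ℕ => (n : ℝ) * _)]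
    · simp only [Nat.cast_zero, zero_mul, zero_add]
      refine tsum_congr fun n => ?_
      rw [Nat.factorial_succ n, pow_succ, show n + 1 + 2 = n + 3 by ring]
      push_cast
      field_simp
    · refine ((hs 3).mul_left z).congr fun n => ?_
      rw [Nat.factorial_succ n, pow_succ, show n + 1 + 2 = n + 3 by ring]
      push_cast
      field_simp
  have h2 : Summable fun n : ℕ => (n : ℝ) * (1 / ((n + 2)! : ℝ) * (z ^ n / (n ! : ℝ))) := by
    rw [← summable_nat_add_iff 1]
    refine ((hs 3).mul_left z).congr fun n => ?_
    rw [Nat.factorial_succ n, pow_succ, show n + 1 + 2 = n + 3 by ring]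
    push_cast
    field_simp
  rw [h1, bessPhi, bessPhi, egf, egf, ← tsum_mul_left, ← ((hs 2).mul_left 2).tsum_add h2]
  refine tsum_congr fun n => ?_
  rw [show n + 2 = n + 1 + 1 by ring, Nat.factorial_succ (n + 1)]
  push_cast
  field_simp
  ring

theorem bessPhi_zero : bessPhi 1 0 = 1 := by
  rw [bessPhi, egf, tsum_eq_single 0]
  · simp
  · intro n hn; simp [hn]

/-- The backstepping kernel as an entire function, with `c = c₁ / (4ε)` of either sign. -/
def ker (c x ξ : ℝ) : ℝ := -c * ((x + ξ - 1) * bessPhi 1 (c * kernelArg x ξ))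

/-- The derivative of `ker` in `x`. -/
def kerX (c x ξ : ℝ) : ℝ :=
  -c * (bessPhi 1 (c * kernelArg x ξ)
    + c * (2 * x - 1) * (x + ξ - 1) * bessPhi 2 (c * kernelArg x ξ))

/-- The second derivative of `ker` in `x`. -/
def kerXX (c x ξ : ℝ) : ℝ :=
  -c * (c * (2 * (2 * x - 1) + 2 * (x + ξ - 1)) * bessPhi 2 (c * kernelArg x ξ)
    + c ^ 2 * (2 * x - 1) ^ 2 * (x + ξ - 1) * bessPhi 3 (c * kernelArg x ξ))

/-- The derivative of `ker` in `ξ`. -/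
def kerY (c x ξ : ℝ) : ℝ :=
  -c * (bessPhi 1 (c * kernelArg x ξ)
    - c * (2 * ξ - 1) * (x + ξ - 1) * bessPhi 2 (c * kernelArg x ξ))

/-- The second derivative of `ker` in `ξ`. -/
def kerYY (c x ξ : ℝ) : ℝ :=
  -c * (-(c * (2 * (2 * ξ - 1) + 2 * (x + ξ - 1)) * bessPhi 2 (c * kernelArg x ξ))
    + c ^ 2 * (2 * ξ - 1) ^ 2 * (x + ξ - 1) * bessPhi 3 (c * kernelArg x ξ))

@[fun_prop]
theorem continuous_kernelArg : Continuous fun p : ℝ × ℝ => kernelArg p.1 p.2 := by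
  unfold kernelArg; fun_prop

theorem continuous_ker (c : ℝ) : Continuous fun p : ℝ × ℝ => ker c p.1 p.2 := by
  unfold ker; fun_prop

theorem continuous_kerX (c : ℝ) : Continuous fun p : ℝ × ℝ => kerX c p.1 p.2 := by
  unfold kerX; fun_prop

theorem continuous_kerXX (c : ℝ) : Continuous fun p : ℝ × ℝ => kerXX c p.1 p.2 := by
  unfold kerXX; fun_prop

theorem continuous_kerY (c : ℝ) : Continuous fun p : ℝ × ℝ => kerY c p.1 p.2 := by
  unfold kerY; fun_prop

theorem continuous_kerYY (c : ℝ) : Continuous fun p : ℝ × ℝ => kerYY c p.1 p.2 := by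
  unfold kerYY; fun_prop

theorem hasDerivAt_bessPhi_x (j : ℕ) (c x ξ : ℝ) :
    HasDerivAt (fun z => bessPhi j (c * kernelArg z ξ))
      (c * (2 * x - 1) * bessPhi (j + 1) (c * kernelArg x ξ)) x := by
  have h : HasDerivAt (fun z => c * kernelArg z ξ) (c * (2 * x - 1)) x := by
    have := ((((hasDerivAt_id x).sub_const (1 / 2)).pow 2).sub_const ((ξ - 1 / 2) ^ 2)).const_mul c
    refine this.congr_deriv ?_
    change c * (((2 : ℕ) : ℝ) * (x - 1 / 2) ^ 1 * 1) = _
    push_cast; ring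
  have := (hasDerivAt_bessPhi j (c * kernelArg x ξ)).comp x h
  exact this.congr_deriv (mul_comm _ _)

theorem hasDerivAt_bessPhi_y (j : ℕ) (c x ξ : ℝ) :
    HasDerivAt (fun z => bessPhi j (c * kernelArg x z))
      (-(c * (2 * ξ - 1)) * bessPhi (j + 1) (c * kernelArg x ξ)) ξ := by
  have h : HasDerivAt (fun z => c * kernelArg x z) (-(c * (2 * ξ - 1))) ξ := by
    have := ((((hasDerivAt_id ξ).sub_const (1 / 2)).pow 2).const_sub ((x - 1 / 2) ^ 2)).const_mul c
    refine this.congr_deriv ?_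
    change c * -(((2 : ℕ) : ℝ) * (ξ - 1 / 2) ^ 1 * 1) = _
    push_cast; ring
  have := (hasDerivAt_bessPhi j (c * kernelArg x ξ)).comp ξ h
  exact this.congr_deriv (mul_comm _ _)

theorem hasDerivAt_ker_x (c x ξ : ℝ) : HasDerivAt (fun z => ker c z ξ) (kerX c x ξ) x := by
  have h1 : HasDerivAt (fun z : ℝ => z + ξ - 1) 1 x := ((hasDerivAt_id x).add_const ξ).sub_const 1
  refine ((h1.mul (hasDerivAt_bessPhi_x 1 c x ξ)).const_mul (-c)).congr_deriv ?_
  rw [kerX]; ring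

theorem hasDerivAt_kerX_x (c x ξ : ℝ) : HasDerivAt (fun z => kerX c z ξ) (kerXX c x ξ) x := by
  have h1 : HasDerivAt (fun z : ℝ => z + ξ - 1) 1 x := ((hasDerivAt_id x).add_const ξ).sub_const 1
  have h2 : HasDerivAt (fun z : ℝ => c * (2 * z - 1)) (c * 2) x := by
    simpa using (((hasDerivAt_id x).const_mul 2).sub_const 1).const_mul c
  refine (((hasDerivAt_bessPhi_x 1 c x ξ).add
    ((h2.mul h1).mul (hasDerivAt_bessPhi_x 2 c x ξ))).const_mul (-c)).congr_deriv ?_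
  simp only [kerXX, Pi.mul_apply]; ring

theorem hasDerivAt_ker_y (c x ξ : ℝ) : HasDerivAt (fun z => ker c x z) (kerY c x ξ) ξ := by
  have h1 : HasDerivAt (fun z : ℝ => x + z - 1) 1 ξ := ((hasDerivAt_id ξ).const_add x).sub_const 1
  refine ((h1.mul (hasDerivAt_bessPhi_y 1 c x ξ)).const_mul (-c)).congr_deriv ?_
  rw [kerY]; ring

theorem hasDerivAt_kerY_y (c x ξ : ℝ) : HasDerivAt (fun z => kerY c x z) (kerYY c x ξ) ξ := by
  have h1 : HasDerivAt (fun z : ℝ => x + z - 1) 1 ξ := ((hasDerivAt_id ξ).const_add x).sub_const 1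
  have h2 : HasDerivAt (fun z : ℝ => c * (2 * z - 1)) (c * 2) ξ := by
    simpa using (((hasDerivAt_id ξ).const_mul 2).sub_const 1).const_mul c
  refine (((hasDerivAt_bessPhi_y 1 c x ξ).sub
    ((h2.mul h1).mul (hasDerivAt_bessPhi_y 2 c x ξ))).const_mul (-c)).congr_deriv ?_
  simp only [kerYY, Pi.mul_apply]; ring

/-- The terms with `bessPhi 2` add up to 8c(x+ξ-1), and (2x-1)² - (2ξ-1)² = 4 `kernelArg x ξ`. The
bracket is thus the left side of `bessPhi_ode` at z = c · `kernelArg x ξ`. -/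
theorem ker_wave (c x ξ : ℝ) : kerXX c x ξ - kerYY c x ξ = 4 * c * ker c x ξ := by
  have := bessPhi_ode (c * kernelArg x ξ)
  rw [ker, ← this, kerXX, kerYY, kernelArg]
  ring

theorem kernelArg_diag (x : ℝ) : kernelArg x x = 0 := by simp [kernelArg]

/-- This and the next three lemmas are the data on ξ = x and ξ = 1 - x. Together with smoothness and
`ker_wave` they are all that `trans_intertwine` needs of the kernel. -/
theorem ker_diag (c x : ℝ) : ker c x x = -c * (2 * x - 1) := by
  rw [ker, kernelArg_diag, mul_zero, bessPhi_zero]; ring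

theorem ker_antidiag (c x : ℝ) : ker c x (1 - x) = 0 := by rw [ker]; ring

theorem kerX_antidiag (c x : ℝ) : kerX c x (1 - x) = kerY c x (1 - x) := by rw [kerX, kerY]; ring

theorem kerX_add_kerY_diag (c x : ℝ) : kerX c x x + kerY c x x = -2 * c := by
  rw [kerX, kerY, kernelArg_diag, mul_zero, bessPhi_zero]; ring

/-! #### Comparison with the kernel of the feedback laws -/

theorem besselI1_eq (z : ℝ) : besselI1 z = z / 2 * bessPhi 1 (z ^ 2 / 4) := by
  rw [besselI1, bessPhi, egf, ← tsum_mul_left]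
  refine tsum_congr fun m => ?_
  rw [pow_succ, pow_mul, div_pow, show (z ^ 2 / 4) = z ^ 2 / 2 ^ 2 by norm_num]
  field_simp

/-- The singularity is removable: I₁(r)/r = `bessPhi 1 (r²/4)`/2 is an entire function of r². The
sign condition matters because the real square root vanishes on negative arguments. -/
theorem kernel_eq_ker {ε c₁ : ℝ} (hε : 0 < ε) (hc : 0 < c₁) {x ξ : ℝ} (h : 0 ≤ kernelArg x ξ) :
    kernel ε c₁ x ξ = ker (c₁ / (4 * ε)) x ξ := by
  have hC : 0 < c₁ / ε := div_pos hc hε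
  have hs : √(c₁ / ε) * √(c₁ / ε) = c₁ / ε := Real.mul_self_sqrt hC.le
  rcases h.eq_or_lt with h0 | h0
  · rw [kernel, ker, if_pos h0.symm, ← h0, mul_zero, bessPhi_zero]
    linear_combination (-(1 / 4) * (x + ξ - 1)) * hs
  · rw [kernel, ker, if_neg h0.ne', besselI1_eq, Real.sq_sqrt (by positivity),
      Real.sqrt_mul hC.le]
    have h1 : √(kernelArg x ξ) ≠ 0 := (Real.sqrt_pos.2 h0).ne'
    have e : c₁ / ε * kernelArg x ξ / 4 = c₁ / (4 * ε) * kernelArg x ξ := by field_simp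
    rw [e]
    have e2 : √(c₁ / ε) * √(kernelArg x ξ) / 2 * bessPhi 1 (c₁ / (4 * ε) * kernelArg x ξ)
        / √(kernelArg x ξ) = √(c₁ / ε) / 2 * bessPhi 1 (c₁ / (4 * ε) * kernelArg x ξ) := by
      field_simp
    rw [e2]
    have e3 : c₁ / (4 * ε) = (√(c₁ / ε) * √(c₁ / ε)) / 4 := by rw [hs]; field_simp
    rw [show ∀ p : ℝ, -(c₁ / (4 * ε)) * p = -((√(c₁ / ε) * √(c₁ / ε)) / 4) * p by
      intro p; rw [e3]]
    ring

/-- Strict positivity persists near x, so the two kernels agree on a neighbourhood and have the same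
derivative. -/
theorem kernelDx_eq_kerX {ε c₁ : ℝ} (hε : 0 < ε) (hc : 0 < c₁) {x ξ : ℝ} (h : 0 < kernelArg x ξ) :
    kernelDx ε c₁ x ξ = kerX (c₁ / (4 * ε)) x ξ := by
  have hcont : Continuous fun z => kernelArg z ξ := by unfold kernelArg; fun_prop
  have hev : (fun z => kernel ε c₁ z ξ) =ᶠ[𝓝 x] fun z => ker (c₁ / (4 * ε)) z ξ := by
    filter_upwards [hcont.continuousAt.eventually (lt_mem_nhds h)] with z hz
    exact kernel_eq_ker hε hc hz.le
  exact hev.deriv_eq.trans (hasDerivAt_ker_x _ x ξ).deriv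

/-! ### Integrals depending on a parameter -/

theorem continuousOn_integral_param {X : Type*} [TopologicalSpace X] [FirstCountableTopology X]
    {f : X → ℝ → ℝ} {S : Set X} {a b : ℝ} (hab : a ≤ b)
    (hf : ContinuousOn (fun p : X × ℝ => f p.1 p.2) (S ×ˢ Icc a b)) :
    ContinuousOn (fun x => ∫ ξ in a..b, f x ξ) S := by
  rw [continuousOn_iff_continuous_domRestrict]
  -- Projecting the integration variable to `[a,b]` yields an integrand continuous on all of S × ℝ,
  -- with the same integral.
  have h : Continuous fun p : S × ℝ => f p.1 (projIcc a b hab p.2) :=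
    hf.comp_continuous (f := fun p : S × ℝ => ((p.1 : X), ((projIcc a b hab p.2 : Icc a b) : ℝ)))
      (by fun_prop) fun p => ⟨p.1.2, (projIcc a b hab p.2).2⟩
  refine (intervalIntegral.continuous_parametric_intervalIntegral_of_continuous'
    (f := fun (p : S) ξ => f p (projIcc a b hab ξ)) (μ := volume) h a b).congr fun p => ?_
  refine intervalIntegral.integral_congr fun ξ hξ => ?_
  rw [uIcc_of_le hab] at hξ
  simp only [projIcc_of_mem hab hξ]

theorem hasDerivAt_integral_param {f f' : ℝ → ℝ → ℝ} {S : Set ℝ} (hS : IsOpen S) {a b : ℝ}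
    (hf : ∀ t ∈ S, ContinuousOn (f t) (uIcc a b))
    (hf' : ContinuousOn (fun p : ℝ × ℝ => f' p.1 p.2) (S ×ˢ uIcc a b))
    (hd : ∀ t ∈ S, ∀ ξ ∈ uIcc a b, HasDerivAt (fun s => f s ξ) (f' t ξ) t) {t : ℝ} (ht : t ∈ S) :
    HasDerivAt (fun s => ∫ ξ in a..b, f s ξ) (∫ ξ in a..b, f' t ξ) t := by
  obtain ⟨r, hr, hrS⟩ := Metric.nhds_basis_closedBall.mem_iff.1 (hS.mem_nhds ht)
  obtain ⟨C, hC⟩ := ((isCompact_closedBall t r).prod isCompact_uIcc).exists_bound_of_continuousOn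
    (hf'.mono (prod_mono hrS Subset.rfl))
  have hslice : ContinuousOn (f' t) (uIcc a b) :=
    hf'.comp (f := fun ξ => (t, ξ)) (by fun_prop) fun ξ hξ => ⟨ht, hξ⟩
  refine (intervalIntegral.hasDerivAt_integral_of_dominated_loc_of_deriv_le (bound := fun _ => C)
    (Metric.closedBall_mem_nhds t hr) ?_ (hf t ht).intervalIntegrable ?_ ?_
    intervalIntegrable_const ?_).2
  · filter_upwards [hS.mem_nhds ht] with s hs
    exact ((hf s hs).mono uIoc_subset_uIcc).aestronglyMeasurable measurableSet_uIoc
  · exact (hslice.mono uIoc_subset_uIcc).aestronglyMeasurable measurableSet_uIoc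
  · exact Eventually.of_forall fun ξ hξ s hs => hC (s, ξ) ⟨hs, uIoc_subset_uIcc hξ⟩
  · exact Eventually.of_forall fun ξ hξ s hs => hd s (hrS hs) ξ (uIoc_subset_uIcc hξ)

/-! ### Volterra operators on the symmetric interval `[1-x,x]` -/

/-- The integral operator with kernel `k` on the interval `[1-x,x]`. -/
def volt (k : ℝ → ℝ → ℝ) (v : ℝ → ℝ) (x : ℝ) : ℝ := ∫ ξ in (1 - x)..x, k x ξ * v ξ

theorem uIcc_one_sub_subset {x : ℝ} (hx : x ∈ Icc (0 : ℝ) 1) : uIcc (1 - x) x ⊆ Icc 0 1 :=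
  uIcc_subset_Icc ⟨by linarith [hx.2], by linarith [hx.1]⟩ hx

theorem volt_congr {k : ℝ → ℝ → ℝ} {v w : ℝ → ℝ} (h : EqOn v w (Icc 0 1)) {x : ℝ}
    (hx : x ∈ Icc (0 : ℝ) 1) : volt k v x = volt k w x :=
  intervalIntegral.integral_congr fun ξ hξ => by
    simp only [h (uIcc_one_sub_subset hx hξ)]

theorem hasDerivAt_volt {k k' : ℝ → ℝ → ℝ} (hk : Continuous fun p : ℝ × ℝ => k p.1 p.2)
    (hk' : Continuous fun p : ℝ × ℝ => k' p.1 p.2)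
    (hd : ∀ x ξ, HasDerivAt (fun z => k z ξ) (k' x ξ) x) {v : ℝ → ℝ} (hv : Continuous v) (x : ℝ) :
    HasDerivAt (volt k v) (k x x * v x + k x (1 - x) * v (1 - x) + volt k' v x) x := by
  -- The limit p and the kernel variable q are separated. G has continuous partial derivatives,
  -- hence is differentiable, and `volt k v` is the difference of G along the curves (z,z) and
  -- (1-z,z). The lower limit moves with speed -1, so both boundary terms come with a plus sign.
  let G : ℝ → ℝ → ℝ := fun p q => ∫ ξ in (0 : ℝ)..p, k q ξ * v ξ
  let G₁ : ℝ → ℝ → ℝ →L[ℝ] ℝ := fun p q => (1 : ℝ →L[ℝ] ℝ).smulRight (k q p * v p)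
  let G₂ : ℝ → ℝ → ℝ →L[ℝ] ℝ := fun p q =>
    (1 : ℝ →L[ℝ] ℝ).smulRight (∫ ξ in (0 : ℝ)..p, k' q ξ * v ξ)
  have hkq : ∀ q, Continuous fun ξ => k q ξ * v ξ := fun q =>
    (hk.comp (Continuous.prodMk_right q)).mul hv
  have hd1 : ∀ p q, HasFDerivAt (fun p => G p q) (G₁ p q) p := fun p q =>
    (intervalIntegral.integral_hasDerivAt_right ((hkq q).intervalIntegrable _ _)
      ((hkq q).stronglyMeasurableAtFilter _ _) (hkq q).continuousAt).hasFDerivAt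
  have hd2 : ∀ p q, HasFDerivAt (fun q => G p q) (G₂ p q) q := fun p q =>
    (hasDerivAt_integral_param isOpen_univ (fun t _ => (hkq t).continuousOn)
      ((hk'.mul (hv.comp continuous_snd)).continuousOn)
      (fun t _ ξ _ => (hd t ξ).mul_const _) (mem_univ q)).hasFDerivAt
  have hc1 : Continuous fun p : ℝ × ℝ => G₁ p.1 p.2 := by
    refine ((ContinuousLinearMap.smulRightL ℝ ℝ ℝ 1).continuous).comp ?_
    exact (hk.comp continuous_swap).mul (hv.comp continuous_fst)
  have hc2 : Continuous fun p : ℝ × ℝ => G₂ p.1 p.2 := by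
    refine ((ContinuousLinearMap.smulRightL ℝ ℝ ℝ 1).continuous).comp ?_
    refine intervalIntegral.continuous_parametric_intervalIntegral_of_continuous
      (f := fun (p : ℝ × ℝ) ξ => k' p.2 ξ * v ξ) ?_ continuous_fst
    have : Continuous fun p : (ℝ × ℝ) × ℝ => k' p.1.2 p.2 := hk'.comp (f := fun p : (ℝ × ℝ) × ℝ => (p.1.2, p.2)) (by fun_prop)
    exact this.mul (hv.comp continuous_snd)
  have hG : ∀ u : ℝ × ℝ, HasFDerivAt (fun p : ℝ × ℝ => G p.1 p.2)
      ((G₁ u.1 u.2).coprod (G₂ u.1 u.2)) u := fun u =>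
    (hasStrictFDerivAt_uncurry_coprod (f := G) (f₁ := G₁) (f₂ := G₂) (𝕜 := ℝ)
      (Eventually.of_forall fun v => hd1 v.1 v.2) (Eventually.of_forall fun v => hd2 v.1 v.2)
      hc1.continuousAt hc2.continuousAt).hasFDerivAt
  have e : volt k v = fun z => G z z - G (1 - z) z := by
    funext z
    simp only [volt, G]
    rw [intervalIntegral.integral_interval_sub_left ((hkq z).intervalIntegrable _ _)
      ((hkq z).intervalIntegrable _ _)]
  have h1 : HasDerivAt (fun z => G z z) _ x :=
    (hG (x, x)).comp_hasDerivAt (f := fun z => (z, z)) x ((hasDerivAt_id x).prodMk (hasDerivAt_id x))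
  have h2 : HasDerivAt (fun z => G (1 - z) z) _ x :=
    (hG (1 - x, x)).comp_hasDerivAt (f := fun z => (1 - z, z)) x
    (((hasDerivAt_id x).const_sub 1).prodMk (hasDerivAt_id x))
  rw [e]
  refine (h1.sub h2).congr_deriv ?_
  simp only [ContinuousLinearMap.coprod_apply, G₁, G₂, ContinuousLinearMap.smulRight_apply,
    one_apply_eq_self, smul_eq_mul, volt]
  have hk'x : Continuous fun ξ => k' x ξ * v ξ := (hk'.comp (Continuous.prodMk_right x)).mul hv
  rw [← intervalIntegral.integral_interval_sub_left (hk'x.intervalIntegrable 0 x)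
      (hk'x.intervalIntegrable 0 (1 - x))]
  ring

theorem hasDerivWithinAt_volt {k k' : ℝ → ℝ → ℝ} (hk : Continuous fun p : ℝ × ℝ => k p.1 p.2)
    (hk' : Continuous fun p : ℝ × ℝ => k' p.1 p.2)
    (hd : ∀ x ξ, HasDerivAt (fun z => k z ξ) (k' x ξ) x) {v : ℝ → ℝ}
    (hv : ContinuousOn v (Icc 0 1)) {x : ℝ} (hx : x ∈ Icc (0 : ℝ) 1) :
    HasDerivWithinAt (volt k v) (k x x * v x + k x (1 - x) * v (1 - x) + volt k' v x)
      (Icc 0 1) x := by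
  -- For x in `[0,1]` the integral sees only `[0,1]`, so a continuous extension of v to the line may
  -- be used.
  let w : ℝ → ℝ := IccExtend zero_le_one ((Icc 0 1).domRestrict v)
  have hw : Continuous w := (continuousOn_iff_continuous_domRestrict.1 hv).Icc_extend'
  have e : EqOn v w (Icc 0 1) := fun ξ hξ => by simp [w, IccExtend_of_mem _ _ hξ, domRestrict]
  have hx' : 1 - x ∈ Icc (0 : ℝ) 1 := ⟨by linarith [hx.2], by linarith [hx.1]⟩
  rw [e hx, e hx', volt_congr e hx]
  exact (hasDerivAt_volt hk hk' hd hw x).hasDerivWithinAt.congr (fun z hz => volt_congr e hz)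
    (volt_congr e hx)

/-- A substitution with a fixed domain of integration, which reduces joint continuity to integrals
with a parameter. It also covers x < 1/2, where the interval is traversed backwards, and x = 1/2,
where both sides vanish. -/
theorem volt_eq_mul_integral (k : ℝ → ℝ → ℝ) (v : ℝ → ℝ) (x : ℝ) :
    volt k v x = (2 * x - 1) * ∫ r in (0 : ℝ)..1,
      k x (1 - x + (2 * x - 1) * r) * v (1 - x + (2 * x - 1) * r) := by
  rw [intervalIntegral.mul_integral_comp_add_mul (f := fun ξ => k x ξ * v ξ), volt]
  congr 1 <;> ring

theorem affine_mem_Icc {x r : ℝ} (hx : x ∈ Icc (0 : ℝ) 1) (hr : r ∈ Icc (0 : ℝ) 1) :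
    1 - x + (2 * x - 1) * r ∈ Icc (0 : ℝ) 1 :=
  ⟨by nlinarith [hx.1, hx.2, hr.1, hr.2], by nlinarith [hx.1, hx.2, hr.1, hr.2]⟩

theorem continuousOn_volt {k : ℝ → ℝ → ℝ} (hk : Continuous fun p : ℝ × ℝ => k p.1 p.2)
    {V : ℝ → ℝ → ℝ} {S : Set ℝ}
    (hV : ContinuousOn (fun p : ℝ × ℝ => V p.1 p.2) (Icc 0 1 ×ˢ S)) :
    ContinuousOn (fun p : ℝ × ℝ => volt k (fun z => V z p.2) p.1) (Icc 0 1 ×ˢ S) := by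
  simp only [volt_eq_mul_integral]
  refine ContinuousOn.mul (by fun_prop) (continuousOn_integral_param zero_le_one
    (f := fun (p : ℝ × ℝ) r => k p.1 (1 - p.1 + (2 * p.1 - 1) * r)
      * V (1 - p.1 + (2 * p.1 - 1) * r) p.2) ?_)
  refine ContinuousOn.mul ?_ ?_
  · exact (hk.comp (f := fun q : (ℝ × ℝ) × ℝ => (q.1.1, 1 - q.1.1 + (2 * q.1.1 - 1) * q.2))
      (by fun_prop)).continuousOn
  · exact hV.comp (f := fun q : (ℝ × ℝ) × ℝ => (1 - q.1.1 + (2 * q.1.1 - 1) * q.2, q.1.2))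
      (by fun_prop) fun q hq => ⟨affine_mem_Icc hq.1.1 hq.2, hq.1.2⟩

theorem continuousOn_volt_slice {k : ℝ → ℝ → ℝ} (hk : Continuous fun p : ℝ × ℝ => k p.1 p.2)
    {v : ℝ → ℝ} (hv : ContinuousOn v (Icc 0 1)) : ContinuousOn (volt k v) (Icc 0 1) := by
  have := continuousOn_volt hk (V := fun x _ => v x) (S := {(0 : ℝ)})
    (hv.comp continuousOn_fst fun p hp => hp.1)
  exact this.comp (f := fun x => (x, (0 : ℝ))) (by fun_prop) fun x hx => ⟨hx, rfl⟩

theorem hasDerivAt_volt_time {k : ℝ → ℝ → ℝ} (hk : Continuous fun p : ℝ × ℝ => k p.1 p.2)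
    {V Vt : ℝ → ℝ → ℝ} {S : Set ℝ} (hS : IsOpen S)
    (hV : ContinuousOn (fun p : ℝ × ℝ => V p.1 p.2) (Icc 0 1 ×ˢ S))
    (hVt : ContinuousOn (fun p : ℝ × ℝ => Vt p.1 p.2) (Icc 0 1 ×ˢ S))
    (hd : ∀ x ∈ Icc (0 : ℝ) 1, ∀ t ∈ S, HasDerivAt (V x) (Vt x t) t) {x t : ℝ}
    (hx : x ∈ Icc (0 : ℝ) 1) (ht : t ∈ S) :
    HasDerivAt (fun s => volt k (fun z => V z s) x) (volt k (fun z => Vt z t) x) t := by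
  have hs := uIcc_one_sub_subset hx
  have hkx : Continuous (k x) := hk.comp (Continuous.prodMk_right x)
  refine hasDerivAt_integral_param hS (f := fun s ξ => k x ξ * V ξ s)
    (f' := fun s ξ => k x ξ * Vt ξ s) (fun s hs' => ?_) ?_ (fun s hs' ξ hξ => ?_) ht
  · exact hkx.continuousOn.mul (hV.comp (f := fun ξ => (ξ, s)) (by fun_prop)
      fun ξ hξ => ⟨hs hξ, hs'⟩)
  · exact (hkx.comp continuous_snd).continuousOn.mul (hVt.comp (f := fun p : ℝ × ℝ => (p.2, p.1))
      (by fun_prop) fun p hp => ⟨hs hp.2, hp.1⟩)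
  · exact (hd ξ (hs hξ) s hs').const_mul _

/-- Cauchy–Schwarz on an interval of length one, in the form that the variance of |v| is
nonnegative. -/
theorem sq_integral_abs_le {v : ℝ → ℝ} (hv : ContinuousOn v (Icc 0 1)) :
    (∫ x in (0 : ℝ)..1, |v x|) ^ 2 ≤ ∫ x in (0 : ℝ)..1, v x ^ 2 := by
  set m := ∫ x in (0 : ℝ)..1, |v x|
  have hv' : ContinuousOn v (uIcc 0 1) := by rwa [uIcc_of_le zero_le_one]
  have h0 : 0 ≤ ∫ x in (0 : ℝ)..1, (|v x| - m) ^ 2 :=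
    intervalIntegral.integral_nonneg zero_le_one fun x _ => sq_nonneg _
  have e : ∫ x in (0 : ℝ)..1, (|v x| - m) ^ 2
      = (∫ x in (0 : ℝ)..1, v x ^ 2) - 2 * m * m + m ^ 2 := by
    have : ∀ x, (|v x| - m) ^ 2 = (v x ^ 2 - 2 * m * |v x|) + m ^ 2 := fun x => by
      rw [sub_sq, sq_abs]; ring
    simp only [this]
    rw [intervalIntegral.integral_add, intervalIntegral.integral_sub,
      intervalIntegral.integral_const_mul, intervalIntegral.integral_const]
    · simp [m]
    · exact (hv'.pow 2).intervalIntegrable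
    · exact (hv'.abs.const_mul _).intervalIntegrable
    · exact ((hv'.pow 2).sub (hv'.abs.const_mul _)).intervalIntegrable
    · exact intervalIntegrable_const
  nlinarith

/-- C is the maximum of |k| on the unit square. The L¹ norm on the right serves both the sup-norm
estimate and, by `sq_integral_abs_le`, the energy estimate. -/
theorem exists_volt_bound {k : ℝ → ℝ → ℝ} (hk : Continuous fun p : ℝ × ℝ => k p.1 p.2) :
    ∃ C, 0 ≤ C ∧ ∀ v : ℝ → ℝ, ContinuousOn v (Icc 0 1) → ∀ x ∈ Icc (0 : ℝ) 1,
      |volt k v x| ≤ C * ∫ ξ in (0 : ℝ)..1, |v ξ| := by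
  obtain ⟨C, hC⟩ := ((isCompact_Icc (a := (0 : ℝ)) (b := 1)).prod
    (isCompact_Icc (a := (0 : ℝ)) (b := 1))).exists_bound_of_continuousOn hk.continuousOn
  have hC0 : 0 ≤ C := (norm_nonneg _).trans (hC (0, 0) (by simp))
  refine ⟨C, hC0, fun v hv x hx => ?_⟩
  have hsub : uIoc (1 - x) x ⊆ Ioc 0 1 := by
    rw [uIoc]
    exact Ioc_subset_Ioc (le_min (by linarith [hx.2]) hx.1) (max_le (by linarith [hx.1]) hx.2)
  have hint : IntegrableOn (fun ξ => C * |v ξ|) (Ioc 0 1) :=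
    ((hv.abs.const_mul C).integrableOn_Icc).mono_set Ioc_subset_Icc_self
  calc |volt k v x| ≤ ∫ ξ in uIoc (1 - x) x, ‖k x ξ * v ξ‖ :=
        intervalIntegral.norm_integral_le_integral_norm_uIoc (f := fun ξ => k x ξ * v ξ)
    _ ≤ ∫ ξ in uIoc (1 - x) x, C * |v ξ| := by
        have hc : ContinuousOn (fun ξ => k x ξ * v ξ) (Icc 0 1) :=
          (hk.comp (Continuous.prodMk_right x)).continuousOn.mul hv
        refine setIntegral_mono_on
          (hc.norm.integrableOn_Icc.mono_set (hsub.trans Ioc_subset_Icc_self))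
          (hint.mono_set hsub) measurableSet_uIoc fun ξ hξ => ?_
        rw [norm_mul]
        exact mul_le_mul_of_nonneg_right (hC (x, ξ) ⟨hx, Ioc_subset_Icc_self (hsub hξ)⟩)
          (norm_nonneg _)
    _ ≤ ∫ ξ in Ioc (0 : ℝ) 1, C * |v ξ| :=
        setIntegral_mono_set hint (Eventually.of_forall fun ξ => by positivity) hsub.eventuallyLE
    _ = C * ∫ ξ in (0 : ℝ)..1, |v ξ| := by
        rw [intervalIntegral.integral_of_le zero_le_one, integral_const_mul]

/-! ### Families of functions on `[0,1]` depending on time -/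

/-- `V₁` is the `x`-derivative of `V` on `[0,1] × S`, and both are jointly continuous there. -/
structure C1Fam (S : Set ℝ) (V V₁ : ℝ → ℝ → ℝ) : Prop where
  deriv : ∀ t ∈ S, ∀ x ∈ Icc (0 : ℝ) 1, HasDerivWithinAt (fun z => V z t) (V₁ x t) (Icc 0 1) x
  cont : ContinuousOn (fun p : ℝ × ℝ => V p.1 p.2) (Icc 0 1 ×ˢ S)
  cont' : ContinuousOn (fun p : ℝ × ℝ => V₁ p.1 p.2) (Icc 0 1 ×ˢ S)

/-- `Vt` is the `t`-derivative of `V` on `[0,1] × S` and jointly continuous there. -/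
structure TimeFam (S : Set ℝ) (V Vt : ℝ → ℝ → ℝ) : Prop where
  deriv : ∀ x ∈ Icc (0 : ℝ) 1, ∀ t ∈ S, HasDerivAt (V x) (Vt x t) t
  cont : ContinuousOn (fun p : ℝ × ℝ => Vt p.1 p.2) (Icc 0 1 ×ˢ S)

/-- A jointly continuous function is continuous in the first variable. -/
theorem slice_continuousOn {S : Set ℝ} {V : ℝ → ℝ → ℝ}
    (h : ContinuousOn (fun p : ℝ × ℝ => V p.1 p.2) (Icc 0 1 ×ˢ S)) {t : ℝ} (ht : t ∈ S) :
    ContinuousOn (fun x => V x t) (Icc 0 1) :=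
  h.comp (f := fun x => (x, t)) (by fun_prop) fun _ hx => ⟨hx, ht⟩

theorem C1Fam.mono {S S' : Set ℝ} {V V₁ : ℝ → ℝ → ℝ} (h : C1Fam S V V₁) (hS : S' ⊆ S) :
    C1Fam S' V V₁ :=
  ⟨fun t ht => h.deriv t (hS ht), h.cont.mono (prod_mono Subset.rfl hS),
    h.cont'.mono (prod_mono Subset.rfl hS)⟩

/-! ### The backstepping transformation -/

/-- The backstepping transformation. -/
def trans (c : ℝ) (v : ℝ → ℝ) (x : ℝ) : ℝ := v x - volt (ker c) v x

/-- The derivative of `trans c v`, for `v' = v₁`. -/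
def trans1 (c : ℝ) (v v₁ : ℝ → ℝ) (x : ℝ) : ℝ :=
  v₁ x + c * (2 * x - 1) * v x - volt (kerX c) v x

/-- The second derivative of `volt (ker c) v`, for `v' = v₁`. -/
def volt2 (c : ℝ) (v v₁ : ℝ → ℝ) (x : ℝ) : ℝ :=
  kerX c x x * v x + kerX c x (1 - x) * v (1 - x) + volt (kerXX c) v x
    - (2 * c * v x + c * (2 * x - 1) * v₁ x)

theorem hasDerivWithinAt_volt_ker (c : ℝ) {v : ℝ → ℝ} (hv : ContinuousOn v (Icc 0 1)) {x : ℝ}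
    (hx : x ∈ Icc (0 : ℝ) 1) :
    HasDerivWithinAt (volt (ker c) v) (volt (kerX c) v x - c * (2 * x - 1) * v x) (Icc 0 1) x := by
  refine (hasDerivWithinAt_volt (continuous_ker c) (continuous_kerX c) (hasDerivAt_ker_x c)
    hv hx).congr_deriv ?_
  rw [ker_diag, ker_antidiag]; ring

theorem hasDerivWithinAt_volt_ker1 (c : ℝ) {v v₁ : ℝ → ℝ} {x : ℝ}
    (hv : ∀ x ∈ Icc (0 : ℝ) 1, HasDerivWithinAt v (v₁ x) (Icc 0 1) x) (hx : x ∈ Icc (0 : ℝ) 1) :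
    HasDerivWithinAt (fun x => volt (kerX c) v x - c * (2 * x - 1) * v x) (volt2 c v v₁ x)
      (Icc 0 1) x := by
  have h1 : HasDerivWithinAt (fun x : ℝ => c * (2 * x - 1)) (c * 2) (Icc 0 1) x := by
    simpa using ((((hasDerivAt_id x).const_mul 2).sub_const 1).const_mul c).hasDerivWithinAt
  refine ((hasDerivWithinAt_volt (continuous_kerX c) (continuous_kerXX c) (hasDerivAt_kerX_x c)
    (fun x hx => (hv x hx).continuousWithinAt) hx).sub (h1.mul (hv x hx))).congr_deriv ?_
  rw [volt2]; ring

theorem hasDerivWithinAt_trans (c : ℝ) {v v₁ : ℝ → ℝ} {x : ℝ}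
    (hv : ∀ x ∈ Icc (0 : ℝ) 1, HasDerivWithinAt v (v₁ x) (Icc 0 1) x) (hx : x ∈ Icc (0 : ℝ) 1) :
    HasDerivWithinAt (trans c v) (trans1 c v v₁ x) (Icc 0 1) x := by
  refine ((hv x hx).sub (hasDerivWithinAt_volt_ker c
    (fun x hx => (hv x hx).continuousWithinAt) hx)).congr_deriv ?_
  rw [trans1]; ring

theorem hasDerivWithinAt_trans1 (c : ℝ) {v v₁ : ℝ → ℝ} {v₂ : ℝ} {x : ℝ}
    (hv : ∀ x ∈ Icc (0 : ℝ) 1, HasDerivWithinAt v (v₁ x) (Icc 0 1) x)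
    (hv₁ : HasDerivWithinAt v₁ v₂ (Icc 0 1) x) (hx : x ∈ Icc (0 : ℝ) 1) :
    HasDerivWithinAt (trans1 c v v₁) (v₂ - volt2 c v v₁ x) (Icc 0 1) x := by
  refine (hv₁.sub (hasDerivWithinAt_volt_ker1 c hv hx)).congr (fun z _ => ?_) ?_ <;>
  · simp only [trans1, Pi.sub_apply]; ring

/-- The transformation conjugates `∂ₓ²` to `∂ₓ² - 4c`, without any boundary condition. -/
theorem trans_intertwine (c : ℝ) {v v₁ v₂ : ℝ → ℝ} {x : ℝ}
    (hv : ∀ x ∈ Icc (0 : ℝ) 1, HasDerivWithinAt v (v₁ x) (Icc 0 1) x)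
    (hv₁ : ∀ x ∈ Icc (0 : ℝ) 1, HasDerivWithinAt v₁ (v₂ x) (Icc 0 1) x)
    (hv₂ : ContinuousOn v₂ (Icc 0 1)) (hx : x ∈ Icc (0 : ℝ) 1) :
    v₂ x - volt2 c v v₁ x = trans c v₂ x + 4 * c * trans c v x := by
  have hs := uIcc_one_sub_subset hx
  have hc : ContinuousOn v (uIcc (1 - x) x) := fun y hy => (hv y (hs hy)).continuousWithinAt.mono hs
  have hc₁ : ContinuousOn v₁ (uIcc (1 - x) x) :=
    fun y hy => (hv₁ y (hs hy)).continuousWithinAt.mono hs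
  have hcont : ∀ k : ℝ → ℝ → ℝ, Continuous (fun p : ℝ × ℝ => k p.1 p.2) → Continuous (k x) :=
    fun k hk => hk.comp (Continuous.prodMk_right x)
  -- Two integrations by parts move both derivatives from v to the ξ-variable of the kernel.
  have ibp1 : volt (ker c) v₂ x = ker c x x * v₁ x - ker c x (1 - x) * v₁ (1 - x)
      - volt (kerY c) v₁ x :=
    intervalIntegral.integral_mul_deriv_eq_deriv_mul_of_hasDerivWithinAt
      (fun y _ => (hasDerivAt_ker_y c x y).hasDerivWithinAt)
      (fun y hy => (hv₁ y (hs hy)).mono hs)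
      ((hcont _ (continuous_kerY c)).intervalIntegrable _ _) ((hv₂.mono hs).intervalIntegrable)
  have ibp2 : volt (kerY c) v₁ x = kerY c x x * v x - kerY c x (1 - x) * v (1 - x)
      - volt (kerYY c) v x :=
    intervalIntegral.integral_mul_deriv_eq_deriv_mul_of_hasDerivWithinAt
      (fun y _ => (hasDerivAt_kerY_y c x y).hasDerivWithinAt)
      (fun y hy => (hv y (hs hy)).mono hs)
      ((hcont _ (continuous_kerYY c)).intervalIntegrable _ _) hc₁.intervalIntegrable
  have wave : volt (kerXX c) v x - volt (kerYY c) v x = 4 * c * volt (ker c) v x := by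
    simp only [volt]
    rw [← intervalIntegral.integral_sub, ← intervalIntegral.integral_const_mul]
    · refine intervalIntegral.integral_congr fun ξ _ => ?_
      linear_combination v ξ * ker_wave c x ξ
    · exact ((hcont _ (continuous_kerXX c)).continuousOn.mul hc).intervalIntegrable
    · exact ((hcont _ (continuous_kerYY c)).continuousOn.mul hc).intervalIntegrable
  simp only [trans, volt2]
  have h1 := ker_diag c x
  have h2 := ker_antidiag c x
  have h3 := kerX_antidiag c x
  have h4 := kerX_add_kerY_diag c x
  -- All boundary terms cancel: the one with v'(1-x) since the kernel vanishes there, those with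
  -- v(1-x) by h3, those with v'(x) by h1, and those with v(x) leave the multiple of v(x) that h4
  -- accounts for.
  rw [ibp1, ibp2, h1, h2, h3]
  linear_combination (-v x) * h4 - wave

theorem continuousOn_trans (c : ℝ) {v : ℝ → ℝ} (hv : ContinuousOn v (Icc 0 1)) :
    ContinuousOn (trans c v) (Icc 0 1) :=
  hv.sub (continuousOn_volt_slice (continuous_ker c) hv)

/-! ### Linearity and inversion of the backstepping transformation. -/

theorem volt_integrable {k : ℝ → ℝ → ℝ} (hk : Continuous fun p : ℝ × ℝ => k p.1 p.2)
    {v : ℝ → ℝ} (hv : ContinuousOn v (Icc 0 1)) {x : ℝ} (hx : x ∈ Icc (0 : ℝ) 1) :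
    IntervalIntegrable (fun ξ => k x ξ * v ξ) volume (1 - x) x :=
  ((hk.comp (Continuous.prodMk_right x)).continuousOn.mul
    (hv.mono (uIcc_one_sub_subset hx))).intervalIntegrable

theorem volt_sub {k : ℝ → ℝ → ℝ} (hk : Continuous fun p : ℝ × ℝ => k p.1 p.2)
    {v w : ℝ → ℝ} (hv : ContinuousOn v (Icc 0 1)) (hw : ContinuousOn w (Icc 0 1)) {x : ℝ}
    (hx : x ∈ Icc (0 : ℝ) 1) : volt k (fun z => v z - w z) x = volt k v x - volt k w x := by
  simp only [volt]
  rw [← intervalIntegral.integral_sub (volt_integrable hk hv hx) (volt_integrable hk hw hx)]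
  simp only [mul_sub]

theorem volt_const_mul (k : ℝ → ℝ → ℝ) (r : ℝ) (v : ℝ → ℝ) (x : ℝ) :
    volt k (fun z => r * v z) x = r * volt k v x := by
  simp only [volt]
  rw [← intervalIntegral.integral_const_mul]
  refine intervalIntegral.integral_congr fun ξ _ => ?_
  ring

theorem trans_sub (c : ℝ) {v w : ℝ → ℝ} (hv : ContinuousOn v (Icc 0 1))
    (hw : ContinuousOn w (Icc 0 1)) {x : ℝ} (hx : x ∈ Icc (0 : ℝ) 1) :
    trans c (fun z => v z - w z) x = trans c v x - trans c w x := by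
  simp only [trans, volt_sub (continuous_ker c) hv hw hx]; ring

theorem trans_const_mul (c r : ℝ) (v : ℝ → ℝ) (x : ℝ) :
    trans c (fun z => r * v z) x = r * trans c v x := by
  simp only [trans, volt_const_mul]; ring

theorem trans_add (c : ℝ) {v w : ℝ → ℝ} (hv : ContinuousOn v (Icc 0 1))
    (hw : ContinuousOn w (Icc 0 1)) {x : ℝ} (hx : x ∈ Icc (0 : ℝ) 1) :
    trans c (fun z => v z + w z) x = trans c v x + trans c w x := by
  have := trans_sub c hv (hw.const_mul (-1)) hx
  rw [trans_const_mul] at this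
  simpa only [neg_one_mul, sub_neg_eq_add] using this

theorem trans_congr (c : ℝ) {v w : ℝ → ℝ} (h : EqOn v w (Icc 0 1)) {x : ℝ}
    (hx : x ∈ Icc (0 : ℝ) 1) : trans c v x = trans c w x := by
  simp only [trans, h hx, volt_congr h hx]

/-- A function on `[0,1]` with vanishing second derivative and vanishing data at `1/2` is zero. -/
theorem eq_zero_of_second_deriv {f f₁ : ℝ → ℝ}
    (h : ∀ x ∈ Icc (0 : ℝ) 1, HasDerivWithinAt f (f₁ x) (Icc 0 1) x)
    (h₁ : ∀ x ∈ Icc (0 : ℝ) 1, HasDerivWithinAt f₁ 0 (Icc 0 1) x)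
    (h0 : f (1 / 2) = 0) (h01 : f₁ (1 / 2) = 0) {x : ℝ} (hx : x ∈ Icc (0 : ℝ) 1) : f x = 0 := by
  have hm : (1 / 2 : ℝ) ∈ Icc (0 : ℝ) 1 := by norm_num
  have key : ∀ g : ℝ → ℝ, (∀ x ∈ Icc (0 : ℝ) 1, HasDerivWithinAt g 0 (Icc 0 1) x) →
      g (1 / 2) = 0 → ∀ x ∈ Icc (0 : ℝ) 1, g x = 0 := by
    intro g hg hg0 x hx
    have := (convex_Icc (0 : ℝ) 1).norm_image_sub_le_of_norm_hasDerivWithin_le (C := 0) hg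
      (fun y _ => by simp) hm hx
    rw [hg0, sub_zero, zero_mul] at this
    exact norm_le_zero_iff.1 this
  have hf₁ := key f₁ h₁ h01
  exact key f (fun y hy => by simpa [hf₁ y hy] using h y hy) h0 x hx

theorem volt_half (k : ℝ → ℝ → ℝ) (v : ℝ → ℝ) : volt k v (1 / 2) = 0 := by
  rw [volt, show (1 - 1 / 2 : ℝ) = 1 / 2 by norm_num, intervalIntegral.integral_same]

theorem trans_half (c : ℝ) (v : ℝ → ℝ) : trans c v (1 / 2) = v (1 / 2) := by
  rw [trans, volt_half, sub_zero]

theorem trans1_half (c : ℝ) (v v₁ : ℝ → ℝ) : trans1 c v v₁ (1 / 2) = v₁ (1 / 2) := by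
  rw [trans1, volt_half]; ring

/-- The shifts by 4c and -4c cancel, so the second derivative of the composition applied to v is the
composition applied to v''. By induction on the degree the latter equals v''. The difference from v
then has zero second derivative, and it vanishes with its derivative at x = 1/2, where the interval
`[1-x,x]` is a point. -/
theorem trans_neg_trans_polynomial (c : ℝ) (n : ℕ) : ∀ p : Polynomial ℝ, p.natDegree < n →
    ∀ x ∈ Icc (0 : ℝ) 1, trans (-c) (trans c fun z => p.eval z) x = p.eval x := by
  induction n with
  | zero => intro p hp; exact absurd hp (Nat.not_lt_zero _)
  | succ n ih =>
    intro p hp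
    set v : ℝ → ℝ := fun z => p.eval z
    set v₁ : ℝ → ℝ := fun z => p.derivative.eval z
    set v₂ : ℝ → ℝ := fun z => p.derivative.derivative.eval z
    have hv : ∀ x ∈ Icc (0 : ℝ) 1, HasDerivWithinAt v (v₁ x) (Icc 0 1) x :=
      fun x _ => (p.hasDerivAt x).hasDerivWithinAt
    have hv₁ : ∀ x ∈ Icc (0 : ℝ) 1, HasDerivWithinAt v₁ (v₂ x) (Icc 0 1) x :=
      fun x _ => (p.derivative.hasDerivAt x).hasDerivWithinAt
    have hv₂ : ContinuousOn v₂ (Icc 0 1) := p.derivative.derivative.continuous.continuousOn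
    have hR : ∀ x ∈ Icc (0 : ℝ) 1, trans (-c) (trans c v₂) x = v₂ x := by
      -- The zero polynomial has `natDegree` 0, so the degree need not drop here; both sides are
      -- then zero.
      by_cases h0 : p.derivative.derivative = 0
      · intro x _
        simp [v₂, h0, trans, volt]
      · refine ih _ ?_
        have h1 : p.derivative ≠ 0 := by rintro h; simp [h] at h0
        have h2 := Polynomial.natDegree_derivative_le p
        have h3 := Polynomial.natDegree_derivative_le p.derivative
        have h4 : p.natDegree ≠ 0 := by
          intro h
          rw [Polynomial.eq_C_of_natDegree_eq_zero h] at h1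
          simp at h1
        omega
    have hg := fun x hx => hasDerivWithinAt_trans c (x := x) hv hx
    have hg₁ : ∀ x ∈ Icc (0 : ℝ) 1, HasDerivWithinAt (trans1 c v v₁)
        (trans c v₂ x + 4 * c * trans c v x) (Icc 0 1) x := fun x hx => by
      rw [← trans_intertwine c hv hv₁ hv₂ hx]
      exact hasDerivWithinAt_trans1 c hv (hv₁ x hx) hx
    have hgc : ContinuousOn (trans c v) (Icc 0 1) := fun x hx => (hg x hx).continuousWithinAt
    have hg2c : ContinuousOn (fun x => trans c v₂ x + 4 * c * trans c v x) (Icc 0 1) :=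
      (continuousOn_trans c hv₂).add (hgc.const_mul _)
    have hh := fun x hx => hasDerivWithinAt_trans (-c) (x := x) hg hx
    have hh₁ : ∀ x ∈ Icc (0 : ℝ) 1, HasDerivWithinAt (trans1 (-c) (trans c v) (trans1 c v v₁))
        (v₂ x) (Icc 0 1) x := fun x hx => by
      refine (hasDerivWithinAt_trans1 (-c) hg (hg₁ x hx) hx).congr_deriv ?_
      rw [trans_intertwine (-c) hg hg₁ hg2c hx, trans_add (-c) (continuousOn_trans c hv₂)
        (hgc.const_mul _) hx, trans_const_mul, hR x hx]
      ring
    intro x hx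
    refine sub_eq_zero.1 (eq_zero_of_second_deriv
      (f := fun x => trans (-c) (trans c v) x - v x)
      (f₁ := fun x => trans1 (-c) (trans c v) (trans1 c v v₁) x - v₁ x)
      (fun x hx => (hh x hx).sub (hv x hx))
      (fun x hx => ((hh₁ x hx).sub (hv₁ x hx)).congr_deriv (sub_self _)) ?_ ?_ hx)
    · simp only [trans_half, sub_self]
    · simp only [trans1_half, sub_self]

theorem exists_trans_bound (c : ℝ) : ∃ C, 0 ≤ C ∧ ∀ (v : ℝ → ℝ) (r : ℝ),
    ContinuousOn v (Icc 0 1) → (∀ x ∈ Icc (0 : ℝ) 1, |v x| ≤ r) →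
      ∀ x ∈ Icc (0 : ℝ) 1, |trans c v x| ≤ C * r := by
  obtain ⟨C, hC0, hC⟩ := exists_volt_bound (continuous_ker c)
  refine ⟨1 + C, by positivity, fun v r hv hr x hx => ?_⟩
  have h1 : ∫ ξ in (0 : ℝ)..1, |v ξ| ≤ r := by
    have := intervalIntegral.integral_mono_on (μ := volume) (zero_le_one' ℝ) (f := fun ξ => |v ξ|)
      (g := fun _ => r) (hv.abs.mono (by rw [uIcc_of_le zero_le_one])).intervalIntegrable
      intervalIntegrable_const hr
    simpa using this
  calc |trans c v x| ≤ |v x| + |volt (ker c) v x| := abs_sub _ _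
    _ ≤ r + C * r := add_le_add (hr x hx)
        ((hC v hv x hx).trans (mul_le_mul_of_nonneg_left h1 hC0))
    _ = (1 + C) * r := by ring

/-- Weierstrass approximation carries the identity from polynomials to continuous functions, both
transformations being bounded in the sup norm. This avoids composing the two kernels. The tolerance
δ is chosen so that δ + DCδ = e. -/
theorem trans_neg_trans (c : ℝ) {v : ℝ → ℝ} (hv : ContinuousOn v (Icc 0 1)) {x : ℝ}
    (hx : x ∈ Icc (0 : ℝ) 1) : trans (-c) (trans c v) x = v x := by
  obtain ⟨C, hC0, hC⟩ := exists_trans_bound c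
  obtain ⟨D, hD0, hD⟩ := exists_trans_bound (-c)
  refine eq_of_forall_dist_le fun e he => ?_
  set δ := e / (D * C + 1)
  have hδ : 0 < δ := by positivity
  obtain ⟨p, hp⟩ := exists_polynomial_near_of_continuousOn 0 1 v hv δ hδ
  set q : ℝ → ℝ := fun z => p.eval z
  have hq : ContinuousOn q (Icc 0 1) := p.continuous.continuousOn
  have h1 : trans (-c) (trans c q) x = q x :=
    trans_neg_trans_polynomial c _ p (Nat.lt_succ_self _) x hx
  have h2 : trans (-c) (trans c fun z => q z - v z) x
      = trans (-c) (trans c q) x - trans (-c) (trans c v) x := by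
    rw [← trans_sub (-c) (continuousOn_trans c hq) (continuousOn_trans c hv) hx]
    exact trans_congr (-c) (fun z hz => trans_sub c hq hv hz) hx
  have hqv : ContinuousOn (fun z => q z - v z) (Icc 0 1) := hq.sub hv
  have h3 := hD _ _ (continuousOn_trans c hqv)
    (hC _ δ hqv fun z hz => (hp z hz).le) x hx
  rw [h2, h1] at h3
  have h4 := (hp x hx).le
  rw [Real.dist_eq]
  calc |trans (-c) (trans c v) x - v x|
      = |(q x - v x) - (q x - trans (-c) (trans c v) x)| := by congr 1; ring
    _ ≤ |q x - v x| + |q x - trans (-c) (trans c v) x| := abs_sub _ _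
    _ ≤ δ + D * (C * δ) := add_le_add h4 h3
    _ = e := by simp only [δ]; field_simp; ring

/-! ### Operations on families with continuous derivatives. -/

theorem continuousOn_reflect {S : Set ℝ} {V : ℝ → ℝ → ℝ}
    (h : ContinuousOn (fun p : ℝ × ℝ => V p.1 p.2) (Icc 0 1 ×ˢ S)) :
    ContinuousOn (fun p : ℝ × ℝ => V (1 - p.1) p.2) (Icc 0 1 ×ˢ S) :=
  h.comp (f := fun p : ℝ × ℝ => (1 - p.1, p.2)) (by fun_prop) fun p hp =>
    ⟨⟨by linarith [hp.1.2], by linarith [hp.1.1]⟩, hp.2⟩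

theorem C1Fam.volt_ker {S : Set ℝ} {V V₁ : ℝ → ℝ → ℝ} (h : C1Fam S V V₁) (c : ℝ) :
    C1Fam S (fun x t => volt (ker c) (fun z => V z t) x)
      (fun x t => volt (kerX c) (fun z => V z t) x - c * (2 * x - 1) * V x t) where
  deriv t ht x hx := hasDerivWithinAt_volt_ker c (slice_continuousOn h.cont ht) hx
  cont := continuousOn_volt (continuous_ker c) h.cont
  cont' := (continuousOn_volt (continuous_kerX c) h.cont).sub
    (ContinuousOn.mul (by fun_prop) h.cont)

theorem C1Fam.volt_ker1 {S : Set ℝ} {V V₁ : ℝ → ℝ → ℝ} (h : C1Fam S V V₁) (c : ℝ) :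
    C1Fam S (fun x t => volt (kerX c) (fun z => V z t) x - c * (2 * x - 1) * V x t)
      (fun x t => volt2 c (fun z => V z t) (fun z => V₁ z t) x) where
  deriv t ht x hx := hasDerivWithinAt_volt_ker1 c (h.deriv t ht) hx
  cont := (h.volt_ker c).cont'
  cont' := by
    have h1 : Continuous fun p : ℝ × ℝ => kerX c p.1 p.1 :=
      (continuous_kerX c).comp (f := fun p : ℝ × ℝ => (p.1, p.1)) (by fun_prop)
    have h2 : Continuous fun p : ℝ × ℝ => kerX c p.1 (1 - p.1) :=
      (continuous_kerX c).comp (f := fun p : ℝ × ℝ => (p.1, 1 - p.1)) (by fun_prop)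
    exact (((h1.continuousOn.mul h.cont).add (h2.continuousOn.mul (continuousOn_reflect h.cont))).add
      (continuousOn_volt (continuous_kerXX c) h.cont)).sub
      ((h.cont.const_mul _).add (ContinuousOn.mul (by fun_prop) h.cont'))

theorem C1Fam.sub {S : Set ℝ} {V V₁ W W₁ : ℝ → ℝ → ℝ} (h : C1Fam S V V₁) (h' : C1Fam S W W₁) :
    C1Fam S (fun x t => V x t - W x t) (fun x t => V₁ x t - W₁ x t) :=
  ⟨fun t ht x hx => (h.deriv t ht x hx).sub (h'.deriv t ht x hx), h.cont.sub h'.cont,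
    h.cont'.sub h'.cont'⟩

theorem C1Fam.add {S : Set ℝ} {V V₁ W W₁ : ℝ → ℝ → ℝ} (h : C1Fam S V V₁) (h' : C1Fam S W W₁) :
    C1Fam S (fun x t => V x t + W x t) (fun x t => V₁ x t + W₁ x t) :=
  ⟨fun t ht x hx => (h.deriv t ht x hx).add (h'.deriv t ht x hx), h.cont.add h'.cont,
    h.cont'.add h'.cont'⟩

theorem C1Fam.mul {S : Set ℝ} {V V₁ W W₁ : ℝ → ℝ → ℝ} (h : C1Fam S V V₁) (h' : C1Fam S W W₁) :
    C1Fam S (fun x t => V x t * W x t) (fun x t => V₁ x t * W x t + V x t * W₁ x t) :=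
  ⟨fun t ht x hx => (h.deriv t ht x hx).mul (h'.deriv t ht x hx), h.cont.mul h'.cont,
    (h.cont'.mul h'.cont).add (h.cont.mul h'.cont')⟩

theorem C1Fam.congr {S : Set ℝ} {V V₁ W W₁ : ℝ → ℝ → ℝ} (h : C1Fam S V V₁)
    (e : ∀ x ∈ Icc (0 : ℝ) 1, ∀ t ∈ S, W x t = V x t)
    (e₁ : ∀ x ∈ Icc (0 : ℝ) 1, ∀ t ∈ S, W₁ x t = V₁ x t) : C1Fam S W W₁ :=
  ⟨fun t ht x hx => by
    rw [e₁ x hx t ht]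
    exact (h.deriv t ht x hx).congr (fun z hz => e z hz t ht) (e x hx t ht),
   h.cont.congr fun p hp => e p.1 hp.1 p.2 hp.2,
   h.cont'.congr fun p hp => e₁ p.1 hp.1 p.2 hp.2⟩

theorem TimeFam.volt {S : Set ℝ} (hS : IsOpen S) {V Vt : ℝ → ℝ → ℝ} (h : TimeFam S V Vt)
    (hV : ContinuousOn (fun p : ℝ × ℝ => V p.1 p.2) (Icc 0 1 ×ˢ S)) (c : ℝ) :
    TimeFam S (fun x t => volt (ker c) (fun z => V z t) x)
      (fun x t => volt (ker c) (fun z => Vt z t) x) :=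
  ⟨fun _ hx _ ht => hasDerivAt_volt_time (continuous_ker c) hS hV h.cont h.deriv hx ht,
    continuousOn_volt (continuous_ker c) h.cont⟩

theorem TimeFam.sub {S : Set ℝ} {V Vt W Wt : ℝ → ℝ → ℝ} (h : TimeFam S V Vt)
    (h' : TimeFam S W Wt) : TimeFam S (fun x t => V x t - W x t) (fun x t => Vt x t - Wt x t) :=
  ⟨fun x hx t ht => (h.deriv x hx t ht).sub (h'.deriv x hx t ht), h.cont.sub h'.cont⟩

theorem TimeFam.add {S : Set ℝ} {V Vt W Wt : ℝ → ℝ → ℝ} (h : TimeFam S V Vt)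
    (h' : TimeFam S W Wt) : TimeFam S (fun x t => V x t + W x t) (fun x t => Vt x t + Wt x t) :=
  ⟨fun x hx t ht => (h.deriv x hx t ht).add (h'.deriv x hx t ht), h.cont.add h'.cont⟩

theorem TimeFam.mono {S S' : Set ℝ} {V Vt : ℝ → ℝ → ℝ} (h : TimeFam S V Vt) (hS : S' ⊆ S) :
    TimeFam S' V Vt :=
  ⟨fun x hx t ht => h.deriv x hx t (hS ht), h.cont.mono (prod_mono Subset.rfl hS)⟩

/-! ### The `H¹` energy -/

/-- `∫₀¹ (f² + f₁²)`, the squared `H¹` norm of `f` when `f₁ = f'`. -/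
def energy (f f₁ : ℝ → ℝ) : ℝ := ∫ x in (0 : ℝ)..1, (f x ^ 2 + f₁ x ^ 2)

theorem ii_of_continuousOn {f : ℝ → ℝ} (hf : ContinuousOn f (Icc 0 1)) :
    IntervalIntegrable f volume 0 1 :=
  (hf.mono (by rw [uIcc_of_le zero_le_one])).intervalIntegrable

theorem energy_eq {f f₁ : ℝ → ℝ} (hf : ContinuousOn f (Icc 0 1)) (hf₁ : ContinuousOn f₁ (Icc 0 1)) :
    energy f f₁ = (∫ x in (0 : ℝ)..1, f x ^ 2) + ∫ x in (0 : ℝ)..1, f₁ x ^ 2 :=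
  intervalIntegral.integral_add (ii_of_continuousOn (hf.pow 2)) (ii_of_continuousOn (hf₁.pow 2))

theorem energy_le_of_pointwise {f f₁ g g₁ : ℝ → ℝ} {C : ℝ} (hf : ContinuousOn f (Icc 0 1))
    (hf₁ : ContinuousOn f₁ (Icc 0 1)) (hg : ContinuousOn g (Icc 0 1))
    (hg₁ : ContinuousOn g₁ (Icc 0 1))
    (h : ∀ x ∈ Icc (0 : ℝ) 1, f x ^ 2 + f₁ x ^ 2 ≤ C * (g x ^ 2 + g₁ x ^ 2)) :
    energy f f₁ ≤ C * energy g g₁ := by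
  rw [energy, energy, ← intervalIntegral.integral_const_mul]
  exact intervalIntegral.integral_mono_on zero_le_one
    (ii_of_continuousOn ((hf.pow 2).add (hf₁.pow 2)))
    (ii_of_continuousOn (((hg.pow 2).add (hg₁.pow 2)).const_mul C)) h

/-- The Sobolev embedding of H¹ in the sup norm. The increment f(x)² - f(y)² = ∫ 2ff' is at most one
energy; averaging over y adds ∫ f², at most another. -/
theorem sq_le_energy {f f₁ : ℝ → ℝ}
    (hd : ∀ x ∈ Icc (0 : ℝ) 1, HasDerivWithinAt f (f₁ x) (Icc 0 1) x)
    (hf₁ : ContinuousOn f₁ (Icc 0 1)) {x : ℝ} (hx : x ∈ Icc (0 : ℝ) 1) :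
    f x ^ 2 ≤ 2 * energy f f₁ := by
  have hf : ContinuousOn f (Icc 0 1) := fun y hy => (hd y hy).continuousWithinAt
  have key : ∀ y ∈ Icc (0 : ℝ) 1, f x ^ 2 - energy f f₁ ≤ f y ^ 2 := by
    intro y hy
    have hsub : uIcc y x ⊆ Icc 0 1 := uIcc_subset_Icc hy hx
    have hsub' : uIoc y x ⊆ Ioc 0 1 := by
      rw [uIoc]
      exact Ioc_subset_Ioc (le_min hy.1 hx.1) (max_le hy.2 hx.2)
    have ftc : ∫ z in y..x, 2 * (f z * f₁ z) = f x ^ 2 - f y ^ 2 := by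
      refine intervalIntegral.integral_eq_sub_of_hasDeriv_right
        ((hf.mono hsub).pow 2) (fun z hz => ?_)
        (((hf.mul hf₁).const_mul 2).mono hsub).intervalIntegrable
      have hz' : z ∈ Ioo (0 : ℝ) 1 :=
        ⟨lt_of_le_of_lt (le_min hy.1 hx.1) hz.1, lt_of_lt_of_le hz.2 (max_le hy.2 hx.2)⟩
      have := ((hd z (Ioo_subset_Icc_self hz')).hasDerivAt
        (Icc_mem_nhds hz'.1 hz'.2)).pow 2
      refine this.hasDerivWithinAt.congr_deriv ?_
      push_cast; ring
    have hle : |∫ z in y..x, 2 * (f z * f₁ z)| ≤ energy f f₁ := by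
      calc |∫ z in y..x, 2 * (f z * f₁ z)| ≤ ∫ z in uIoc y x, ‖2 * (f z * f₁ z)‖ :=
            intervalIntegral.norm_integral_le_integral_norm_uIoc (f := fun z => 2 * (f z * f₁ z))
        _ ≤ ∫ z in uIoc y x, (f z ^ 2 + f₁ z ^ 2) := by
            refine setIntegral_mono_on
              (((hf.mul hf₁).const_mul 2).norm.integrableOn_Icc.mono_set
                (hsub'.trans Ioc_subset_Icc_self))
              (((hf.pow 2).add (hf₁.pow 2)).integrableOn_Icc.mono_set
                (hsub'.trans Ioc_subset_Icc_self)) measurableSet_uIoc fun z _ => ?_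
            rw [Real.norm_eq_abs, abs_le]
            constructor <;> nlinarith [sq_nonneg (f z + f₁ z), sq_nonneg (f z - f₁ z)]
        _ ≤ ∫ z in Ioc (0 : ℝ) 1, (f z ^ 2 + f₁ z ^ 2) :=
            setIntegral_mono_set (((hf.pow 2).add (hf₁.pow 2)).integrableOn_Icc.mono_set
                Ioc_subset_Icc_self) (Eventually.of_forall fun z => by positivity)
              hsub'.eventuallyLE
        _ = energy f f₁ := by rw [energy, intervalIntegral.integral_of_le zero_le_one]
    rw [ftc] at hle
    linarith [le_abs_self (f x ^ 2 - f y ^ 2)]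
  have h1 := intervalIntegral.integral_mono_on (μ := volume) (zero_le_one' ℝ)
    intervalIntegrable_const (ii_of_continuousOn (hf.pow 2)) key
  have h2 : ∫ y in (0 : ℝ)..1, f y ^ 2 ≤ energy f f₁ := by
    rw [energy_eq hf hf₁]
    have : 0 ≤ ∫ x in (0 : ℝ)..1, f₁ x ^ 2 :=
      intervalIntegral.integral_nonneg zero_le_one fun x _ => sq_nonneg _
    linarith
  simp at h1
  linarith

theorem exists_trans_energy_bound (c : ℝ) : ∃ C, 0 < C ∧ ∀ v v₁ : ℝ → ℝ,
    ContinuousOn v (Icc 0 1) → ContinuousOn v₁ (Icc 0 1) →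
      energy (trans c v) (trans1 c v v₁) ≤ C * energy v v₁ := by
  obtain ⟨A, hA0, hA⟩ := exists_volt_bound (continuous_ker c)
  obtain ⟨B, hB0, hB⟩ := exists_volt_bound (continuous_kerX c)
  -- The square of a sum of two terms in `trans` costs a factor 2, that of three terms in `trans1` a
  -- factor 3; A and B bound the two integral operators, and |2x-1| ≤ 1.
  refine ⟨3 + 3 * c ^ 2 + 2 * A ^ 2 + 3 * B ^ 2, by positivity, fun v v₁ hv hv₁ => ?_⟩
  set N := ∫ x in (0 : ℝ)..1, v x ^ 2
  have hN : (∫ x in (0 : ℝ)..1, |v x|) ^ 2 ≤ N := sq_integral_abs_le hv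
  have hN1 : N ≤ energy v v₁ := by
    rw [energy_eq hv hv₁]
    have : 0 ≤ ∫ x in (0 : ℝ)..1, v₁ x ^ 2 :=
      intervalIntegral.integral_nonneg zero_le_one fun x _ => sq_nonneg _
    linarith
  have sqb : ∀ {k : ℝ → ℝ → ℝ} {D : ℝ}, (∀ v : ℝ → ℝ, ContinuousOn v (Icc 0 1) →
      ∀ x ∈ Icc (0 : ℝ) 1, |volt k v x| ≤ D * ∫ ξ in (0 : ℝ)..1, |v ξ|) →
      ∀ x ∈ Icc (0 : ℝ) 1, volt k v x ^ 2 ≤ D ^ 2 * N := by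
    intro k D hD x hx
    calc volt k v x ^ 2 = |volt k v x| ^ 2 := (sq_abs _).symm
      _ ≤ (D * ∫ ξ in (0 : ℝ)..1, |v ξ|) ^ 2 := by gcongr; exact hD v hv x hx
      _ ≤ D ^ 2 * N := by rw [mul_pow]; gcongr
  have hT : ContinuousOn (trans1 c v v₁) (Icc 0 1) :=
    (hv₁.add (ContinuousOn.mul (by fun_prop) hv)).sub
      (continuousOn_volt_slice (continuous_kerX c) hv)
  have hpt : ∀ x ∈ Icc (0 : ℝ) 1, trans c v x ^ 2 + trans1 c v v₁ x ^ 2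
      ≤ (3 + 3 * c ^ 2) * (v x ^ 2 + v₁ x ^ 2) + (2 * A ^ 2 + 3 * B ^ 2) * N := by
    intro x hx
    have h1 := sqb hA x hx
    have h2 := sqb hB x hx
    have h3 : (c * (2 * x - 1) * v x) ^ 2 ≤ c ^ 2 * v x ^ 2 := by
      have : (2 * x - 1) ^ 2 ≤ 1 := by nlinarith [hx.1, hx.2]
      calc (c * (2 * x - 1) * v x) ^ 2 = (c ^ 2 * v x ^ 2) * (2 * x - 1) ^ 2 := by ring
        _ ≤ (c ^ 2 * v x ^ 2) * 1 := by gcongr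
        _ = _ := mul_one _
    rw [trans, trans1]
    have h4 := two_mul_le_add_sq (v x) (-volt (ker c) v x)
    have h5 := two_mul_le_add_sq (v₁ x) (c * (2 * x - 1) * v x)
    have h6 := two_mul_le_add_sq (v₁ x) (-volt (kerX c) v x)
    have h7 := two_mul_le_add_sq (c * (2 * x - 1) * v x) (-volt (kerX c) v x)
    have h8 : 0 ≤ c ^ 2 * v₁ x ^ 2 := by positivity
    have h9 : 0 ≤ v x ^ 2 := by positivity
    nlinarith
  calc energy (trans c v) (trans1 c v v₁)
      ≤ ∫ x in (0 : ℝ)..1, ((3 + 3 * c ^ 2) * (v x ^ 2 + v₁ x ^ 2)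
          + (2 * A ^ 2 + 3 * B ^ 2) * N) :=
        intervalIntegral.integral_mono_on zero_le_one
          (ii_of_continuousOn (((continuousOn_trans c hv).pow 2).add (hT.pow 2)))
          (ii_of_continuousOn ((((hv.pow 2).add (hv₁.pow 2)).const_mul _).add continuousOn_const))
          hpt
    _ = (3 + 3 * c ^ 2) * energy v v₁ + (2 * A ^ 2 + 3 * B ^ 2) * N := by
        rw [intervalIntegral.integral_add
          (f := fun x => (3 + 3 * c ^ 2) * (v x ^ 2 + v₁ x ^ 2))
          (ii_of_continuousOn (((hv.pow 2).add (hv₁.pow 2)).const_mul _))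
          intervalIntegrable_const, intervalIntegral.integral_const_mul, energy]
        simp
    _ ≤ (3 + 3 * c ^ 2) * energy v v₁ + (2 * A ^ 2 + 3 * B ^ 2) * energy v v₁ := by gcongr
    _ = _ := by ring

/-! ### Gevrey bounds -/

/-- `f` is smooth on `[0,∞)` with derivatives bounded by `C Kⁿ (n!)^γ`. -/
def GevBound (γ C K : ℝ) (f : ℝ → ℝ) : Prop :=
  ContDiffOn ℝ ∞ f (Ici 0) ∧
    ∀ n : ℕ, ∀ t ∈ Ici (0 : ℝ), |iteratedDerivWithin n f (Ici 0) t| ≤ C * K ^ n * (n ! : ℝ) ^ γ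

/-- Raise n! = C(n,i) i! (n-i)! to the power γ. As C(n,i) ≥ 1 and γ ≥ 1, the binomial coefficient is
at most its γ-th power. -/
theorem choose_mul_rpow_le {γ : ℝ} (hγ : 1 ≤ γ) {n i : ℕ} (hi : i ≤ n) :
    (n.choose i : ℝ) * ((i ! : ℝ) ^ γ * ((n - i)! : ℝ) ^ γ) ≤ (n ! : ℝ) ^ γ := by
  have h : (n.choose i : ℝ) * ((i ! : ℝ) * ((n - i)! : ℝ)) = (n ! : ℝ) := by
    rw [← mul_assoc]; exact_mod_cast Nat.choose_mul_factorial_mul_factorial hi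
  have hc : (1 : ℝ) ≤ n.choose i := by exact_mod_cast Nat.choose_pos hi
  have hc' : (n.choose i : ℝ) ≤ (n.choose i : ℝ) ^ γ := by
    simpa using Real.rpow_le_rpow_of_exponent_le hc hγ
  rw [← Real.mul_rpow (by positivity) (by positivity), ← h,
    Real.mul_rpow (x := (n.choose i : ℝ)) (by positivity) (by positivity)]
  exact mul_le_mul_of_nonneg_right hc' (by positivity)

/-- The version for the recursion g' = f'g, where one derivative always falls on f; it follows from
C(n,i) ≤ C(n+1,i+1). -/
theorem choose_succ_mul_rpow_le {γ : ℝ} (hγ : 1 ≤ γ) {n i : ℕ} (hi : i ≤ n) :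
    (n.choose i : ℝ) * (((i + 1)! : ℝ) ^ γ * ((n - i)! : ℝ) ^ γ) ≤ ((n + 1)! : ℝ) ^ γ := by
  have h := choose_mul_rpow_le hγ (Nat.succ_le_succ hi)
  rw [Nat.succ_sub_succ] at h
  refine le_trans (mul_le_mul_of_nonneg_right ?_ (by positivity)) h
  exact_mod_cast Nat.choose_succ_succ n i ▸ Nat.le_add_right _ _

theorem GevBound.nonneg {γ C K : ℝ} {f : ℝ → ℝ} (h : GevBound γ C K f) : 0 ≤ C := by
  have := (abs_nonneg _).trans (h.2 0 0 self_mem_Ici)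
  simpa using this

theorem GevBound.mono {γ C C' K K' : ℝ} {f : ℝ → ℝ} (h : GevBound γ C K f) (hC : C ≤ C')
    (hK0 : 0 ≤ K) (hK : K ≤ K') : GevBound γ C' K' f :=
  ⟨h.1, fun n t ht => (h.2 n t ht).trans (by
    have := h.nonneg
    have := this.trans hC
    gcongr)⟩

theorem GevBound.add {γ C D K : ℝ} {f g : ℝ → ℝ} (hf : GevBound γ C K f) (hg : GevBound γ D K g) :
    GevBound γ (C + D) K (fun t => f t + g t) := by
  refine ⟨hf.1.add hg.1, fun n t ht => ?_⟩
  rw [iteratedDerivWithin_fun_add ht (uniqueDiffOn_Ici 0)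
    ((hf.1 t ht).of_le (by exact_mod_cast le_top)) ((hg.1 t ht).of_le (by exact_mod_cast le_top))]
  calc _ ≤ _ := abs_add_le _ _
    _ ≤ C * K ^ n * (n ! : ℝ) ^ γ + D * K ^ n * (n ! : ℝ) ^ γ := add_le_add (hf.2 n t ht) (hg.2 n t ht)
    _ = _ := by ring

theorem GevBound.const_mul {γ C K : ℝ} {f : ℝ → ℝ} (hf : GevBound γ C K f) (r : ℝ) :
    GevBound γ (|r| * C) K (fun t => r * f t) := by
  refine ⟨contDiffOn_const.mul hf.1, fun n t ht => ?_⟩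
  rw [iteratedDerivWithin_const_mul_field, abs_mul]
  calc _ ≤ |r| * (C * K ^ n * (n ! : ℝ) ^ γ) := by gcongr; exact hf.2 n t ht
    _ = _ := by ring

/-- In Leibniz' rule each of the n+1 terms has the same bound, and n + 1 ≤ 2^n is paid for by
doubling K. -/
theorem GevBound.mul {γ C D K : ℝ} (hγ : 1 ≤ γ) (hK : 0 ≤ K) {f g : ℝ → ℝ} (hf : GevBound γ C K f)
    (hg : GevBound γ D K g) : GevBound γ (C * D) (2 * K) (fun t => f t * g t) := by
  refine ⟨hf.1.mul hg.1, fun n t ht => ?_⟩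
  have hC := hf.nonneg
  have hD := hg.nonneg
  have e := iteratedDerivWithin_mul (n := n) ht (uniqueDiffOn_Ici (0 : ℝ))
    ((hf.1 t ht).of_le (by exact_mod_cast le_top)) ((hg.1 t ht).of_le (by exact_mod_cast le_top))
  change iteratedDerivWithin n (fun t => f t * g t) _ _ = _ at e
  rw [e]
  calc _ ≤ ∑ i ∈ Finset.range (n + 1), |(n.choose i : ℝ) * iteratedDerivWithin i f (Ici 0) t
          * iteratedDerivWithin (n - i) g (Ici 0) t| := Finset.abs_sum_le_sum_abs _ _
    _ ≤ ∑ i ∈ Finset.range (n + 1), C * D * K ^ n * (n ! : ℝ) ^ γ := by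
        refine Finset.sum_le_sum fun i hi => ?_
        have hi' : i ≤ n := Nat.lt_succ_iff.1 (Finset.mem_range.1 hi)
        rw [abs_mul, abs_mul, Nat.abs_cast]
        calc (n.choose i : ℝ) * |iteratedDerivWithin i f (Ici 0) t|
              * |iteratedDerivWithin (n - i) g (Ici 0) t|
            ≤ (n.choose i : ℝ) * (C * K ^ i * (i ! : ℝ) ^ γ)
              * (D * K ^ (n - i) * ((n - i)! : ℝ) ^ γ) := by
              gcongr
              · exact hf.2 i t ht
              · exact hg.2 _ t ht
          _ = C * D * (K ^ i * K ^ (n - i))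
              * ((n.choose i : ℝ) * ((i ! : ℝ) ^ γ * ((n - i)! : ℝ) ^ γ)) := by ring
          _ ≤ C * D * K ^ n * (n ! : ℝ) ^ γ := by
              rw [← pow_add, Nat.add_sub_cancel' hi']
              gcongr
              exact choose_mul_rpow_le hγ hi'
    _ = ((n : ℝ) + 1) * (C * D * K ^ n * (n ! : ℝ) ^ γ) := by simp
    _ ≤ 2 ^ n * (C * D * K ^ n * (n ! : ℝ) ^ γ) := by
        gcongr
        exact_mod_cast Nat.lt_two_pow_self
    _ = _ := by rw [mul_pow]; ring

/-- Leibniz' rule for g' = f'g with g = e^f gives a recursion for the derivatives of g. The constant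
must be proportional to F, so that small outputs yield a small v^r: derivatives of positive order
inherit a factor F from f', and subtracting 1 supplies it at order 0. -/
theorem GevBound.exp_sub_one {γ F M : ℝ} (hγ : 1 ≤ γ) (hM : 0 < M) (hF : F ≤ 1) {f : ℝ → ℝ}
    (hf : GevBound γ F M f) : GevBound γ (3 * F) (2 * M) (fun t => Real.exp (f t) - 1) := by
  have hF0 := hf.nonneg
  have hs := uniqueDiffOn_Ici (0 : ℝ)
  set g : ℝ → ℝ := fun t => Real.exp (f t)
  have hg : ContDiffOn ℝ ∞ g (Ici 0) := Real.contDiff_exp.comp_contDiffOn hf.1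
  have hf0 : ∀ t ∈ Ici (0 : ℝ), |f t| ≤ F := fun t ht => by simpa using hf.2 0 t ht
  have hf' : ContDiffOn ℝ ∞ (derivWithin f (Ici 0)) (Ici 0) := hf.1.derivWithin hs (by simp)
  have hG : ∀ t ∈ Ici (0 : ℝ), |g t| ≤ 3 := fun t ht => by
    rw [abs_of_pos (Real.exp_pos _)]
    calc Real.exp (f t) ≤ Real.exp 1 :=
          Real.exp_le_exp.2 ((le_abs_self _).trans ((hf0 t ht).trans hF))
      _ ≤ 3 := by have := Real.exp_one_lt_d9; linarith
  have hrec : ∀ n : ℕ, ∀ t ∈ Ici (0 : ℝ), iteratedDerivWithin (n + 1) g (Ici 0) t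
      = ∑ i ∈ Finset.range (n + 1), (n.choose i : ℝ) * iteratedDerivWithin (i + 1) f (Ici 0) t
          * iteratedDerivWithin (n - i) g (Ici 0) t := by
    intro n t ht
    have e : EqOn (derivWithin g (Ici 0)) (derivWithin f (Ici 0) * g) (Ici 0) := fun s hs' => by
      have := ((hf.1.differentiableOn (by simp)) s hs').hasDerivWithinAt.exp
      rw [Pi.mul_apply, mul_comm]
      exact this.derivWithin (hs s hs')
    rw [iteratedDerivWithin_succ', iteratedDerivWithin_congr e ht, iteratedDerivWithin_mul ht hs
      ((hf' t ht).of_le (by exact_mod_cast le_top)) ((hg t ht).of_le (by exact_mod_cast le_top))]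
    simp only [iteratedDerivWithin_succ']
  -- The hypothesis carries the constant 3 > e and the conclusion 3F, so F ≤ 1 closes the induction.
  -- Doubling M makes the convolution a geometric sum, Σ 2^{n-i} < 2^{n+1}.
  have step : ∀ n : ℕ, (∀ m ≤ n, ∀ t ∈ Ici (0 : ℝ), |iteratedDerivWithin m g (Ici 0) t|
      ≤ 3 * (2 * M) ^ m * (m ! : ℝ) ^ γ) → ∀ t ∈ Ici (0 : ℝ),
      |iteratedDerivWithin (n + 1) g (Ici 0) t| ≤ 3 * F * (2 * M) ^ (n + 1) * ((n + 1)! : ℝ) ^ γ := by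
    intro n ih t ht
    rw [hrec n t ht]
    calc _ ≤ ∑ i ∈ Finset.range (n + 1), |(n.choose i : ℝ)
            * iteratedDerivWithin (i + 1) f (Ici 0) t
            * iteratedDerivWithin (n - i) g (Ici 0) t| := Finset.abs_sum_le_sum_abs _ _
      _ ≤ ∑ i ∈ Finset.range (n + 1),
            3 * F * M ^ (n + 1) * ((n + 1)! : ℝ) ^ γ * 2 ^ (n - i) := by
          refine Finset.sum_le_sum fun i hi => ?_
          have hi' : i ≤ n := Nat.lt_succ_iff.1 (Finset.mem_range.1 hi)
          rw [abs_mul, abs_mul, Nat.abs_cast]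
          calc (n.choose i : ℝ) * |iteratedDerivWithin (i + 1) f (Ici 0) t|
                * |iteratedDerivWithin (n - i) g (Ici 0) t|
              ≤ (n.choose i : ℝ) * (F * M ^ (i + 1) * ((i + 1)! : ℝ) ^ γ)
                * (3 * (2 * M) ^ (n - i) * ((n - i)! : ℝ) ^ γ) := by
                gcongr
                · exact hf.2 (i + 1) t ht
                · exact ih _ (Nat.sub_le _ _) t ht
            _ = 3 * F * (M ^ (i + 1) * M ^ (n - i)) * 2 ^ (n - i)
                * ((n.choose i : ℝ) * (((i + 1)! : ℝ) ^ γ * ((n - i)! : ℝ) ^ γ)) := by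
                rw [mul_pow]; ring
            _ ≤ 3 * F * M ^ (n + 1) * 2 ^ (n - i) * ((n + 1)! : ℝ) ^ γ := by
                rw [← pow_add, show i + 1 + (n - i) = n + 1 by omega]
                gcongr
                exact choose_succ_mul_rpow_le hγ hi'
            _ = _ := by ring
      _ = 3 * F * M ^ (n + 1) * ((n + 1)! : ℝ) ^ γ * ∑ i ∈ Finset.range (n + 1), 2 ^ (n - i) := by
          rw [Finset.mul_sum]
      _ ≤ 3 * F * M ^ (n + 1) * ((n + 1)! : ℝ) ^ γ * 2 ^ (n + 1) := by
          gcongr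
          have h1 := Finset.sum_range_reflect (fun i => (2 : ℝ) ^ i) (n + 1)
          simp only [Nat.add_sub_cancel] at h1
          rw [h1, geom_sum_eq (by norm_num)]
          have : (0 : ℝ) < 2 ^ (n + 1) := by positivity
          linarith
      _ = _ := by rw [mul_pow]; ring
  have main : ∀ n : ℕ, ∀ m ≤ n, ∀ t ∈ Ici (0 : ℝ), |iteratedDerivWithin m g (Ici 0) t|
      ≤ 3 * (2 * M) ^ m * (m ! : ℝ) ^ γ := by
    intro n
    induction n with
    | zero =>
      intro m hm t ht
      rw [Nat.le_zero.1 hm]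
      simpa using hG t ht
    | succ n ih =>
      intro m hm t ht
      rcases Nat.le_succ_iff.1 hm with h | rfl
      · exact ih m h t ht
      · refine (step n ih t ht).trans ?_
        gcongr
        linarith
  refine ⟨hg.sub contDiffOn_const, fun n t ht => ?_⟩
  rcases n with _ | n
  · have h1 := Real.abs_exp_sub_one_le ((hf0 t ht).trans hF)
    simp only [iteratedDerivWithin_zero, pow_zero, mul_one, Nat.factorial_zero, Nat.cast_one,
      Real.one_rpow]
    linarith [hf0 t ht]
  · have e : iteratedDerivWithin (n + 1) (fun t => Real.exp (f t) - 1) (Ici 0) t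
        = iteratedDerivWithin (n + 1) g (Ici 0) t := by
      rw [iteratedDerivWithin_succ', iteratedDerivWithin_succ']
      exact iteratedDerivWithin_congr (fun s _ => by simp only [derivWithin_sub_const, g]) ht
    rw [e]
    exact step n (main n) t ht

/-! ### Bounds for the coefficients of the reference trajectory -/

/-- After m! ≤ k! the sum is the binomial expansion of (K + a²b²/(4ε))^k. -/
theorem abs_refCoeff_le {ε a b γ C K : ℝ} (hε : 0 < ε) (hγ : 1 ≤ γ) (hK : 0 ≤ K) {y : ℝ → ℝ}
    (h : GevBound γ C K y) (k : ℕ) {t : ℝ} (ht : 0 ≤ t) :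
    |refCoeff ε a b y k t| ≤ C * ((k ! : ℝ) ^ γ * (K + a ^ 2 * b ^ 2 / (4 * ε)) ^ k) := by
  have hC := h.nonneg
  set L := a ^ 2 * b ^ 2 / (4 * ε)
  have hL : 0 ≤ L := by positivity
  rw [refCoeff, add_pow, Finset.mul_sum, Finset.mul_sum]
  refine (Finset.abs_sum_le_sum_abs _ _).trans (Finset.sum_le_sum fun m hm => ?_)
  have hm' : m ≤ k := Nat.lt_succ_iff.1 (Finset.mem_range.1 hm)
  rw [abs_mul, abs_of_nonneg (by positivity)]
  calc (k.choose m : ℝ) * L ^ (k - m) * |iteratedDerivWithin m y (Ici 0) t|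
      ≤ (k.choose m : ℝ) * L ^ (k - m) * (C * K ^ m * (k ! : ℝ) ^ γ) := by
        gcongr
        refine (h.2 m t ht).trans ?_
        gcongr
    _ = _ := by ring

/-- With L = a²b²/(4ε), `refCoeff` of index k is (∂_t + L)^k y, so ∂_t raises the index up to the
correction by L. In coordinates this is Pascal's rule. -/
theorem hasDerivWithinAt_refCoeff {ε a b : ℝ} {y : ℝ → ℝ} (h : ContDiffOn ℝ ∞ y (Ici 0)) (k : ℕ)
    {t : ℝ} (ht : 0 ≤ t) : HasDerivWithinAt (refCoeff ε a b y k)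
      (refCoeff ε a b y (k + 1) t - a ^ 2 * b ^ 2 / (4 * ε) * refCoeff ε a b y k t) (Ici 0) t := by
  set L := a ^ 2 * b ^ 2 / (4 * ε) with hL
  have hd : ∀ m : ℕ, HasDerivWithinAt (iteratedDerivWithin m y (Ici 0))
      (iteratedDerivWithin (m + 1) y (Ici 0) t) (Ici 0) t := fun m => by
    have := (h.differentiableOn_iteratedDerivWithin (m := m) (by exact_mod_cast ENat.natCast_lt_top m)
      (uniqueDiffOn_Ici 0) t ht).hasDerivWithinAt
    rwa [← iteratedDerivWithin_succ] at this
  have h1 : HasDerivWithinAt (refCoeff ε a b y k) (∑ m ∈ Finset.range (k + 1),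
      (k.choose m : ℝ) * L ^ (k - m) * iteratedDerivWithin (m + 1) y (Ici 0) t) (Ici 0) t := by
    have := HasDerivWithinAt.fun_sum (u := Finset.range (k + 1)) fun m _ =>
      (hd m).const_mul ((k.choose m : ℝ) * L ^ (k - m))
    exact this
  refine h1.congr_deriv ?_
  rw [eq_sub_iff_add_eq, refCoeff, refCoeff, Finset.sum_range_succ' _ (k + 1), ← hL]
  have e2 : L * ∑ m ∈ Finset.range (k + 1), (k.choose m : ℝ) * L ^ (k - m)
        * iteratedDerivWithin m y (Ici 0) t
      = ∑ m ∈ Finset.range (k + 1), (k.choose (m + 1) : ℝ) * L ^ (k - m)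
        * iteratedDerivWithin (m + 1) y (Ici 0) t
        + L ^ (k + 1) * iteratedDerivWithin 0 y (Ici 0) t := by
    rw [Finset.sum_range_succ', Finset.sum_range_succ]
    simp only [Nat.choose_succ_self, Nat.cast_zero, zero_mul, add_zero, mul_add, Nat.choose_zero_right,
      Nat.cast_one, one_mul, Nat.sub_zero]
    rw [Finset.mul_sum]
    congr 1
    · refine Finset.sum_congr rfl fun m hm => ?_
      have hm' := Finset.mem_range.1 hm
      rw [show k - m = k - (m + 1) + 1 by omega, pow_succ]
      ring
    · rw [pow_succ]; ring
  rw [e2, ← add_assoc, ← Finset.sum_add_distrib]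
  congr 1
  · refine Finset.sum_congr rfl fun m _ => ?_
    rw [Nat.choose_succ_succ, Nat.succ_sub_succ]
    push_cast
    ring
  · simp

/-- The bound `((n/2)!)^γ Q^(n/2)` for the coefficients of the reference trajectory. -/
def refBound (γ Q : ℝ) (n : ℕ) : ℝ := ((n / 2)! : ℝ) ^ γ * Q ^ (n / 2)

/-- Ratio test: consecutive terms have quotient (k+1)^γ X / ((2k+1)(2k+2)), which tends to 0
precisely because γ < 2. -/
theorem summable_refBound_even {γ X : ℝ} (hγ : γ < 2) (hX : 0 ≤ X) :
    Summable fun k : ℕ => (k ! : ℝ) ^ γ * X ^ k / ((2 * k)! : ℝ) := by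
  have h1 : Tendsto (fun k : ℕ => X * ((k : ℝ) + 1) ^ (-(2 - γ))) atTop (𝓝 (X * 0)) := by
    refine Tendsto.const_mul _ ((tendsto_rpow_neg_atTop (by linarith)).comp ?_)
    exact tendsto_atTop_add_const_right _ _ tendsto_natCast_atTop_atTop
  rw [mul_zero] at h1
  refine summable_of_ratio_norm_eventually_le (r := 1 / 2) (by norm_num) ?_
  filter_upwards [h1.eventually (ge_mem_nhds (show (0 : ℝ) < 1 / 2 by norm_num))] with k hk
  rw [Real.norm_of_nonneg (by positivity), Real.norm_of_nonneg (by positivity)]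
  have hk1 : (0 : ℝ) < (k : ℝ) + 1 := by positivity
  have e1 : (((k + 1)! : ℕ) : ℝ) ^ γ = ((k : ℝ) + 1) ^ γ * (k ! : ℝ) ^ γ := by
    rw [Nat.factorial_succ, Nat.cast_mul, Real.mul_rpow (by positivity) (by positivity)]
    push_cast; rfl
  have e2 : (((2 * (k + 1))! : ℕ) : ℝ)
      = (2 * (k : ℝ) + 2) * ((2 * (k : ℝ) + 1) * ((2 * k)! : ℝ)) := by
    rw [show 2 * (k + 1) = 2 * k + 1 + 1 by ring, Nat.factorial_succ, Nat.factorial_succ]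
    push_cast; ring
  have e3 : ((k : ℝ) + 1) ^ γ = ((k : ℝ) + 1) ^ (-(2 - γ)) * ((k : ℝ) + 1) ^ 2 := by
    rw [← Real.rpow_natCast, ← Real.rpow_add hk1]
    congr 1; push_cast; ring
  rw [e1, e2, e3, pow_succ]
  have hf : (0 : ℝ) < ((2 * k)! : ℝ) := by positivity
  rw [div_le_iff₀ (by positivity)]
  set P := (k ! : ℝ) ^ γ * X ^ k
  have hP : 0 ≤ P := by positivity
  set r := ((k : ℝ) + 1) ^ (-(2 - γ))
  have e4 : 1 / 2 * (P / ((2 * k)! : ℝ)) * ((2 * (k : ℝ) + 2) * ((2 * (k : ℝ) + 1) * ((2 * k)! : ℝ)))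
      = P * (1 / 2 * ((2 * (k : ℝ) + 2) * (2 * (k : ℝ) + 1))) := by
    field_simp
  rw [e4]
  calc r * ((k : ℝ) + 1) ^ 2 * (k ! : ℝ) ^ γ * (X ^ k * X)
      = P * ((X * r) * ((k : ℝ) + 1) ^ 2) := by ring
    _ ≤ P * (1 / 2 * ((2 * (k : ℝ) + 2) * (2 * (k : ℝ) + 1))) := by
        gcongr
        nlinarith

theorem entireBound_refBound {γ Q : ℝ} (hγ : γ < 2) (hQ : 0 ≤ Q) : EntireBound (refBound γ Q) := by
  have h0 : ∀ n, 0 ≤ refBound γ Q n := fun n => by rw [refBound]; positivity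
  refine ⟨h0, fun R hR => ?_⟩
  have hs := summable_refBound_even hγ (mul_nonneg hQ (sq_nonneg R))
  have he : Summable fun k : ℕ => refBound γ Q (2 * k) * (R ^ (2 * k) / ((2 * k)! : ℝ)) := by
    refine hs.congr fun k => ?_
    rw [refBound, Nat.mul_div_cancel_left k two_pos, mul_pow, pow_mul]
    ring
  have hodd : ∀ k : ℕ, refBound γ Q (2 * k + 1) = refBound γ Q (2 * k) := fun k => by
    rw [refBound, refBound, show (2 * k + 1) / 2 = 2 * k / 2 by omega]
  have ho : Summable fun k : ℕ => refBound γ Q (2 * k + 1)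
      * (R ^ (2 * k + 1) / ((2 * k + 1)! : ℝ)) := by
    refine Summable.of_nonneg_of_le (fun k => mul_nonneg (h0 _) (by positivity)) (fun k => ?_)
      (he.mul_left R)
    have hle : R ^ (2 * k + 1) / ((2 * k + 1)! : ℝ) ≤ R * R ^ (2 * k) / ((2 * k)! : ℝ) := by
      rw [pow_succ']
      refine div_le_div_of_nonneg_left (by positivity) (by positivity) ?_
      exact_mod_cast Nat.factorial_le (Nat.le_succ (2 * k))
    rw [hodd]
    refine (mul_le_mul_of_nonneg_left hle (h0 _)).trans (le_of_eq ?_)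
    ring
  exact (HasSum.even_add_odd (f := fun n : ℕ => refBound γ Q n * (R ^ n / (n ! : ℝ)))
    he.hasSum ho.hasSum).summable

/-- The outputs in the linearizing coordinates stay Gevrey with a constant linear in F. M is doubled
once by the exponential and once by the product with y₂, hence 4M. -/
theorem exists_gevBound_outputs (ε a b x₀ M γ : ℝ) (hε : 0 < ε) (ha : a ≠ 0) (hM : 0 < M)
    (hγ : 1 ≤ γ) : ∃ μ₀ A : ℝ, 0 < μ₀ ∧ 0 ≤ A ∧ ∀ (F : ℝ) (y₁ y₂ : ℝ → ℝ), F ≤ μ₀ →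
      IsGevrey F M γ (Ici 0) y₁ → IsGevrey F M γ (Ici 0) y₂ →
      GevBound γ (A * F) (4 * M) (y1v ε a b x₀ y₁) ∧
      GevBound γ (A * F) (4 * M) (y2v ε a b x₀ y₁ y₂) := by
  have ha' : 0 < |a| := abs_pos.2 ha
  set r := |-(a / ε)|
  have hr : r = |a| / ε := by simp [r, abs_div, abs_of_pos hε]
  have hr0 : 0 < r := by rw [hr]; positivity
  set s := |-(a * b / (2 * ε))|
  set e₀ := Real.exp (-(a * b / (2 * ε)) * x₀)
  have he₀ : 0 < e₀ := Real.exp_pos _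
  -- F ≤ 1/r brings (a/ε)y₁ into the range of `GevBound.exp_sub_one`; F ≤ 1 bounds the quadratic
  -- term from e^{-ay₁/ε}y₂ linearly. The first summand of A serves y_{1,v}, the other two y_{2,v}.
  refine ⟨min 1 (1 / r), e₀ * (3 * r + r * (3 * r + 1) + s * (3 * r)), by positivity, by positivity,
    fun F y₁ y₂ hF h₁ h₂ => ?_⟩
  have hF0 : 0 < F := h₁.1
  have hF1 : F ≤ 1 := hF.trans (min_le_left _ _)
  have hrF : r * F ≤ 1 := by
    have := hF.trans (min_le_right _ _)
    rwa [le_div_iff₀ hr0, mul_comm] at this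
  have g₁ : GevBound γ F M y₁ := h₁.2.2
  have g₂ : GevBound γ F M y₂ := h₂.2.2
  have hE : GevBound γ (3 * (r * F)) (2 * M) (fun t => Real.exp (-(a / ε) * y₁ t) - 1) :=
    (g₁.const_mul _).exp_sub_one hγ hM hrF
  have hE4 := hE.mono le_rfl (by positivity) (show 2 * M ≤ 4 * M by linarith)
  have h24 := g₂.mono le_rfl hM.le (show M ≤ 4 * M by linarith)
  have hprod := (hE.mul hγ (by positivity) (g₂.mono le_rfl hM.le (show M ≤ 2 * M by linarith)))
  rw [show 2 * (2 * M) = 4 * M by ring] at hprod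
  have e0 : |e₀| = e₀ := abs_of_pos he₀
  constructor
  · refine (hE4.const_mul e₀).mono ?_ (by positivity) le_rfl
    rw [e0]
    have : 0 ≤ e₀ * (r * (3 * r + 1) + s * (3 * r)) * F := by positivity
    linarith
  · have h3 := (((hprod.add h24).const_mul (-(a / ε))).add
      (hE4.const_mul (-(a * b / (2 * ε))))).const_mul e₀
    have e : (fun t => e₀ * (-(a / ε) * ((Real.exp (-(a / ε) * y₁ t) - 1) * y₂ t + y₂ t)
        + -(a * b / (2 * ε)) * (Real.exp (-(a / ε) * y₁ t) - 1))) = y2v ε a b x₀ y₁ y₂ := by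
      funext t; simp only [y2v, e₀]; ring
    rw [e] at h3
    refine h3.mono ?_ (by positivity) le_rfl
    rw [e0]
    change e₀ * (r * (3 * (r * F) * F + F) + s * (3 * (r * F))) ≤ _
    have h5 : e₀ * r * (3 * r) * F * F ≤ e₀ * r * (3 * r) * F * 1 := by gcongr
    have : 0 ≤ e₀ * (3 * r) * F := by positivity
    linarith

/-! ### The two series of v^r as one Taylor series at x₀. -/

/-- The Taylor coefficients of `v^r(·,t)` at `x₀`. -/
def refC (ε a b x₀ : ℝ) (y₁ y₂ : ℝ → ℝ) (n : ℕ) (t : ℝ) : ℝ :=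
  if n % 2 = 0 then 1 / ε ^ (n / 2) * refCoeff ε a b (y1v ε a b x₀ y₁) (n / 2) t
  else 1 / ε ^ (n / 2) * refCoeff ε a b (y2v ε a b x₀ y₁ y₂) (n / 2) t

/-- The `j`-th `x`-derivative of `v^r`. -/
def vRefD (ε a b x₀ : ℝ) (y₁ y₂ : ℝ → ℝ) (j : ℕ) (x t : ℝ) : ℝ :=
  egf (fun n => refC ε a b x₀ y₁ y₂ (n + j) t) (x - x₀)

theorem abs_refC_le {ε a b x₀ γ C K : ℝ} {y₁ y₂ : ℝ → ℝ} (hε : 0 < ε) (hγ : 1 ≤ γ) (hK : 0 ≤ K)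
    (h₁ : GevBound γ C K (y1v ε a b x₀ y₁)) (h₂ : GevBound γ C K (y2v ε a b x₀ y₁ y₂)) (n : ℕ)
    {t : ℝ} (ht : 0 ≤ t) : |refC ε a b x₀ y₁ y₂ n t|
      ≤ C * refBound γ ((K + a ^ 2 * b ^ 2 / (4 * ε)) / ε) n := by
  have key : ∀ {y}, GevBound γ C K y → |1 / ε ^ (n / 2) * refCoeff ε a b y (n / 2) t|
      ≤ C * refBound γ ((K + a ^ 2 * b ^ 2 / (4 * ε)) / ε) n := fun {y} h => by
    rw [abs_mul, abs_of_pos (by positivity), refBound, div_pow]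
    calc 1 / ε ^ (n / 2) * |refCoeff ε a b y (n / 2) t|
        ≤ 1 / ε ^ (n / 2) * (C * (((n / 2)! : ℝ) ^ γ * (K + a ^ 2 * b ^ 2 / (4 * ε)) ^ (n / 2))) := by
          gcongr
          exact abs_refCoeff_le hε hγ hK h _ ht
      _ = _ := by ring
  unfold refC
  split_ifs
  · exact key h₁
  · exact key h₂

/-- The linear equation read off coefficientwise: a shift of the index by 2 is a second derivative
in x. The parity of n, and so the output involved, is preserved. -/
theorem hasDerivWithinAt_refC {ε a b x₀ : ℝ} {y₁ y₂ : ℝ → ℝ} (hε : 0 < ε)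
    (h₁ : ContDiffOn ℝ ∞ (y1v ε a b x₀ y₁) (Ici 0))
    (h₂ : ContDiffOn ℝ ∞ (y2v ε a b x₀ y₁ y₂) (Ici 0)) (n : ℕ) {t : ℝ} (ht : 0 ≤ t) :
    HasDerivWithinAt (refC ε a b x₀ y₁ y₂ n) (ε * refC ε a b x₀ y₁ y₂ (n + 2) t
      - a ^ 2 * b ^ 2 / (4 * ε) * refC ε a b x₀ y₁ y₂ n t) (Ici 0) t := by
  have key : ∀ y : ℝ → ℝ, ContDiffOn ℝ ∞ y (Ici 0) →
      HasDerivWithinAt (fun t => 1 / ε ^ (n / 2) * refCoeff ε a b y (n / 2) t)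
        (ε * (1 / ε ^ (n / 2 + 1) * refCoeff ε a b y (n / 2 + 1) t)
          - a ^ 2 * b ^ 2 / (4 * ε) * (1 / ε ^ (n / 2) * refCoeff ε a b y (n / 2) t)) (Ici 0) t :=
    fun y hy => by
      refine ((hasDerivWithinAt_refCoeff hy (n / 2) ht).const_mul _).congr_deriv ?_
      field_simp
      ring
  have e1 : (n + 2) / 2 = n / 2 + 1 := by omega
  have e2 : (n + 2) % 2 = n % 2 := by omega
  by_cases h : n % 2 = 0
  · have e : refC ε a b x₀ y₁ y₂ n
        = fun t => 1 / ε ^ (n / 2) * refCoeff ε a b (y1v ε a b x₀ y₁) (n / 2) t := by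
      funext t; rw [refC, if_pos h]
    rw [e, refC, e2, if_pos h, e1]
    exact key _ h₁
  · have e : refC ε a b x₀ y₁ y₂ n
        = fun t => 1 / ε ^ (n / 2) * refCoeff ε a b (y2v ε a b x₀ y₁ y₂) (n / 2) t := by
      funext t; rw [refC, if_neg h]
    rw [e, refC, e2, if_neg h, e1]
    exact key _ h₂

/-- `V` with `x`-derivatives `V₁`, `V₂` solves `V_t = ε V_xx - κ V` on `[0,1] × S`. -/
structure LinSol (ε κ : ℝ) (S : Set ℝ) (V V₁ V₂ : ℝ → ℝ → ℝ) : Prop where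
  fam : C1Fam S V V₁
  fam₁ : C1Fam S V₁ V₂
  time : TimeFam S V fun x t => ε * V₂ x t - κ * V x t

theorem refC_even (ε a b x₀ : ℝ) (y₁ y₂ : ℝ → ℝ) (x t : ℝ) (k : ℕ) :
    refC ε a b x₀ y₁ y₂ (2 * k) t * ((x - x₀) ^ (2 * k) / ((2 * k)! : ℝ))
      = vRefEven ε a b x₀ y₁ x t k := by
  rw [refC, if_pos (by omega), Nat.mul_div_cancel_left k two_pos, vRefEven]; ring

theorem refC_odd (ε a b x₀ : ℝ) (y₁ y₂ : ℝ → ℝ) (x t : ℝ) (k : ℕ) :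
    refC ε a b x₀ y₁ y₂ (2 * k + 1) t * ((x - x₀) ^ (2 * k + 1) / ((2 * k + 1)! : ℝ))
      = vRefOdd ε a b x₀ y₁ y₂ x t k := by
  rw [refC, if_neg (by omega), show (2 * k + 1) / 2 = k by omega, vRefOdd]; ring

/-! ### Convergence and regularity of v^r, and its equation. -/

section Reference

variable {ε a b x₀ : ℝ} {y₁ y₂ : ℝ → ℝ} {B : ℕ → ℝ}

theorem summable_vRefEven (hB : EntireBound B)
    (h : ∀ n : ℕ, ∀ t : ℝ, 0 ≤ t → |refC ε a b x₀ y₁ y₂ n t| ≤ B n) (x : ℝ) {t : ℝ} (ht : 0 ≤ t) :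
    Summable (vRefEven ε a b x₀ y₁ x t) :=
  ((summable_egf hB (fun n => h n t ht) (x - x₀)).comp_injective
    (i := fun k : ℕ => 2 * k) (fun _ _ h => by simpa using h)).congr
    fun k => refC_even ε a b x₀ y₁ y₂ x t k

theorem summable_vRefOdd (hB : EntireBound B)
    (h : ∀ n : ℕ, ∀ t : ℝ, 0 ≤ t → |refC ε a b x₀ y₁ y₂ n t| ≤ B n) (x : ℝ) {t : ℝ} (ht : 0 ≤ t) :
    Summable (vRefOdd ε a b x₀ y₁ y₂ x t) :=
  ((summable_egf hB (fun n => h n t ht) (x - x₀)).comp_injective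
    (i := fun k : ℕ => 2 * k + 1) (fun _ _ h => by simpa using h)).congr
    fun k => refC_odd ε a b x₀ y₁ y₂ x t k

theorem vRef_eq (hB : EntireBound B)
    (h : ∀ n : ℕ, ∀ t : ℝ, 0 ≤ t → |refC ε a b x₀ y₁ y₂ n t| ≤ B n) (x : ℝ) {t : ℝ} (ht : 0 ≤ t) :
    vRef ε a b x₀ y₁ y₂ x t = vRefD ε a b x₀ y₁ y₂ 0 x t := by
  have he := (summable_vRefEven hB h x ht).hasSum
  have ho := (summable_vRefOdd hB h x ht).hasSum
  have := HasSum.even_add_odd (f := fun n : ℕ => refC ε a b x₀ y₁ y₂ n t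
      * ((x - x₀) ^ n / (n ! : ℝ)))
    (by simpa only [refC_even] using he) (by simpa only [refC_odd] using ho)
  exact this.tsum_eq.symm

theorem abs_vRefD_le (hB : EntireBound B)
    (h : ∀ n : ℕ, ∀ t : ℝ, 0 ≤ t → |refC ε a b x₀ y₁ y₂ n t| ≤ B n) (hx₀ : x₀ ∈ Icc (0 : ℝ) 1)
    (j : ℕ) {x t : ℝ} (hx : x ∈ Icc (0 : ℝ) 1) (ht : 0 ≤ t) :
    |vRefD ε a b x₀ y₁ y₂ j x t| ≤ egf (fun n => B (n + j)) 1 :=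
  abs_egf_le (hB.shift_iter j) (fun n => h (n + j) t ht)
    (abs_le.2 ⟨by linarith [hx.1, hx₀.2], by linarith [hx.2, hx₀.1]⟩)

theorem c1Fam_vRefD (hε : 0 < ε) (hB : EntireBound B)
    (h : ∀ n : ℕ, ∀ t : ℝ, 0 ≤ t → |refC ε a b x₀ y₁ y₂ n t| ≤ B n)
    (h₁ : ContDiffOn ℝ ∞ (y1v ε a b x₀ y₁) (Ici 0))
    (h₂ : ContDiffOn ℝ ∞ (y2v ε a b x₀ y₁ y₂) (Ici 0)) (hx₀ : x₀ ∈ Icc (0 : ℝ) 1) (j : ℕ) :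
    C1Fam (Ici 0) (vRefD ε a b x₀ y₁ y₂ j) (vRefD ε a b x₀ y₁ y₂ (j + 1)) := by
  have hc : ∀ i : ℕ, ContinuousOn (fun p : ℝ × ℝ => vRefD ε a b x₀ y₁ y₂ i p.1 p.2)
      (Icc 0 1 ×ˢ Ici 0) := fun i => by
    refine (continuousOn_egf (hB.shift_iter i) (c := fun n => refC ε a b x₀ y₁ y₂ (n + i))
      (fun n t ht => (hasDerivWithinAt_refC hε h₁ h₂ (n + i) ht).continuousWithinAt)
      (fun n t ht => h (n + i) t ht) zero_le_one).comp
      (f := fun p : ℝ × ℝ => (p.1 - x₀, p.2)) (by fun_prop) fun p hp => ⟨?_, hp.2⟩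
    exact ⟨by linarith [hp.1.1, hx₀.2], by linarith [hp.1.2, hx₀.1]⟩
  refine ⟨fun t ht x _ => ?_, hc j, hc (j + 1)⟩
  have := (hasDerivAt_egf (hB.shift_iter j) (fun n => h (n + j) t ht) (x - x₀)).comp_sub_const x x₀
  have e : (fun n => refC ε a b x₀ y₁ y₂ (n + 1 + j) t)
      = fun n => refC ε a b x₀ y₁ y₂ (n + (j + 1)) t := by
    funext n; congr 1; ring
  rw [e] at this
  exact this.hasDerivWithinAt

/-- Summation of `hasDerivWithinAt_refC`. The time set is open because the outputs have only
one-sided derivatives at t = 0. -/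
theorem linSol_vRefD (hε : 0 < ε) (hB : EntireBound B)
    (h : ∀ n : ℕ, ∀ t : ℝ, 0 ≤ t → |refC ε a b x₀ y₁ y₂ n t| ≤ B n)
    (h₁ : ContDiffOn ℝ ∞ (y1v ε a b x₀ y₁) (Ici 0))
    (h₂ : ContDiffOn ℝ ∞ (y2v ε a b x₀ y₁ y₂) (Ici 0)) (hx₀ : x₀ ∈ Icc (0 : ℝ) 1) :
    LinSol ε (a ^ 2 * b ^ 2 / (4 * ε)) (Ioi 0) (vRefD ε a b x₀ y₁ y₂ 0) (vRefD ε a b x₀ y₁ y₂ 1)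
      (vRefD ε a b x₀ y₁ y₂ 2) := by
  set L := a ^ 2 * b ^ 2 / (4 * ε)
  have hL : 0 ≤ L := by positivity
  have f0 := (c1Fam_vRefD hε hB h h₁ h₂ hx₀ 0).mono Ioi_subset_Ici_self
  have f1 := (c1Fam_vRefD hε hB h h₁ h₂ hx₀ 1).mono Ioi_subset_Ici_self
  refine ⟨f0, f1, fun x _ t ht => ?_, (f1.cont'.const_mul ε).sub (f0.cont.const_mul L)⟩
  have ht' : (0 : ℝ) < t := ht
  have hB2 := (hB.shift_iter 2).const_mul hε.le
  have key := hasDerivAt_egf_param isOpen_Ioi isPreconnected_Ioi hB (hB2.add (hB.const_mul hL))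
    (c := refC ε a b x₀ y₁ y₂)
    (c' := fun n t => ε * refC ε a b x₀ y₁ y₂ (n + 2) t - L * refC ε a b x₀ y₁ y₂ n t)
    (S := Ioi 0) (fun n t ht => (hasDerivWithinAt_refC hε h₁ h₂ n (le_of_lt ht)).hasDerivAt
      (Ici_mem_nhds ht)) (fun n t ht => h n t (le_of_lt ht))
    (fun n t ht => ?_) (x - x₀) ht
  · refine key.congr_deriv ?_
    have s2 := summable_egf (hB.shift_iter 2) (fun n => h (n + 2) t ht'.le) (x - x₀)
    have s0 := summable_egf hB (fun n => h n t ht'.le) (x - x₀)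
    simp only [vRefD, egf, add_zero]
    rw [← tsum_mul_left, ← tsum_mul_left, ← (s2.mul_left ε).tsum_sub (s0.mul_left L)]
    exact tsum_congr fun n => by ring
  · refine (abs_sub _ _).trans (add_le_add ?_ ?_)
    · rw [abs_mul, abs_of_pos hε]
      exact mul_le_mul_of_nonneg_left (h _ t (le_of_lt ht)) hε.le
    · rw [abs_mul, abs_of_nonneg hL]
      exact mul_le_mul_of_nonneg_left (h _ t (le_of_lt ht)) hL

theorem egf_at_zero (c : ℕ → ℝ) : egf c 0 = c 0 := by
  rw [egf, tsum_eq_single 0]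
  · simp
  · intro n hn; simp [hn]

theorem vRefD_zero_at (t : ℝ) : vRefD ε a b x₀ y₁ y₂ 0 x₀ t = y1v ε a b x₀ y₁ t := by
  rw [vRefD, sub_self, egf_at_zero]
  simp [refC, refCoeff]

theorem vRefD_one_at (t : ℝ) : vRefD ε a b x₀ y₁ y₂ 1 x₀ t = y2v ε a b x₀ y₁ y₂ t := by
  rw [vRefD, sub_self, egf_at_zero]
  simp [refC, refCoeff]

end Reference

/-! ### Regularity classes of families -/

theorem dx_eq_of_hasDerivWithinAt {f : ℝ → ℝ} {d x : ℝ} (hx : x ∈ Icc (0 : ℝ) 1)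
    (h : HasDerivWithinAt f d (Icc 0 1) x) : dx f x = d :=
  h.derivWithin (uniqueDiffOn_Icc_zero_one x hx)

theorem dx_congr {f g : ℝ → ℝ} (h : EqOn f g (Icc 0 1)) {x : ℝ} (hx : x ∈ Icc (0 : ℝ) 1) :
    dx f x = dx g x := derivWithin_congr h (h hx)

section Families

variable {S : Set ℝ} {V V₁ V₂ Vt : ℝ → ℝ → ℝ} {t : ℝ}

theorem C1Fam.dx_eq (h : C1Fam S V V₁) (ht : t ∈ S) {x : ℝ} (hx : x ∈ Icc (0 : ℝ) 1) :
    dx (fun z => V z t) x = V₁ x t := dx_eq_of_hasDerivWithinAt hx (h.deriv t ht x hx)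

theorem C1Fam.dxdx_eq (h : C1Fam S V V₁) (h₁ : C1Fam S V₁ V₂) (ht : t ∈ S) {x : ℝ}
    (hx : x ∈ Icc (0 : ℝ) 1) : dx (dx fun z => V z t) x = V₂ x t := by
  rw [dx_congr (fun z hz => h.dx_eq ht hz) hx, h₁.dx_eq ht hx]

theorem isC21_of_fam {t₀ : ℝ} (h : C1Fam (Ioi t₀) V V₁) (h₁ : C1Fam (Ioi t₀) V₁ V₂)
    (ht : TimeFam (Ioi t₀) V Vt) : IsC21 t₀ V := by
  refine ⟨fun t htt x hx => (h.deriv t htt x hx).differentiableWithinAt, fun t htt x hx => ?_,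
    fun x hx t htt => (ht.deriv x hx t htt).differentiableAt.differentiableWithinAt, h.cont,
    h.cont'.congr fun p hp => h.dx_eq hp.2 hp.1,
    h₁.cont'.congr fun p hp => h.dxdx_eq h₁ hp.2 hp.1,
    ht.cont.congr fun p hp => (ht.deriv p.1 hp.1 p.2 hp.2).deriv⟩
  exact (h₁.deriv t htt x hx).differentiableWithinAt.congr (fun z hz => h.dx_eq htt hz)
    (h.dx_eq htt hx)

theorem IsC21.fam {t₀ : ℝ} {u : ℝ → ℝ → ℝ} (h : IsC21 t₀ u) :
    C1Fam (Ioi t₀) u (fun x t => dx (fun z => u z t) x) :=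
  ⟨fun t ht x hx => (h.1 t ht x hx).hasDerivWithinAt, h.2.2.2.1, h.2.2.2.2.1⟩

theorem IsC21.fam₁ {t₀ : ℝ} {u : ℝ → ℝ → ℝ} (h : IsC21 t₀ u) :
    C1Fam (Ioi t₀) (fun x t => dx (fun z => u z t) x) (fun x t => dx (dx fun z => u z t) x) :=
  ⟨fun t ht x hx => (h.2.1 t ht x hx).hasDerivWithinAt, h.2.2.2.2.1, h.2.2.2.2.2.1⟩

theorem IsC21.timeFam {t₀ : ℝ} {u : ℝ → ℝ → ℝ} (h : IsC21 t₀ u) :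
    TimeFam (Ioi t₀) u (fun x t => deriv (u x) t) :=
  ⟨fun x hx t ht => ((h.2.2.1 x hx t ht).differentiableAt (isOpen_Ioi.mem_nhds ht)).hasDerivAt,
    h.2.2.2.2.2.2⟩

theorem C1Fam.const_mul (h : C1Fam S V V₁) (r : ℝ) :
    C1Fam S (fun x t => r * V x t) (fun x t => r * V₁ x t) :=
  ⟨fun t ht x hx => (h.deriv t ht x hx).const_mul r, h.cont.const_mul r, h.cont'.const_mul r⟩

theorem C1Fam.log (h : C1Fam S V V₁) (h0 : ∀ x ∈ Icc (0 : ℝ) 1, ∀ t ∈ S, V x t ≠ 0) :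
    C1Fam S (fun x t => Real.log (V x t)) (fun x t => V₁ x t / V x t) :=
  ⟨fun t ht x hx => (h.deriv t ht x hx).log (h0 x hx t ht),
    h.cont.log fun p hp => h0 p.1 hp.1 p.2 hp.2,
    h.cont'.div h.cont fun p hp => h0 p.1 hp.1 p.2 hp.2⟩

theorem C1Fam.div {W W₁ : ℝ → ℝ → ℝ} (h : C1Fam S V V₁) (h' : C1Fam S W W₁)
    (h0 : ∀ x ∈ Icc (0 : ℝ) 1, ∀ t ∈ S, W x t ≠ 0) : C1Fam S (fun x t => V x t / W x t)
      (fun x t => (V₁ x t * W x t - V x t * W₁ x t) / W x t ^ 2) :=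
  ⟨fun t ht x hx => (h.deriv t ht x hx).div (h'.deriv t ht x hx) (h0 x hx t ht),
    h.cont.div h'.cont fun p hp => h0 p.1 hp.1 p.2 hp.2,
    ((h.cont'.mul h'.cont).sub (h.cont.mul h'.cont')).div (h'.cont.pow 2)
      fun p hp => pow_ne_zero 2 (h0 p.1 hp.1 p.2 hp.2)⟩

end Families

/-! ### The Hopf–Cole transformation -/

/-- The argument `e^{ab x/(2ε)} V + 1` of the logarithm, for `β = ab/(2ε)`. -/
def hcArg (β : ℝ) (V : ℝ → ℝ → ℝ) (x t : ℝ) : ℝ := Real.exp (β * x) * V x t + 1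

/-- The `x`-derivative of `hcArg`. -/
def hcArg1 (β : ℝ) (V V₁ : ℝ → ℝ → ℝ) (x t : ℝ) : ℝ := Real.exp (β * x) * (β * V x t + V₁ x t)

/-- The inverse Hopf–Cole transformation. -/
def hopfCole (ε a b : ℝ) (V : ℝ → ℝ → ℝ) (x t : ℝ) : ℝ :=
  -(ε / a) * Real.log (hcArg (a * b / (2 * ε)) V x t)

theorem c1Fam_exp (S : Set ℝ) (β : ℝ) :
    C1Fam S (fun x _ => Real.exp (β * x)) (fun x _ => β * Real.exp (β * x)) := by
  refine ⟨fun t _ x _ => ?_, by fun_prop, by fun_prop⟩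
  have : HasDerivAt (fun x : ℝ => β * x) β x := by simpa using (hasDerivAt_id x).const_mul β
  exact (this.exp.hasDerivWithinAt).congr_deriv (mul_comm _ _)

theorem c1Fam_const (S : Set ℝ) (r : ℝ) : C1Fam S (fun _ _ => r) (fun _ _ => 0) :=
  ⟨fun _ _ _ _ => hasDerivWithinAt_const _ _ _, continuousOn_const, continuousOn_const⟩

section HopfCole

variable {ε a b β t₀ : ℝ} {S : Set ℝ} {V V₁ V₂ : ℝ → ℝ → ℝ}

theorem C1Fam.hcArg (h : C1Fam S V V₁) (β : ℝ) :
    C1Fam S (ViscousHJ.hcArg β V) (hcArg1 β V V₁) :=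
  (((c1Fam_exp S β).mul h).add (c1Fam_const S 1)).congr (fun _ _ _ _ => rfl)
    fun _ _ _ _ => by rw [hcArg1]; ring

theorem C1Fam.hcArg1 (h : C1Fam S V V₁) (h₁ : C1Fam S V₁ V₂) (β : ℝ) :
    C1Fam S (ViscousHJ.hcArg1 β V V₁) (fun x t =>
      Real.exp (β * x) * (β ^ 2 * V x t + 2 * β * V₁ x t + V₂ x t)) :=
  ((c1Fam_exp S β).mul ((h.const_mul β).add h₁)).congr (fun _ _ _ _ => rfl)
    fun _ _ _ _ => by ring

theorem C1Fam.hopfCole (h : C1Fam S V V₁)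
    (h0 : ∀ x ∈ Icc (0 : ℝ) 1, ∀ t ∈ S, 0 < ViscousHJ.hcArg (a * b / (2 * ε)) V x t) :
    C1Fam S (ViscousHJ.hopfCole ε a b V) (fun x t => -(ε / a)
      * (ViscousHJ.hcArg1 (a * b / (2 * ε)) V V₁ x t / ViscousHJ.hcArg (a * b / (2 * ε)) V x t)) :=
  ((h.hcArg _).log fun x hx t ht => (h0 x hx t ht).ne').const_mul _

theorem TimeFam.hopfCole {Vt : ℝ → ℝ → ℝ} (h : TimeFam S V Vt)
    (hc : ContinuousOn (fun p : ℝ × ℝ => V p.1 p.2) (Icc 0 1 ×ˢ S))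
    (h0 : ∀ x ∈ Icc (0 : ℝ) 1, ∀ t ∈ S, 0 < ViscousHJ.hcArg (a * b / (2 * ε)) V x t) :
    TimeFam S (ViscousHJ.hopfCole ε a b V) (fun x t => -(ε / a)
      * (Real.exp (a * b / (2 * ε) * x) * Vt x t / ViscousHJ.hcArg (a * b / (2 * ε)) V x t)) := by
  refine ⟨fun x hx t ht => ?_, ?_⟩
  · exact ((((h.deriv x hx t ht).const_mul _).add_const 1).log (h0 x hx t ht).ne').const_mul _
  · refine ContinuousOn.const_mul (ContinuousOn.div (ContinuousOn.mul (by fun_prop) h.cont) ?_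
      fun p hp => (h0 p.1 hp.1 p.2 hp.2).ne') _
    exact (ContinuousOn.mul (by fun_prop) hc).add continuousOn_const

/-- The inverse Hopf–Cole transformation of a solution of the linear equation solves the plant. -/
theorem LinSol.hopfCole (hε : 0 < ε) (ha : a ≠ 0)
    (h : LinSol ε (a ^ 2 * b ^ 2 / (4 * ε)) (Ioi t₀) V V₁ V₂)
    (h0 : ∀ x ∈ Icc (0 : ℝ) 1, ∀ t ∈ Ioi t₀, 0 < hcArg (a * b / (2 * ε)) V x t) :
    IsC21 t₀ (ViscousHJ.hopfCole ε a b V) ∧ ∀ x ∈ Icc (0 : ℝ) 1, ∀ t, t₀ < t →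
      deriv (ViscousHJ.hopfCole ε a b V x) t
        = ε * dx (dx (fun z => ViscousHJ.hopfCole ε a b V z t)) x
          - a * dx (fun z => ViscousHJ.hopfCole ε a b V z t) x
            * (b + dx (fun z => ViscousHJ.hopfCole ε a b V z t) x) := by
  have f := h.fam.hopfCole h0
  have f₁ := ((h.fam.hcArg1 h.fam₁ (a * b / (2 * ε))).div (h.fam.hcArg (a * b / (2 * ε)))
    fun x hx t ht => (h0 x hx t ht).ne').const_mul (-(ε / a))
  have ft := h.time.hopfCole h.fam.cont h0
  refine ⟨isC21_of_fam f f₁ ft, fun x hx t ht => ?_⟩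
  rw [(ft.deriv x hx t ht).deriv, f.dx_eq ht hx, f.dxdx_eq f₁ ht hx]
  have hW := (h0 x hx t ht).ne'
  rw [hcArg1]
  set W := hcArg (a * b / (2 * ε)) V x t
  set X := Real.exp (a * b / (2 * ε) * x)
  -- With W the argument of the logarithm, the terms W_x²/W² from u_xx and u_x² cancel. The exponent
  -- ab/(2ε) is the one that removes V_x, and the potential a²b²/(4ε) remains.
  field_simp
  ring

/-- The Hopf–Cole transformation. -/
def coleHopf (ε a b : ℝ) (u : ℝ → ℝ → ℝ) (x t : ℝ) : ℝ :=
  Real.exp (-(a * b / (2 * ε)) * x) * (Real.exp (-(a / ε) * u x t) - 1)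

/-- The `x`-derivative of `coleHopf`. -/
def coleHopf1 (ε a b : ℝ) (u u₁ : ℝ → ℝ → ℝ) (x t : ℝ) : ℝ :=
  Real.exp (-(a * b / (2 * ε)) * x) * (-(a / ε) * Real.exp (-(a / ε) * u x t) * u₁ x t
    - a * b / (2 * ε) * (Real.exp (-(a / ε) * u x t) - 1))

theorem C1Fam.exp {u u₁ : ℝ → ℝ → ℝ} (h : C1Fam S u u₁) (r : ℝ) :
    C1Fam S (fun x t => Real.exp (r * u x t)) (fun x t => r * u₁ x t * Real.exp (r * u x t)) :=
  ⟨fun t ht x hx => (((h.deriv t ht x hx).const_mul r).exp).congr_deriv (mul_comm _ _),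
    (h.cont.const_mul r).rexp, (h.cont'.const_mul r).mul (h.cont.const_mul r).rexp⟩

theorem C1Fam.coleHopf {u u₁ : ℝ → ℝ → ℝ} (h : C1Fam S u u₁) :
    C1Fam S (ViscousHJ.coleHopf ε a b u) (ViscousHJ.coleHopf1 ε a b u u₁) :=
  ((c1Fam_exp S (-(a * b / (2 * ε)))).mul ((h.exp (-(a / ε))).add (c1Fam_const S (-1)))).congr
    (fun _ _ _ _ => by rw [ViscousHJ.coleHopf, sub_eq_add_neg])
    fun _ _ _ _ => by rw [ViscousHJ.coleHopf1]; ring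

theorem hopfCole_coleHopf (u : ℝ → ℝ → ℝ) (x t : ℝ) :
    hcArg (a * b / (2 * ε)) (ViscousHJ.coleHopf ε a b u) x t = Real.exp (-(a / ε) * u x t) := by
  rw [hcArg, ViscousHJ.coleHopf, ← mul_assoc, ← Real.exp_add]
  rw [show a * b / (2 * ε) * x + -(a * b / (2 * ε)) * x = 0 by ring, Real.exp_zero]
  ring

theorem coleHopf_hopfCole (hε : 0 < ε) (ha : a ≠ 0) {x t : ℝ}
    (h0 : 0 < hcArg (a * b / (2 * ε)) V x t) :
    ViscousHJ.coleHopf ε a b (ViscousHJ.hopfCole ε a b V) x t = V x t := by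
  rw [ViscousHJ.coleHopf, ViscousHJ.hopfCole]
  rw [show -(a / ε) * (-(ε / a) * Real.log (hcArg (a * b / (2 * ε)) V x t))
    = Real.log (hcArg (a * b / (2 * ε)) V x t) by field_simp, Real.exp_log h0, hcArg,
    add_sub_cancel_right, ← mul_assoc, ← Real.exp_add,
    show -(a * b / (2 * ε)) * x + a * b / (2 * ε) * x = 0 by ring, Real.exp_zero, one_mul]

/-- The Hopf–Cole transformation of a classical solution of the plant solves the linear equation. -/
theorem IsC21.linSol_coleHopf (hε : 0 < ε) {u : ℝ → ℝ → ℝ} (h : IsC21 t₀ u)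
    (hpde : ∀ x ∈ Icc (0 : ℝ) 1, ∀ t, t₀ < t →
      deriv (u x) t = ε * dx (dx (fun z => u z t)) x
        - a * dx (fun z => u z t) x * (b + dx (fun z => u z t) x)) :
    ∃ V₂, LinSol ε (a ^ 2 * b ^ 2 / (4 * ε)) (Ioi t₀) (ViscousHJ.coleHopf ε a b u)
      (ViscousHJ.coleHopf1 ε a b u fun x t => dx (fun z => u z t) x) V₂ := by
  set u₁ : ℝ → ℝ → ℝ := fun x t => dx (fun z => u z t) x
  set u₂ : ℝ → ℝ → ℝ := fun x t => dx (dx fun z => u z t) x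
  have f : C1Fam (Ioi t₀) u u₁ := h.fam
  have f₁ : C1Fam (Ioi t₀) u₁ u₂ := h.fam₁
  have fe := f.exp (-(a / ε))
  have fx := c1Fam_exp (Ioi t₀) (-(a * b / (2 * ε)))
  have hfam₁ := (fx.mul (((fe.const_mul (-(a / ε))).mul f₁).sub
      ((fe.sub (c1Fam_const _ 1)).const_mul (a * b / (2 * ε))))).congr
    (W := ViscousHJ.coleHopf1 ε a b u u₁) (fun _ _ _ _ => by rw [ViscousHJ.coleHopf1])
    (fun _ _ _ _ => rfl)
  refine ⟨_, f.coleHopf, hfam₁, ⟨fun x hx t ht => ?_,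
    (hfam₁.cont'.const_mul ε).sub (f.coleHopf.cont.const_mul _)⟩⟩
  have hd := ((((h.timeFam.deriv x hx t ht).const_mul (-(a / ε))).exp).sub_const 1).const_mul
    (Real.exp (-(a * b / (2 * ε)) * x))
  refine hd.congr_deriv ?_
  rw [hpde x hx t ht]
  change _ * (_ * (-(a / ε) * (ε * u₂ x t - a * u₁ x t * (b + u₁ x t)))) = _
  rw [ViscousHJ.coleHopf]
  set X := Real.exp (-(a * b / (2 * ε)) * x)
  set Y := Real.exp (-(a / ε) * u x t)
  field_simp
  ring

end HopfCole

/-! ### Continuity in time with values in `H²` -/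

theorem ac_congr {f g : ℝ → ℝ} (hf : AbsolutelyContinuousOnInterval f 0 1)
    (h : EqOn f g (Icc 0 1)) : AbsolutelyContinuousOnInterval g 0 1 := by
  rw [absolutelyContinuousOnInterval_iff] at hf ⊢
  intro e he
  obtain ⟨δ, hδ, H⟩ := hf e he
  refine ⟨δ, hδ, fun E hE hlen => lt_of_eq_of_lt ?_ (H E hE hlen)⟩
  refine Finset.sum_congr rfl fun i hi => ?_
  have := hE.1 i hi
  rw [uIcc_of_le zero_le_one] at this
  rw [h this.1, h this.2]

theorem ac_of_hasDerivWithinAt {f f' : ℝ → ℝ}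
    (h : ∀ x ∈ Icc (0 : ℝ) 1, HasDerivWithinAt f (f' x) (Icc 0 1) x)
    (hc : ContinuousOn f' (Icc 0 1)) : AbsolutelyContinuousOnInterval f 0 1 := by
  obtain ⟨C, hC⟩ := isCompact_Icc.exists_bound_of_continuousOn hc
  have hC0 : 0 ≤ C := (norm_nonneg _).trans (hC 0 (by simp))
  refine LipschitzOnWith.absolutelyContinuousOnInterval (K := ⟨C, hC0⟩) ?_
  rw [uIcc_of_le zero_le_one]
  exact (convex_Icc 0 1).lipschitzOnWith_of_nnnorm_hasDerivWithin_le h fun x hx => hC x hx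

theorem C1Fam.slice' {S : Set ℝ} {V V₁ : ℝ → ℝ → ℝ} (h : C1Fam S V V₁) {t : ℝ} (ht : t ∈ S) :
    ContinuousOn (fun x => V₁ x t) (Icc 0 1) := slice_continuousOn h.cont' ht

theorem C1Fam.slice {S : Set ℝ} {V V₁ : ℝ → ℝ → ℝ} (h : C1Fam S V V₁) {t : ℝ} (ht : t ∈ S) :
    ContinuousOn (fun x => V x t) (Icc 0 1) := slice_continuousOn h.cont ht

/-- Uniform continuity on the compact slab `[0,1] × [t₀, t+1]` makes the estimate uniform in x. -/
theorem eventually_abs_sub_le {t₀ t : ℝ} {q : ℝ → ℝ → ℝ}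
    (hq : ContinuousOn (fun p : ℝ × ℝ => q p.1 p.2) (Icc 0 1 ×ˢ Ici t₀)) (ht : t₀ ≤ t) {δ : ℝ}
    (hδ : 0 < δ) : ∀ᶠ s in 𝓝[Ici t₀] t, ∀ x ∈ Icc (0 : ℝ) 1, |q x s - q x t| ≤ δ := by
  have hK : IsCompact (Icc (0 : ℝ) 1 ×ˢ Icc t₀ (t + 1)) := isCompact_Icc.prod isCompact_Icc
  have huc := hK.uniformContinuousOn_of_continuous
    (hq.mono (prod_mono Subset.rfl Icc_subset_Ici_self))
  rw [Metric.uniformContinuousOn_iff] at huc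
  obtain ⟨η, hη, H⟩ := huc δ hδ
  filter_upwards [inter_mem_nhdsWithin (Ici t₀)
    (inter_mem (Metric.ball_mem_nhds t hη) (Iio_mem_nhds (lt_add_one t)))] with s hs x hx
  have := H (x, s) ⟨hx, hs.1, (le_of_lt hs.2.2)⟩ (x, t) ⟨hx, ht, by linarith⟩ (by
    rw [Prod.dist_eq, dist_self]; exact max_lt hη hs.2.1)
  exact this.le

theorem tendsto_integral_sq_sub {t₀ t : ℝ} {q : ℝ → ℝ → ℝ}
    (hq : ContinuousOn (fun p : ℝ × ℝ => q p.1 p.2) (Icc 0 1 ×ˢ Ici t₀)) (ht : t₀ ≤ t) :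
    Tendsto (fun s => ∫ x in (0 : ℝ)..1, (q x s - q x t) ^ 2) (𝓝[Ici t₀] t) (𝓝 0) := by
  have hc : ContinuousOn (fun s => ∫ x in (0 : ℝ)..1, (q x s - q x t) ^ 2) (Ici t₀) := by
    refine continuousOn_integral_param zero_le_one (f := fun s x => (q x s - q x t) ^ 2) ?_
    refine ContinuousOn.pow (ContinuousOn.sub ?_ ?_) 2
    · exact hq.comp (f := fun p : ℝ × ℝ => (p.2, p.1)) (by fun_prop) fun p hp => ⟨hp.2, hp.1⟩
    · exact (slice_continuousOn hq ht).comp continuousOn_snd fun p hp => hp.2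
  simpa using (hc t ht).tendsto

theorem memLp_restrict_of_continuousOn {f : ℝ → ℝ} (hf : ContinuousOn f (Icc 0 1)) :
    MemLp f 2 (volume.restrict (Ioo 0 1)) := by
  obtain ⟨C, hC⟩ := isCompact_Icc.exists_bound_of_continuousOn hf
  exact MemLp.of_bound ((hf.mono Ioo_subset_Icc_self).aestronglyMeasurable measurableSet_Ioo) C
    ((ae_restrict_iff' measurableSet_Ioo).2 (Eventually.of_forall fun x hx =>
      hC x (Ioo_subset_Icc_self hx)))

theorem ii_sq_of_memLp {f : ℝ → ℝ} (hf : MemLp f 2 (volume.restrict (Ioo 0 1))) :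
    IntervalIntegrable (fun x => f x ^ 2) volume 0 1 := by
  rw [intervalIntegrable_iff_integrableOn_Ioo_of_le zero_le_one]
  exact hf.integrable_sq

theorem memLp_mul_of_continuousOn {f g : ℝ → ℝ} (hf : ContinuousOn f (Icc 0 1))
    (hg : MemLp g 2 (volume.restrict (Ioo 0 1))) :
    MemLp (fun x => f x * g x) 2 (volume.restrict (Ioo 0 1)) := by
  obtain ⟨C, hC⟩ := isCompact_Icc.exists_bound_of_continuousOn hf
  refine MemLp.of_le_mul (c := C) hg
    (((hf.mono Ioo_subset_Icc_self).aestronglyMeasurable measurableSet_Ioo).mul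
      hg.aestronglyMeasurable) ?_
  refine (ae_restrict_iff' measurableSet_Ioo).2 (Eventually.of_forall fun x hx => ?_)
  rw [norm_mul]
  exact mul_le_mul_of_nonneg_right (hC x (Ioo_subset_Icc_self hx)) (norm_nonneg _)

theorem integral_congr_ae_Ioo {f g : ℝ → ℝ} (h : ∀ᵐ x ∂volume.restrict (Ioo 0 1), f x = g x) :
    ∫ x in (0 : ℝ)..1, f x = ∫ x in (0 : ℝ)..1, g x := by
  rw [intervalIntegral.integral_of_le zero_le_one, intervalIntegral.integral_of_le zero_le_one,
    integral_Ioc_eq_integral_Ioo, integral_Ioc_eq_integral_Ioo]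
  exact integral_congr_ae h

theorem dxdx_ae_eq {f f₁ f₂ : ℝ → ℝ}
    (h : ∀ x ∈ Icc (0 : ℝ) 1, HasDerivWithinAt f (f₁ x) (Icc 0 1) x)
    (h₁ : ∀ᵐ x ∂volume.restrict (Ioo 0 1), HasDerivAt f₁ (f₂ x) x) :
    ∀ᵐ x ∂volume.restrict (Ioo 0 1), dx (dx f) x = f₂ x := by
  filter_upwards [h₁, ae_restrict_mem measurableSet_Ioo] with x hx hxm
  have hxm' := Ioo_subset_Icc_self hxm
  rw [dx_congr (fun z hz => dx_eq_of_hasDerivWithinAt hz (h z hz)) hxm']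
  exact dx_eq_of_hasDerivWithinAt hxm' hx.hasDerivWithinAt

theorem memH2_of_fam {f f₁ f₂ : ℝ → ℝ}
    (h : ∀ x ∈ Icc (0 : ℝ) 1, HasDerivWithinAt f (f₁ x) (Icc 0 1) x)
    (hac : AbsolutelyContinuousOnInterval f₁ 0 1)
    (h₁ : ∀ᵐ x ∂volume.restrict (Ioo 0 1), HasDerivAt f₁ (f₂ x) x)
    (h₂ : MemLp f₂ 2 (volume.restrict (Ioo 0 1))) : MemH2 f :=
  ⟨fun x hx => (h x hx).differentiableWithinAt,
    ac_congr hac fun _ hz => (dx_eq_of_hasDerivWithinAt hz (h _ hz)).symm,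
    h₂.ae_eq ((dxdx_ae_eq h h₁).mono fun _ hx => hx.symm)⟩

/-- A criterion for `u ∈ C([t₀,∞); H²)` when `u_xx = q g + r` with `q`, `r` jointly continuous and
`g` continuous with values in `L²`. -/
theorem continuousH2_of_fam {t₀ : ℝ} {u u₁ q r g : ℝ → ℝ → ℝ} (hu : C1Fam (Ici t₀) u u₁)
    (hac : ∀ t, t₀ ≤ t → AbsolutelyContinuousOnInterval (fun x => u₁ x t) 0 1)
    (hd : ∀ t, t₀ ≤ t → ∀ᵐ x ∂volume.restrict (Ioo 0 1),
      HasDerivAt (fun z => u₁ z t) (q x t * g x t + r x t) x)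
    (hq : ContinuousOn (fun p : ℝ × ℝ => q p.1 p.2) (Icc 0 1 ×ˢ Ici t₀))
    (hr : ContinuousOn (fun p : ℝ × ℝ => r p.1 p.2) (Icc 0 1 ×ˢ Ici t₀))
    (hg : ∀ t, t₀ ≤ t → MemLp (fun x => g x t) 2 (volume.restrict (Ioo 0 1)))
    (hgt : ∀ t, t₀ ≤ t →
      Tendsto (fun s => ∫ x in (0 : ℝ)..1, (g x s - g x t) ^ 2) (𝓝[Ici t₀] t) (𝓝 0)) :
    ContinuousH2 t₀ u := by
  have hmem : ∀ t, t₀ ≤ t →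
      MemLp (fun x => q x t * g x t + r x t) 2 (volume.restrict (Ioo 0 1)) := fun t ht =>
    (memLp_mul_of_continuousOn (slice_continuousOn hq ht) (hg t ht)).add
      (memLp_restrict_of_continuousOn (slice_continuousOn hr ht))
  refine ⟨fun t ht => memH2_of_fam (hu.deriv t ht) (hac t ht) (hd t ht) (hmem t ht),
    fun t ht => ?_⟩
  have hsub : ∀ s, t₀ ≤ s → ∀ x ∈ Icc (0 : ℝ) 1,
      HasDerivWithinAt (fun x => u x s - u x t) (u₁ x s - u₁ x t) (Icc 0 1) x :=
    fun s hs x hx => (hu.deriv s hs x hx).sub (hu.deriv t ht x hx)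
  have hdd : ∀ s, t₀ ≤ s → ∀ᵐ x ∂volume.restrict (Ioo 0 1),
      dx (dx fun x => u x s - u x t) x = (q x s * g x s + r x s) - (q x t * g x t + r x t) :=
    fun s hs => by
      refine dxdx_ae_eq (f₁ := fun x => u₁ x s - u₁ x t) (hsub s hs) ?_
      filter_upwards [hd s hs, hd t ht] with x h1 h2
      exact h1.sub h2
  have l0 : Tendsto (fun s => l2Norm (fun x => u x s - u x t)) (𝓝[Ici t₀] t) (𝓝 0) := by
    simpa [l2Norm] using (tendsto_integral_sq_sub hu.cont ht).sqrt
  have l1 : Tendsto (fun s => l2Norm (dx fun x => u x s - u x t)) (𝓝[Ici t₀] t) (𝓝 0) := by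
    have h1 : Tendsto (fun s => √(∫ x in (0 : ℝ)..1, (u₁ x s - u₁ x t) ^ 2)) (𝓝[Ici t₀] t)
        (𝓝 0) := by simpa using (tendsto_integral_sq_sub hu.cont' ht).sqrt
    refine h1.congr' ?_
    filter_upwards [self_mem_nhdsWithin] with s hs
    rw [l2Norm]
    congr 1
    refine intervalIntegral.integral_congr fun x hx => ?_
    rw [uIcc_of_le zero_le_one] at hx
    simp only [dx_eq_of_hasDerivWithinAt hx (hsub s hs x hx)]
  have l2 : Tendsto (fun s => ∫ x in (0 : ℝ)..1,
      ((q x s * g x s + r x s) - (q x t * g x t + r x t)) ^ 2) (𝓝[Ici t₀] t) (𝓝 0) := by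
    obtain ⟨C, hC⟩ := isCompact_Icc.exists_bound_of_continuousOn (slice_continuousOn hq ht)
    have hC0 : 0 ≤ C := (norm_nonneg _).trans (hC 0 (by simp))
    set N := ∫ x in (0 : ℝ)..1, g x t ^ 2
    have hN : 0 ≤ N := intervalIntegral.integral_nonneg zero_le_one fun x _ => sq_nonneg _
    -- The difference of second derivatives is q(s)(g(s) - g(t)) + (q(s) - q(t))g(t) + (r(s) -
    -- r(t)), which needs g only in L². C bounds |q(t)|, hence C + 1 bounds |q(s)|; the factor 3
    -- comes from the square of three terms.
    have key : ∀ δ : ℝ, 0 < δ → δ ≤ 1 → ∀ᶠ s in 𝓝[Ici t₀] t, ∫ x in (0 : ℝ)..1,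
        ((q x s * g x s + r x s) - (q x t * g x t + r x t)) ^ 2
          ≤ 3 * (C + 1) ^ 2 * (∫ x in (0 : ℝ)..1, (g x s - g x t) ^ 2)
            + (3 * δ ^ 2 * N + 3 * δ ^ 2) := by
      intro δ hδ hδ1
      filter_upwards [eventually_abs_sub_le hq ht hδ, eventually_abs_sub_le hr ht hδ,
        self_mem_nhdsWithin] with s hqs hrs hs
      have i1 : IntervalIntegrable (fun x => (g x s - g x t) ^ 2) volume 0 1 :=
        ii_sq_of_memLp ((hg s hs).sub (hg t ht))
      have i2 : IntervalIntegrable (fun x => g x t ^ 2) volume 0 1 := ii_sq_of_memLp (hg t ht)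
      have i3 : IntervalIntegrable (fun x =>
          ((q x s * g x s + r x s) - (q x t * g x t + r x t)) ^ 2) volume 0 1 :=
        ii_sq_of_memLp ((hmem s hs).sub (hmem t ht))
      calc _ ≤ ∫ x in (0 : ℝ)..1, (3 * (C + 1) ^ 2 * (g x s - g x t) ^ 2
            + (3 * δ ^ 2 * g x t ^ 2 + 3 * δ ^ 2)) := by
            refine intervalIntegral.integral_mono_on zero_le_one i3
              ((i1.const_mul _).add ((i2.const_mul _).add intervalIntegrable_const))
              fun x hx => ?_
            have h1 := hqs x hx
            have h2 := hrs x hx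
            have h3 : |q x s| ≤ C + 1 := by
              have e := hC x hx
              rw [Real.norm_eq_abs] at e
              calc |q x s| = |q x t + (q x s - q x t)| := by congr 1; ring
                _ ≤ |q x t| + |q x s - q x t| := abs_add_le _ _
                _ ≤ C + 1 := by linarith
            have e1 : (q x s * (g x s - g x t)) ^ 2 ≤ (C + 1) ^ 2 * (g x s - g x t) ^ 2 := by
              rw [mul_pow]
              exact mul_le_mul_of_nonneg_right (sq_le_sq' (by linarith [neg_abs_le (q x s)])
                ((le_abs_self _).trans h3)) (sq_nonneg _)
            have e2 : ((q x s - q x t) * g x t) ^ 2 ≤ δ ^ 2 * g x t ^ 2 := by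
              rw [mul_pow]
              exact mul_le_mul_of_nonneg_right (sq_le_sq' (abs_le.1 h1).1 (abs_le.1 h1).2)
                (sq_nonneg _)
            have e3 : (r x s - r x t) ^ 2 ≤ δ ^ 2 := sq_le_sq' (abs_le.1 h2).1 (abs_le.1 h2).2
            have e4 : (q x s * g x s + r x s) - (q x t * g x t + r x t)
                = q x s * (g x s - g x t) + (q x s - q x t) * g x t + (r x s - r x t) := by ring
            rw [e4]
            generalize q x s * (g x s - g x t) = A at *
            generalize (q x s - q x t) * g x t = B at *
            generalize r x s - r x t = D at *
            nlinarith [sq_nonneg (A - B), sq_nonneg (A - D), sq_nonneg (B - D)]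
        _ = _ := by
            rw [intervalIntegral.integral_add (i1.const_mul _)
              ((i2.const_mul _).add intervalIntegrable_const),
              intervalIntegral.integral_add (i2.const_mul _) intervalIntegrable_const,
              intervalIntegral.integral_const_mul, intervalIntegral.integral_const_mul]
            simp [N]
    rw [Metric.tendsto_nhds]
    intro e he
    -- Chosen so that 3δ²(N+1) ≤ e/2; the other half of e is left for the L² continuity of g.
    set δ := min 1 (e / (6 * (N + 1)))
    have hδ : 0 < δ := by positivity
    have hδ2 : 3 * δ ^ 2 * N + 3 * δ ^ 2 ≤ e / 2 := by
      have h1 : δ ≤ 1 := min_le_left _ _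
      have h2 : δ ≤ e / (6 * (N + 1)) := min_le_right _ _
      have h3 : δ ^ 2 ≤ e / (6 * (N + 1)) := by nlinarith
      calc 3 * δ ^ 2 * N + 3 * δ ^ 2 = 3 * (N + 1) * δ ^ 2 := by ring
        _ ≤ 3 * (N + 1) * (e / (6 * (N + 1))) := by gcongr
        _ = e / 2 := by field_simp; norm_num
    have h4 : Tendsto (fun s => 3 * (C + 1) ^ 2 * ∫ x in (0 : ℝ)..1, (g x s - g x t) ^ 2)
        (𝓝[Ici t₀] t) (𝓝 0) := by simpa using (hgt t ht).const_mul (3 * (C + 1) ^ 2)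
    filter_upwards [key δ hδ (min_le_left _ _),
      h4.eventually (gt_mem_nhds (show (0 : ℝ) < e / 2 by positivity))] with s h5 h6
    rw [Real.dist_eq, sub_zero, abs_of_nonneg
      (intervalIntegral.integral_nonneg zero_le_one fun x _ => sq_nonneg _)]
    linarith
  have l3 : Tendsto (fun s => l2Norm (dx (dx fun x => u x s - u x t))) (𝓝[Ici t₀] t) (𝓝 0) := by
    have h1 : Tendsto (fun s => √(∫ x in (0 : ℝ)..1,
        ((q x s * g x s + r x s) - (q x t * g x t + r x t)) ^ 2)) (𝓝[Ici t₀] t) (𝓝 0) := by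
      simpa using l2.sqrt
    refine h1.congr' ?_
    filter_upwards [self_mem_nhdsWithin] with s hs
    rw [l2Norm]
    congr 1
    exact integral_congr_ae_Ioo ((hdd s hs).mono fun x hx => by rw [hx])
  simpa [h2Norm] using (l0.add l1).add l3

/-- Transfer of the class `C([t₀,∞); H²)` through the inverse Hopf–Cole transformation, for
`V_x = R₁ + w₁` with `R₁` of class `C¹` in `x` and `w₁` absolutely continuous in `x`. -/
theorem continuousH2_hopfCole {ε a b t₀ : ℝ} {V V₁ R₁ R₂ w₁ g : ℝ → ℝ → ℝ}
    (hV : C1Fam (Ici t₀) V V₁) (hR : C1Fam (Ici t₀) R₁ R₂)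
    (hV₁ : ∀ x ∈ Icc (0 : ℝ) 1, ∀ t, t₀ ≤ t → V₁ x t = R₁ x t + w₁ x t)
    (hac : ∀ t, t₀ ≤ t → AbsolutelyContinuousOnInterval (fun x => w₁ x t) 0 1)
    (hd : ∀ t, t₀ ≤ t → ∀ᵐ x ∂volume.restrict (Ioo 0 1), HasDerivAt (fun z => w₁ z t) (g x t) x)
    (hg : ∀ t, t₀ ≤ t → MemLp (fun x => g x t) 2 (volume.restrict (Ioo 0 1)))
    (hgt : ∀ t, t₀ ≤ t →
      Tendsto (fun s => ∫ x in (0 : ℝ)..1, (g x s - g x t) ^ 2) (𝓝[Ici t₀] t) (𝓝 0))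
    (h0 : ∀ x ∈ Icc (0 : ℝ) 1, ∀ t ∈ Ici t₀, 0 < hcArg (a * b / (2 * ε)) V x t) :
    ContinuousH2 t₀ (hopfCole ε a b V) := by
  set β := a * b / (2 * ε)
  have fW := hV.hcArg β
  have hne : ∀ x ∈ Icc (0 : ℝ) 1, ∀ t ∈ Ici t₀, hcArg β V x t ≠ 0 :=
    fun x hx t ht => (h0 x hx t ht).ne'
  have fE := c1Fam_exp (Ici t₀) β
  have fInv := (c1Fam_const (Ici t₀) 1).div fW hne
  have cE : ContinuousOn (fun p : ℝ × ℝ => Real.exp (β * p.1)) (Icc 0 1 ×ˢ Ici t₀) := fE.cont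
  have fS := (fE.mul ((hV.const_mul β).add hR))
  -- With W the argument of the logarithm, u_xx = -(ε/a)(W_xx/W - W_x²/W²). The only factor that is
  -- not continuous is g, which enters W_xx through the summand e^{βx} g.
  refine continuousH2_of_fam (g := g)
    (q := fun x t => -(ε / a) * (Real.exp (β * x) / hcArg β V x t))
    (r := fun x t => -(ε / a) * (Real.exp (β * x) * (β * (β * V x t + V₁ x t)
      + (β * V₁ x t + R₂ x t)) / hcArg β V x t - hcArg1 β V V₁ x t ^ 2 / hcArg β V x t ^ 2))
    (hV.hopfCole h0) (fun t ht => ?_) (fun t ht => ?_) ?_ ?_ hg hgt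
  · have a1 : AbsolutelyContinuousOnInterval (fun x => Real.exp (β * x)
        * (β * V x t + R₁ x t)) 0 1 :=
      ac_of_hasDerivWithinAt (fS.deriv t ht) (fS.slice' ht)
    have a2 : AbsolutelyContinuousOnInterval (fun x => Real.exp (β * x)) 0 1 :=
      ac_of_hasDerivWithinAt (fE.deriv t ht) (fE.slice' ht)
    have a3 : AbsolutelyContinuousOnInterval (fun x => 1 / hcArg β V x t) 0 1 :=
      ac_of_hasDerivWithinAt (fInv.deriv t ht) (fInv.slice' ht)
    refine ac_congr (((a1.fun_add (a2.fun_mul (hac t ht))).fun_mul a3).const_mul (-(ε / a)))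
      fun x hx => ?_
    simp only [hcArg1]
    rw [hV₁ x hx t ht]
    ring
  · filter_upwards [hd t ht, ae_restrict_mem measurableSet_Ioo] with x hx hxm
    have hxm' := Ioo_subset_Icc_self hxm
    have hnb : Icc (0 : ℝ) 1 ∈ 𝓝 x := Icc_mem_nhds hxm.1 hxm.2
    have d1 := (fS.deriv t ht x hxm').hasDerivAt hnb
    have d2 := ((fE.deriv t ht x hxm').hasDerivAt hnb).mul hx
    have d3 := (fW.deriv t ht x hxm').hasDerivAt hnb
    have d4 := ((d1.add d2).div d3 (hne x hxm' t ht)).const_mul (-(ε / a))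
    have hev : (fun z => -(ε / a) * (hcArg1 β V V₁ z t / hcArg β V z t)) =ᶠ[𝓝 x]
        fun z => -(ε / a) * ((Real.exp (β * z) * (β * V z t + R₁ z t)
          + Real.exp (β * z) * w₁ z t) / hcArg β V z t) := by
      filter_upwards [hnb] with z hz
      rw [hcArg1, hV₁ z hz t ht]; ring
    refine (d4.congr_of_eventuallyEq hev).congr_deriv ?_
    simp only [Pi.add_apply, Pi.mul_apply, hcArg1]
    rw [hV₁ x hxm' t ht]
    have := hne x hxm' t ht
    field_simp
    ring
  · exact ContinuousOn.const_mul (cE.div fW.cont fun p hp => hne p.1 hp.1 p.2 hp.2) _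
  · refine ContinuousOn.const_mul (ContinuousOn.sub (ContinuousOn.div (cE.mul ?_) fW.cont
      fun p hp => hne p.1 hp.1 p.2 hp.2) ?_) _
    · exact (((hV.cont.const_mul β).add hV.cont').const_mul β).add
        ((hV.cont'.const_mul β).add hR.cont')
    · exact (fW.cont'.pow 2).div (fW.cont.pow 2)
        fun p hp => pow_ne_zero 2 (hne p.1 hp.1 p.2 hp.2)

/-! ### Parseval's identity for cosine and sine series on `(0,1)` -/

/-- The cosine coefficients `∫₀¹ f cos(nπx)`. -/
def cosCoeff (f : ℝ → ℝ) (n : ℤ) : ℝ := ∫ x in (0 : ℝ)..1, Real.cos (n * π * x) * f x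

/-- The sine coefficients `∫₀¹ f sin(nπx)`. -/
def sinCoeff (f : ℝ → ℝ) (n : ℤ) : ℝ := ∫ x in (0 : ℝ)..1, Real.sin (n * π * x) * f x

theorem intervalIntegral_indicator_Ioo {E : Type*} [NormedAddCommGroup E] [NormedSpace ℝ E]
    (h : ℝ → E) : ∫ x in (-1 : ℝ)..1, (Ioo (0 : ℝ) 1).indicator h x = ∫ x in (0 : ℝ)..1, h x := by
  rw [intervalIntegral.integral_of_le (by norm_num), intervalIntegral.integral_of_le zero_le_one,
    setIntegral_indicator measurableSet_Ioo, integral_Ioc_eq_integral_Ioo]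
  congr 2
  ext x
  simp only [mem_inter_iff, mem_Ioc, mem_Ioo]
  constructor
  · rintro ⟨_, h⟩; exact h
  · rintro ⟨h1, h2⟩; exact ⟨⟨by linarith, h2.le⟩, h1, h2⟩

/-- Parseval's identity on `(-1,1)` for the even (`σ = 1`) or odd (`σ = -1`) extension of `f`. -/
theorem hasSum_sq_norm_extension {f : ℝ → ℝ} (hf : MemLp f 2 (volume.restrict (Ioo 0 1))) {σ : ℝ}
    (hσ : σ ^ 2 = 1) : HasSum (fun n : ℤ => ‖∫ x in (0 : ℝ)..1,
      (1 / 2 : ℂ) * (Complex.exp (-((n * π * x : ℝ) * Complex.I))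
        + σ * Complex.exp ((n * π * x : ℝ) * Complex.I)) * (f x : ℂ)‖ ^ 2)
      (∫ x in (0 : ℝ)..1, f x ^ 2) := by
  have hlt : (-1 : ℝ) < 1 := by norm_num
  set f₀ : ℝ → ℝ := (Ioo (0 : ℝ) 1).indicator f with hf₀
  have hm₀ : MemLp f₀ 2 volume := (memLp_indicator_iff_restrict measurableSet_Ioo).2 hf
  have hm₀' : MemLp (fun x => f₀ (-x)) 2 volume :=
    hm₀.comp_measurePreserving (Measure.measurePreserving_neg volume)
  -- f₀ and its reflection have disjoint supports, so with σ² = 1 the integral of G² over (-1,1) is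
  -- twice that of f² over (0,1).
  set G : ℝ → ℝ := fun x => f₀ x + σ * f₀ (-x)
  have hG : MemLp G 2 volume := hm₀.add (hm₀'.const_mul σ)
  have hGc : MemLp (fun x => (G x : ℂ)) 2 (volume.restrict (Ioc (-1) 1)) :=
    (hG.restrict _).ofReal
  have hpar := hasSum_sq_fourierCoeffOn hlt hGc
  have hi₀ : Integrable f₀ volume := by
    rw [hf₀, integrable_indicator_iff measurableSet_Ioo]
    exact hf.integrable one_le_two
  have e1 : ∫ x in (-1 : ℝ)..1, ‖(G x : ℂ)‖ ^ 2 = 2 * ∫ x in (0 : ℝ)..1, f x ^ 2 := by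
    have h1 : ∀ x, ‖(G x : ℂ)‖ ^ 2 = f₀ x ^ 2 + f₀ (-x) ^ 2 := by
      intro x
      rw [Complex.norm_real, Real.norm_eq_abs, sq_abs]
      have h0 : f₀ x * f₀ (-x) = 0 := by
        simp only [hf₀, indicator, mem_Ioo]
        split_ifs with h1 h2 <;> simp
        exact absurd h2.1 (by linarith [h1.1])
      have : G x ^ 2 = f₀ x ^ 2 + σ ^ 2 * f₀ (-x) ^ 2 + 2 * σ * (f₀ x * f₀ (-x)) := by
        simp only [G]; ring
      rw [this, h0, hσ]; ring
    simp only [h1]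
    have i1 : IntervalIntegrable (fun x => f₀ x ^ 2) volume (-1) 1 :=
      hm₀.integrable_sq.intervalIntegrable
    have i2 : IntervalIntegrable (fun x => f₀ (-x) ^ 2) volume (-1) 1 :=
      hm₀'.integrable_sq.intervalIntegrable
    rw [intervalIntegral.integral_add i1 i2,
      intervalIntegral.integral_comp_neg (fun x => f₀ x ^ 2), neg_neg]
    have h2 : ∀ x, f₀ x ^ 2 = (Ioo (0 : ℝ) 1).indicator (fun x => f x ^ 2) x := fun x => by
      simp only [hf₀, indicator]; split_ifs <;> simp
    simp only [h2, intervalIntegral_indicator_Ioo]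
    ring
  have e2 : ∀ n : ℤ, fourierCoeffOn hlt (fun x => (G x : ℂ)) n = ∫ x in (0 : ℝ)..1,
      (1 / 2 : ℂ) * (Complex.exp (-((n * π * x : ℝ) * Complex.I))
        + σ * Complex.exp ((n * π * x : ℝ) * Complex.I)) * (f x : ℂ) := by
    intro n
    set E : ℝ → ℂ := fun x => Complex.exp (-((n * π * x : ℝ) * Complex.I))
    have hE : Continuous E := by fun_prop
    have hE' : ∀ x, ‖E x‖ ≤ 1 := fun x => by
      simp only [E]
      rw [← neg_mul, ← Complex.ofReal_neg, Complex.norm_exp_ofReal_mul_I]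
    have hfE : ∀ x : ℝ, (fourier (-n) (x : AddCircle ((1 : ℝ) - -1)) : ℂ) = E x := fun x => by
      rw [fourier_coe_apply]
      simp only [E]
      congr 1
      push_cast
      ring
    have j1 : IntervalIntegrable (fun x => E x * (f₀ x : ℂ)) volume (-1) 1 := by
      refine Integrable.intervalIntegrable ?_
      exact hi₀.ofReal.bdd_mul hE.aestronglyMeasurable (Eventually.of_forall hE')
    have j2 : IntervalIntegrable (fun x => E (-x) * (f₀ x : ℂ)) volume (-1) 1 := by
      refine Integrable.intervalIntegrable ?_
      exact hi₀.ofReal.bdd_mul (hE.comp continuous_neg).aestronglyMeasurable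
        (Eventually.of_forall fun x => hE' _)
    have j3 : IntervalIntegrable (fun x => E x * (f₀ (-x) : ℂ)) volume (-1) 1 := by
      refine Integrable.intervalIntegrable ?_
      exact hi₀.comp_neg.ofReal.bdd_mul hE.aestronglyMeasurable (Eventually.of_forall hE')
    have s1 : ∫ x in (-1 : ℝ)..1, E x * (f₀ (-x) : ℂ) = ∫ x in (-1 : ℝ)..1, E (-x) * (f₀ x : ℂ) := by
      have := intervalIntegral.integral_comp_neg (a := -1) (b := 1)
        (fun x => E (-x) * (f₀ x : ℂ))
      simpa using this
    have s2 : ∫ x in (-1 : ℝ)..1, E x * (G x : ℂ)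
        = ∫ x in (-1 : ℝ)..1, (E x + σ * E (-x)) * (f₀ x : ℂ) := by
      have h1 : ∀ x, E x * (G x : ℂ) = E x * (f₀ x : ℂ) + σ * (E x * (f₀ (-x) : ℂ)) := fun x => by
        simp only [G]; push_cast; ring
      have h2 : ∀ x, (E x + σ * E (-x)) * (f₀ x : ℂ)
          = E x * (f₀ x : ℂ) + σ * (E (-x) * (f₀ x : ℂ)) := fun x => by ring
      simp only [h1, h2]
      rw [intervalIntegral.integral_add j1 (j3.const_mul _),
        intervalIntegral.integral_add j1 (j2.const_mul _), intervalIntegral.integral_const_mul,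
        intervalIntegral.integral_const_mul, s1]
    rw [fourierCoeffOn_eq_integral]
    simp only [hfE, smul_eq_mul]
    rw [s2]
    have h3 : ∀ x, (E x + σ * E (-x)) * (f₀ x : ℂ)
        = (Ioo (0 : ℝ) 1).indicator (fun x => (E x + σ * E (-x)) * (f x : ℂ)) x := fun x => by
      simp only [hf₀, indicator]; split_ifs <;> simp
    simp only [h3, intervalIntegral_indicator_Ioo]
    rw [← intervalIntegral.integral_smul]
    refine intervalIntegral.integral_congr fun x _ => ?_
    simp only [E, Complex.real_smul]
    push_cast
    ring_nf
  simp only [e2] at hpar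
  rw [e1] at hpar
  convert hpar using 1
  -- The normalization 1/2 of the interval of length 2 cancels that factor 2.
  rw [smul_eq_mul, ← mul_assoc]
  norm_num

/-- Summation over all integers counts ±n separately, so neither a factor 2 nor a special constant
mode appears. -/
theorem hasSum_sq_cosCoeff {f : ℝ → ℝ} (hf : MemLp f 2 (volume.restrict (Ioo 0 1))) :
    HasSum (fun n => cosCoeff f n ^ 2) (∫ x in (0 : ℝ)..1, f x ^ 2) := by
  refine (hasSum_sq_norm_extension hf (σ := 1) (by norm_num)).congr_fun fun n => ?_
  have e : ∀ x : ℝ, (1 / 2 : ℂ) * (Complex.exp (-((n * π * x : ℝ) * Complex.I))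
      + (1 : ℝ) * Complex.exp ((n * π * x : ℝ) * Complex.I)) * (f x : ℂ)
      = ((Real.cos (n * π * x) * f x : ℝ) : ℂ) := fun x => by
    rw [show ((Real.cos (n * π * x) * f x : ℝ) : ℂ)
      = Complex.cos ((n * π * x : ℝ) : ℂ) * f x by push_cast; rfl, Complex.cos]
    push_cast
    ring_nf
  simp only [e]
  rw [intervalIntegral.integral_ofReal, Complex.norm_real, Real.norm_eq_abs, sq_abs, cosCoeff]

theorem hasSum_sq_sinCoeff {f : ℝ → ℝ} (hf : MemLp f 2 (volume.restrict (Ioo 0 1))) :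
    HasSum (fun n => sinCoeff f n ^ 2) (∫ x in (0 : ℝ)..1, f x ^ 2) := by
  refine (hasSum_sq_norm_extension hf (σ := -1) (by norm_num)).congr_fun fun n => ?_
  have e : ∀ x : ℝ, (1 / 2 : ℂ) * (Complex.exp (-((n * π * x : ℝ) * Complex.I))
      + (-1 : ℝ) * Complex.exp ((n * π * x : ℝ) * Complex.I)) * (f x : ℂ)
      = -Complex.I * ((Real.sin (n * π * x) * f x : ℝ) : ℂ) := fun x => by
    rw [show ((Real.sin (n * π * x) * f x : ℝ) : ℂ)
      = Complex.sin ((n * π * x : ℝ) : ℂ) * f x by push_cast; rfl, Complex.sin]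
    push_cast
    ring_nf
    rw [Complex.I_sq]
    ring_nf
  simp only [e]
  rw [intervalIntegral.integral_const_mul, intervalIntegral.integral_ofReal, norm_mul, norm_neg,
    Complex.norm_I, one_mul, Complex.norm_real, Real.norm_eq_abs, sq_abs, sinCoeff]

/-! ### Cosine series -/

theorem continuousOn_Ioi_of_Ici {t₀ : ℝ} {V : ℝ → ℝ → ℝ}
    (h : ∀ t₁, t₀ < t₁ → ContinuousOn (fun p : ℝ × ℝ => V p.1 p.2) (Icc 0 1 ×ˢ Ici t₁)) :
    ContinuousOn (fun p : ℝ × ℝ => V p.1 p.2) (Icc 0 1 ×ˢ Ioi t₀) := by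
  refine continuousOn_of_locally_continuousOn fun p hp => ?_
  have hp2 : t₀ < p.2 := hp.2
  refine ⟨univ ×ˢ Ioi ((t₀ + p.2) / 2), isOpen_univ.prod isOpen_Ioi,
    ⟨mem_univ _, by simp only [mem_Ioi]; linarith⟩, (h ((t₀ + p.2) / 2) (by linarith)).mono ?_⟩
  rintro q ⟨h1, h2⟩
  exact ⟨h1.1, mem_Ici.2 (le_of_lt h2.2)⟩

theorem C1Fam.of_tsum {S : Set ℝ} {f f₁ : ℤ → ℝ → ℝ → ℝ} {B B₁ : ℤ → ℝ} (hB : Summable B)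
    (hB₁ : Summable B₁) (hd : ∀ n t x, HasDerivAt (fun z => f n z t) (f₁ n x t) x)
    (hc : ∀ n, Continuous fun p : ℝ × ℝ => f n p.1 p.2)
    (hc₁ : ∀ n, Continuous fun p : ℝ × ℝ => f₁ n p.1 p.2)
    (hf : ∀ n x, ∀ t ∈ S, |f n x t| ≤ B n) (hf₁ : ∀ n x, ∀ t ∈ S, |f₁ n x t| ≤ B₁ n) :
    C1Fam S (fun x t => ∑' n, f n x t) fun x t => ∑' n, f₁ n x t where
  deriv t ht x _ := (hasDerivAt_tsum hB₁ (fun n y => hd n t y) (fun n y => hf₁ n y t ht)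
    (y₀ := 0) (hB.of_norm_bounded fun n => hf n 0 t ht) x).hasDerivWithinAt
  cont := continuousOn_tsum (fun n => (hc n).continuousOn) hB fun n p hp => hf n p.1 p.2 hp.2
  cont' := continuousOn_tsum (fun n => (hc₁ n).continuousOn) hB₁ fun n p hp => hf₁ n p.1 p.2 hp.2

theorem integral_cos_int (k : ℤ) :
    ∫ x in (0 : ℝ)..1, Real.cos (k * π * x) = if k = 0 then 1 else 0 := by
  split_ifs with h
  · simp [h]
  · have hk : (k : ℝ) * π ≠ 0 := mul_ne_zero (by exact_mod_cast h) Real.pi_ne_zero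
    rw [intervalIntegral.integral_comp_mul_left (fun x => Real.cos x) hk, integral_cos]
    simp [Real.sin_int_mul_pi]

theorem cosCoeff_cos (n m : ℤ) : cosCoeff (fun x => Real.cos (n * π * x)) m
    = ((if n = m then 1 else 0) + if n = -m then 1 else 0) / 2 := by
  have h : ∀ x : ℝ, Real.cos (m * π * x) * Real.cos (n * π * x)
      = (Real.cos ((n - m : ℤ) * π * x) + Real.cos ((n + m : ℤ) * π * x)) / 2 := fun x => by
    rw [show ((n - m : ℤ) : ℝ) * π * x = n * π * x - m * π * x by push_cast; ring,
      show ((n + m : ℤ) : ℝ) * π * x = n * π * x + m * π * x by push_cast; ring,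
      Real.cos_sub, Real.cos_add]
    ring
  simp only [cosCoeff, h]
  rw [intervalIntegral.integral_div, intervalIntegral.integral_add
    (Continuous.intervalIntegrable (by fun_prop) _ _)
    (Continuous.intervalIntegrable (by fun_prop) _ _), integral_cos_int, integral_cos_int]
  simp only [sub_eq_zero, eq_neg_iff_add_eq_zero]

theorem cosCoeff_neg (f : ℝ → ℝ) (n : ℤ) : cosCoeff f (-n) = cosCoeff f n := by
  simp only [cosCoeff]
  congr 1
  ext x
  rw [← Real.cos_neg]
  push_cast
  ring_nf

theorem abs_mul_cos_le (r y : ℝ) : |r * Real.cos y| ≤ |r| := by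
  rw [abs_mul]
  exact mul_le_of_le_one_right (abs_nonneg _) (Real.abs_cos_le_one _)

theorem abs_mul_sin_le (r y : ℝ) : |r * Real.sin y| ≤ |r| := by
  rw [abs_mul]
  exact mul_le_of_le_one_right (abs_nonneg _) (Real.abs_sin_le_one _)

/-- The coefficients of a cosine series with summable even coefficients. -/
theorem cosCoeff_tsum {β : ℤ → ℝ} (hβ : Summable fun n => |β n|) (he : ∀ n, β (-n) = β n) (m : ℤ) :
    cosCoeff (fun x => ∑' n, β n * Real.cos (n * π * x)) m = β m := by
  have h1 : HasSum (fun n : ℤ => ∫ x in (0 : ℝ)..1, Real.cos (m * π * x)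
      * (β n * Real.cos (n * π * x)))
      (∫ x in (0 : ℝ)..1, Real.cos (m * π * x) * ∑' n : ℤ, β n * Real.cos (n * π * x)) := by
    have hle : ∀ (n : ℤ) (x : ℝ), ‖Real.cos (m * π * x) * (β n * Real.cos (n * π * x))‖ ≤ |β n| :=
      fun n x => by
        rw [Real.norm_eq_abs, mul_comm]
        exact (abs_mul_cos_le (β n * Real.cos (n * π * x)) (m * π * x)).trans
          (abs_mul_cos_le (β n) (n * π * x))
    have hcont : ∀ n : ℤ, Continuous fun x : ℝ =>
        Real.cos (m * π * x) * (β n * Real.cos (n * π * x)) := fun n => by fun_prop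
    have hs : ∀ x : ℝ, Summable fun n : ℤ => β n * Real.cos (n * π * x) := fun x =>
      Summable.of_norm_bounded hβ fun n => abs_mul_cos_le (β n) (n * π * x)
    have hsum : ∀ x : ℝ, HasSum (fun n : ℤ => Real.cos (m * π * x) * (β n * Real.cos (n * π * x)))
        (Real.cos (m * π * x) * ∑' n : ℤ, β n * Real.cos (n * π * x)) := fun x =>
      (hs x).hasSum.mul_left (Real.cos (m * π * x))
    exact intervalIntegral.hasSum_integral_of_dominated_convergence (fun n _ => |β n|)
      (fun n => (hcont n).aestronglyMeasurable) (fun n => Eventually.of_forall fun x _ => hle n x)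
      (Eventually.of_forall fun _ _ => hβ) intervalIntegrable_const
      (Eventually.of_forall fun x _ => hsum x)
  -- The indices n = m and n = -m contribute half of the coefficient each, and for m = 0 both halves
  -- come from the same n.
  have h2 : ∀ n : ℤ, ∫ x in (0 : ℝ)..1, Real.cos (m * π * x) * (β n * Real.cos (n * π * x))
      = (if n = m then β m / 2 else 0) + if n = -m then β m / 2 else 0 := fun n => by
    have h3 : ∀ x, Real.cos (m * π * x) * (β n * Real.cos (n * π * x))
        = β n * (Real.cos (m * π * x) * Real.cos (n * π * x)) := fun x => by ring
    simp only [h3]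
    rw [intervalIntegral.integral_const_mul]
    have := cosCoeff_cos n m
    rw [cosCoeff] at this
    rw [this]
    split_ifs with h4 h5 h5
    · rw [h4]; ring
    · rw [h4]; ring
    · rw [h5, he]; ring
    · ring
  simp only [h2] at h1
  have h6 := (hasSum_ite_eq m (β m / 2)).add (hasSum_ite_eq (-m) (β m / 2))
  rw [cosCoeff, h1.unique h6]
  ring

theorem cosCoeff_sub {f g : ℝ → ℝ} (hf : MemLp f 2 (volume.restrict (Ioo 0 1)))
    (hg : MemLp g 2 (volume.restrict (Ioo 0 1))) (n : ℤ) :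
    cosCoeff (fun x => f x - g x) n = cosCoeff f n - cosCoeff g n := by
  have key : ∀ {h : ℝ → ℝ}, MemLp h 2 (volume.restrict (Ioo 0 1)) →
      IntervalIntegrable (fun x => Real.cos (n * π * x) * h x) volume 0 1 := fun {h} hh => by
    rw [intervalIntegrable_iff_integrableOn_Ioo_of_le zero_le_one]
    exact (memLp_mul_of_continuousOn (Continuous.continuousOn (by fun_prop)) hh).integrable
      one_le_two
  simp only [cosCoeff, mul_sub]
  exact intervalIntegral.integral_sub (key hf) (key hg)

/-! ### Coefficients of derivatives -/

theorem ae_deriv_eq {f f' : ℝ → ℝ} (hd : ∀ᵐ x ∂volume.restrict (Ioo 0 1), HasDerivAt f (f' x) x)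
    (h : ℝ → ℝ) : ∫ x in (0 : ℝ)..1, h x * deriv f x = ∫ x in (0 : ℝ)..1, h x * f' x :=
  integral_congr_ae_Ioo (hd.mono fun x hx => by rw [hx.deriv])

theorem hasDerivAt_sin_mul (r x : ℝ) :
    HasDerivAt (fun x => Real.sin (r * x)) (r * Real.cos (r * x)) x := by
  have := ((hasDerivAt_id x).const_mul r).sin
  simpa [mul_comm] using this

theorem hasDerivAt_cos_mul (r x : ℝ) :
    HasDerivAt (fun x => Real.cos (r * x)) (-(r * Real.sin (r * x))) x := by
  have := ((hasDerivAt_id x).const_mul r).cos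
  simpa [mul_comm] using this

/-- Integration by parts for absolutely continuous functions; the sine vanishes at 0 and 1, so f
needs no boundary values. -/
theorem sinCoeff_deriv {f f' : ℝ → ℝ} (hac : AbsolutelyContinuousOnInterval f 0 1)
    (hd : ∀ᵐ x ∂volume.restrict (Ioo 0 1), HasDerivAt f (f' x) x) (n : ℤ) :
    sinCoeff f' n = -(n * π * cosCoeff f n) := by
  have hs : AbsolutelyContinuousOnInterval (fun x => Real.sin (n * π * x)) 0 1 :=
    ac_of_hasDerivWithinAt (fun x _ => (hasDerivAt_sin_mul (n * π) x).hasDerivWithinAt)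
      (Continuous.continuousOn (by fun_prop))
  have h := hs.integral_mul_deriv_eq_deriv_mul hac
  rw [ae_deriv_eq hd] at h
  have e : ∀ x, deriv (fun x => Real.sin (n * π * x)) x = n * π * Real.cos (n * π * x) :=
    fun x => (hasDerivAt_sin_mul _ x).deriv
  simp only [e, mul_assoc _ (Real.cos _)] at h
  rw [intervalIntegral.integral_const_mul] at h
  rw [sinCoeff, h, cosCoeff]
  simp [Real.sin_int_mul_pi]

/-- Here the boundary values of f do enter. Applied to f = w₀', they are the Neumann conditions, the
form that the compatibility of the initial state takes. -/
theorem cosCoeff_deriv {f f' : ℝ → ℝ} (hac : AbsolutelyContinuousOnInterval f 0 1)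
    (hd : ∀ᵐ x ∂volume.restrict (Ioo 0 1), HasDerivAt f (f' x) x) (h0 : f 0 = 0) (h1 : f 1 = 0)
    (n : ℤ) : cosCoeff f' n = n * π * sinCoeff f n := by
  have hs : AbsolutelyContinuousOnInterval (fun x => Real.cos (n * π * x)) 0 1 :=
    ac_of_hasDerivWithinAt (fun x _ => (hasDerivAt_cos_mul (n * π) x).hasDerivWithinAt)
      (Continuous.continuousOn (by fun_prop))
  have h := hs.integral_mul_deriv_eq_deriv_mul hac
  rw [ae_deriv_eq hd] at h
  have e : ∀ x, deriv (fun x => Real.cos (n * π * x)) x = -(n * π) * Real.sin (n * π * x) :=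
    fun x => (hasDerivAt_cos_mul _ x).deriv.trans (by ring)
  simp only [e, mul_assoc _ (Real.sin _)] at h
  rw [intervalIntegral.integral_const_mul] at h
  rw [cosCoeff, h, sinCoeff, h0, h1]
  ring

theorem ae_hasDerivAt_of_Icc {f f' : ℝ → ℝ}
    (h : ∀ x ∈ Icc (0 : ℝ) 1, HasDerivWithinAt f (f' x) (Icc 0 1) x) :
    ∀ᵐ x ∂volume.restrict (Ioo 0 1), HasDerivAt f (f' x) x :=
  (ae_restrict_iff' measurableSet_Ioo).2 (Eventually.of_forall fun x hx =>
    (h x (Ioo_subset_Icc_self hx)).hasDerivAt (Icc_mem_nhds hx.1 hx.2))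

/-- The energy in terms of the cosine coefficients. -/
theorem hasSum_energy {f f' : ℝ → ℝ}
    (h : ∀ x ∈ Icc (0 : ℝ) 1, HasDerivWithinAt f (f' x) (Icc 0 1) x)
    (hc : ContinuousOn f' (Icc 0 1)) :
    HasSum (fun n : ℤ => (1 + (n * π) ^ 2) * cosCoeff f n ^ 2) (energy f f') := by
  have hf : ContinuousOn f (Icc 0 1) := fun x hx => (h x hx).continuousWithinAt
  have h1 := hasSum_sq_cosCoeff (memLp_restrict_of_continuousOn hf)
  have h2 := hasSum_sq_sinCoeff (memLp_restrict_of_continuousOn hc)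
  rw [energy_eq hf hc]
  refine (h1.add h2).congr_fun fun n => ?_
  rw [sinCoeff_deriv (ac_of_hasDerivWithinAt h hc) (ae_hasDerivAt_of_Icc h)]
  ring

/-- A function of class `C¹` is determined by its cosine coefficients. -/
theorem eqOn_zero_of_cosCoeff {f f' : ℝ → ℝ}
    (h : ∀ x ∈ Icc (0 : ℝ) 1, HasDerivWithinAt f (f' x) (Icc 0 1) x)
    (hc : ContinuousOn f' (Icc 0 1)) (h0 : ∀ n, cosCoeff f n = 0) :
    ∀ x ∈ Icc (0 : ℝ) 1, f x = 0 := by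
  have hE : energy f f' = 0 := (hasSum_energy h hc).unique (by simp [h0])
  intro x hx
  have := sq_le_energy h hc hx
  rw [hE, mul_zero] at this
  exact pow_eq_zero_iff two_ne_zero |>.1 (le_antisymm this (sq_nonneg _))

/-! ### The heat equation with homogeneous Neumann conditions -/

/-- The decay factor of the `n`-th mode. -/
def modeDecay (ε κ t₀ : ℝ) (n : ℤ) (t : ℝ) : ℝ := Real.exp (-(ε * (n * π) ^ 2 + κ) * (t - t₀))

/-- The solution with coefficients `β` at time `t₀`. -/
def heat (ε κ t₀ : ℝ) (β : ℤ → ℝ) (x t : ℝ) : ℝ :=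
  ∑' n : ℤ, β n * modeDecay ε κ t₀ n t * Real.cos (n * π * x)

/-- The `x`-derivative of `heat`. -/
def heat1 (ε κ t₀ : ℝ) (β : ℤ → ℝ) (x t : ℝ) : ℝ :=
  ∑' n : ℤ, -(n * π) * (β n * modeDecay ε κ t₀ n t) * Real.sin (n * π * x)

/-- The second `x`-derivative of `heat`. -/
def heat2 (ε κ t₀ : ℝ) (β : ℤ → ℝ) (x t : ℝ) : ℝ :=
  ∑' n : ℤ, -(n * π) ^ 2 * (β n * modeDecay ε κ t₀ n t) * Real.cos (n * π * x)

theorem C1Fam.of_Ici {t₀ : ℝ} {V V₁ : ℝ → ℝ → ℝ} (h : ∀ t₁, t₀ < t₁ → C1Fam (Ici t₁) V V₁) :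
    C1Fam (Ioi t₀) V V₁ :=
  ⟨fun t ht => (h t ht).deriv t self_mem_Ici, continuousOn_Ioi_of_Ici fun t₁ h₁ => (h t₁ h₁).cont,
    continuousOn_Ioi_of_Ici fun t₁ h₁ => (h t₁ h₁).cont'⟩

section

variable {ε κ t₀ : ℝ} (hε : 0 < ε) (hκ : 0 ≤ κ)

theorem modeDecay_nonneg (n : ℤ) (t : ℝ) : 0 ≤ modeDecay ε κ t₀ n t := (Real.exp_pos _).le

theorem modeDecay_self (n : ℤ) : modeDecay ε κ t₀ n t₀ = 1 := by simp [modeDecay]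

theorem modeDecay_neg (n : ℤ) (t : ℝ) : modeDecay ε κ t₀ (-n) t = modeDecay ε κ t₀ n t := by
  simp only [modeDecay]; push_cast; ring_nf

theorem continuous_modeDecay (n : ℤ) : Continuous (modeDecay ε κ t₀ n) := by
  unfold modeDecay; fun_prop

theorem hasDerivAt_modeDecay (n : ℤ) (t : ℝ) : HasDerivAt (modeDecay ε κ t₀ n)
    (-(ε * (n * π) ^ 2 + κ) * modeDecay ε κ t₀ n t) t := by
  have := (((hasDerivAt_id t).sub_const t₀).const_mul (-(ε * (n * π) ^ 2 + κ))).exp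
  refine this.congr_deriv ?_
  simp only [modeDecay, id]; ring

include hε in
theorem modeDecay_le (n : ℤ) {t : ℝ} (ht : t₀ ≤ t) :
    modeDecay ε κ t₀ n t ≤ Real.exp (-κ * (t - t₀)) := by
  refine Real.exp_le_exp.2 (mul_le_mul_of_nonneg_right ?_ (sub_nonneg.2 ht))
  have : 0 ≤ ε * (n * π) ^ 2 := by positivity
  linarith

include hε hκ in
theorem modeDecay_le_one (n : ℤ) {t : ℝ} (ht : t₀ ≤ t) : modeDecay ε κ t₀ n t ≤ 1 := by
  refine (modeDecay_le hε n ht).trans (Real.exp_le_one_iff.2 ?_)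
  nlinarith [mul_nonneg hκ (sub_nonneg.2 ht)]

include hε hκ in
-- Parabolic smoothing: y e^{-y} ≤ 1 with y = (nπ)² ε (t₁ - t₀). The bound is uniform in n and in t
-- ≥ t₁, and degenerates as t₁ tends to t₀.
theorem sq_mul_modeDecay_le (n : ℤ) {t₁ t : ℝ} (h₁ : t₀ < t₁) (ht : t₁ ≤ t) :
    (n * π) ^ 2 * modeDecay ε κ t₀ n t ≤ 1 / (ε * (t₁ - t₀)) := by
  have hδ : 0 < t₁ - t₀ := sub_pos.2 h₁
  have h0 : 0 ≤ ε * (n * π) ^ 2 := by positivity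
  have h2 : modeDecay ε κ t₀ n t ≤ Real.exp (-((n * π) ^ 2 * (ε * (t₁ - t₀)))) := by
    refine Real.exp_le_exp.2 ?_
    nlinarith [mul_le_mul_of_nonneg_left (sub_le_sub_right ht t₀) h0,
      mul_nonneg hκ (sub_nonneg.2 (h₁.le.trans ht))]
  rw [le_div_iff₀ (by positivity)]
  calc (n * π) ^ 2 * modeDecay ε κ t₀ n t * (ε * (t₁ - t₀))
      = (n * π) ^ 2 * (ε * (t₁ - t₀)) * modeDecay ε κ t₀ n t := by ring
    _ ≤ Real.exp ((n * π) ^ 2 * (ε * (t₁ - t₀)))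
        * Real.exp (-((n * π) ^ 2 * (ε * (t₁ - t₀)))) := by
      refine mul_le_mul ?_ h2 (modeDecay_nonneg _ _) (Real.exp_pos _).le
      linarith [Real.add_one_le_exp ((n * π : ℝ) ^ 2 * (ε * (t₁ - t₀)))]
    _ = 1 := by rw [← Real.exp_add, add_neg_cancel, Real.exp_zero]

theorem heat_mode_deriv (r : ℝ) (n : ℤ) (x : ℝ) : HasDerivAt (fun z => r * Real.cos (n * π * z))
    (-(n * π) * r * Real.sin (n * π * x)) x :=
  ((hasDerivAt_cos_mul (n * π) x).const_mul r).congr_deriv (by ring)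

theorem heat1_mode_deriv (r : ℝ) (n : ℤ) (x : ℝ) :
    HasDerivAt (fun z => -(n * π) * r * Real.sin (n * π * z))
    (-(n * π) ^ 2 * r * Real.cos (n * π * x)) x :=
  ((hasDerivAt_sin_mul (n * π) x).const_mul _).congr_deriv (by ring)

theorem continuous_modeDecay_snd (n : ℤ) :
    Continuous fun p : ℝ × ℝ => modeDecay ε κ t₀ n p.2 :=
  (continuous_modeDecay n).comp continuous_snd

include hε hκ in
theorem abs_mul_modeDecay_le (r : ℝ) (n : ℤ) {t : ℝ} (ht : t₀ ≤ t) :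
    |r * modeDecay ε κ t₀ n t| ≤ |r| := by
  rw [abs_mul, abs_of_nonneg (modeDecay_nonneg n t)]
  exact mul_le_of_le_one_right (abs_nonneg _) (modeDecay_le_one hε hκ n ht)

include hε hκ in
theorem c1Fam_heat {β : ℤ → ℝ} (hβ : Summable fun n => |β n|)
    (hβ₁ : Summable fun n : ℤ => |n * π * β n|) :
    C1Fam (Ici t₀) (heat ε κ t₀ β) (heat1 ε κ t₀ β) := by
  have hc := fun n => continuous_modeDecay_snd (ε := ε) (κ := κ) (t₀ := t₀) n
  refine C1Fam.of_tsum (f := fun n x t => β n * modeDecay ε κ t₀ n t * Real.cos (n * π * x))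
    (f₁ := fun n x t => -(n * π) * (β n * modeDecay ε κ t₀ n t) * Real.sin (n * π * x)) hβ hβ₁
    (fun n t x => heat_mode_deriv _ n x) (fun n => ?_) (fun n => ?_)
    (fun n x t ht => (abs_mul_cos_le _ _).trans (abs_mul_modeDecay_le hε hκ _ n ht))
    (fun n x t ht => (abs_mul_sin_le _ _).trans ?_)
  · have := hc n; fun_prop
  · have := hc n; fun_prop
  · refine le_trans (le_of_eq ?_) (abs_mul_modeDecay_le hε hκ (n * π * β n) n ht)
    rw [← abs_neg]; congr 1; ring

include hε hκ in
theorem abs_sq_mul_modeDecay_le (r : ℝ) (n : ℤ) {t₁ t : ℝ} (h₁ : t₀ < t₁) (ht : t₁ ≤ t) :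
    |-(n * π) ^ 2 * (r * modeDecay ε κ t₀ n t)| ≤ 1 / (ε * (t₁ - t₀)) * |r| := by
  rw [show -(n * π) ^ 2 * (r * modeDecay ε κ t₀ n t)
    = -((n * π) ^ 2 * modeDecay ε κ t₀ n t * r) by ring, abs_neg, abs_mul,
    abs_of_nonneg (mul_nonneg (sq_nonneg _) (modeDecay_nonneg n t))]
  exact mul_le_mul_of_nonneg_right (sq_mul_modeDecay_le hε hκ n h₁ ht) (abs_nonneg _)

include hε hκ in
-- Away from t₀ the decay factor pays for two derivatives in x, so summability of the coefficients
-- alone suffices.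
theorem c1Fam_heat_of_lt {β : ℤ → ℝ} (hβ : Summable fun n => |β n|) {t₁ : ℝ} (h₁ : t₀ < t₁) :
    C1Fam (Ici t₁) (heat ε κ t₀ β) (heat1 ε κ t₀ β) ∧
    C1Fam (Ici t₁) (heat1 ε κ t₀ β) (heat2 ε κ t₀ β) := by
  have hc := fun n => continuous_modeDecay_snd (ε := ε) (κ := κ) (t₀ := t₀) n
  have b1 : ∀ (n : ℤ) (x : ℝ), ∀ t ∈ Ici t₁,
      |-(n * π) * (β n * modeDecay ε κ t₀ n t) * Real.sin (n * π * x)|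
        ≤ (1 + 1 / (ε * (t₁ - t₀))) * |β n| := fun n x t ht => by
    refine (abs_mul_sin_le _ _).trans ?_
    have h2 := abs_mul_modeDecay_le hε hκ (β n) n (h₁.le.trans ht)
    have h3 := abs_sq_mul_modeDecay_le hε hκ (β n) n h₁ ht
    rw [abs_mul, abs_neg, abs_of_nonneg (sq_nonneg _)] at h3
    rw [abs_mul, abs_neg]
    have h4 : |(n * π : ℝ)| ≤ 1 + (n * π) ^ 2 := by
      rw [← sq_abs]; nlinarith [sq_nonneg (|(n * π : ℝ)| - 1), abs_nonneg (n * π : ℝ)]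
    nlinarith [mul_le_mul_of_nonneg_right h4 (abs_nonneg (β n * modeDecay ε κ t₀ n t))]
  refine ⟨C1Fam.of_tsum (f := fun n x t => β n * modeDecay ε κ t₀ n t * Real.cos (n * π * x))
    (f₁ := fun n x t => -(n * π) * (β n * modeDecay ε κ t₀ n t) * Real.sin (n * π * x)) hβ
    (hβ.mul_left _) (fun n t x => heat_mode_deriv _ n x) (fun n => ?_) (fun n => ?_)
    (fun n x t ht => (abs_mul_cos_le _ _).trans
      (abs_mul_modeDecay_le hε hκ _ n (h₁.le.trans ht))) b1,
    C1Fam.of_tsum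
    (f := fun n x t => -(n * π) * (β n * modeDecay ε κ t₀ n t) * Real.sin (n * π * x))
    (f₁ := fun n x t => -(n * π) ^ 2 * (β n * modeDecay ε κ t₀ n t) * Real.cos (n * π * x))
    (hβ.mul_left _) (hβ.mul_left _) (fun n t x => heat1_mode_deriv _ n x) (fun n => ?_)
    (fun n => ?_) b1 (fun n x t ht => (abs_mul_cos_le _ _).trans
      (abs_sq_mul_modeDecay_le hε hκ _ n h₁ ht))⟩
  all_goals
    have := hc n
    fun_prop

include hε hκ in
theorem linSol_heat {β : ℤ → ℝ} (hβ : Summable fun n => |β n|) :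
    LinSol ε κ (Ioi t₀) (heat ε κ t₀ β) (heat1 ε κ t₀ β) (heat2 ε κ t₀ β) := by
  have f0 : C1Fam (Ioi t₀) (heat ε κ t₀ β) (heat1 ε κ t₀ β) :=
    C1Fam.of_Ici fun t₁ h₁ => (c1Fam_heat_of_lt hε hκ hβ h₁).1
  have f1 : C1Fam (Ioi t₀) (heat1 ε κ t₀ β) (heat2 ε κ t₀ β) :=
    C1Fam.of_Ici fun t₁ h₁ => (c1Fam_heat_of_lt hε hκ hβ h₁).2
  refine ⟨f0, f1, fun x _ t ht => ?_, (f1.cont'.const_mul ε).sub (f0.cont.const_mul κ)⟩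
  have ht' : t₀ < t := ht
  -- Strictly between t₀ and t, because the bounds for termwise differentiation hold only on
  -- half-lines bounded away from t₀.
  set t₁ := (t₀ + t) / 2 with ht₁
  have h₁ : t₀ < t₁ := by linarith
  have h₁t : t₁ < t := by linarith
  have s0 : ∀ s, t₁ ≤ s → Summable fun n : ℤ =>
      β n * modeDecay ε κ t₀ n s * Real.cos (n * π * x) := fun s hs =>
    Summable.of_norm_bounded hβ fun n => (abs_mul_cos_le _ _).trans
      (abs_mul_modeDecay_le hε hκ (β n) n (h₁.le.trans hs))
  have s2 : ∀ s, t₁ ≤ s → Summable fun n : ℤ =>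
      -(n * π) ^ 2 * (β n * modeDecay ε κ t₀ n s) * Real.cos (n * π * x) := fun s hs =>
    Summable.of_norm_bounded (hβ.mul_left (1 / (ε * (t₁ - t₀)))) fun n =>
      (abs_mul_cos_le _ _).trans (abs_sq_mul_modeDecay_le hε hκ (β n) n h₁ hs)
  have hD := hasDerivAt_tsum_of_isPreconnected (𝕜 := ℝ) (F := ℝ)
    (g := fun (n : ℤ) s => β n * modeDecay ε κ t₀ n s * Real.cos (n * π * x))
    (g' := fun (n : ℤ) s => ε * (-(n * π) ^ 2 * (β n * modeDecay ε κ t₀ n s) * Real.cos (n * π * x))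
      - κ * (β n * modeDecay ε κ t₀ n s * Real.cos (n * π * x)))
    (((hβ.mul_left (1 / (ε * (t₁ - t₀)))).mul_left ε).add (hβ.mul_left κ))
    isOpen_Ioi isPreconnected_Ioi (fun n s _ => ?_) (fun n s hs => ?_) (mem_Ioi.2 h₁t) (s0 t h₁t.le)
    (mem_Ioi.2 h₁t)
  · refine hD.congr_deriv ?_
    rw [((s2 t h₁t.le).mul_left ε).tsum_sub ((s0 t h₁t.le).mul_left κ), tsum_mul_left,
      tsum_mul_left]
    rfl
  · refine (((hasDerivAt_modeDecay n s).const_mul (β n)).mul_const _).congr_deriv ?_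
    ring
  · have hs' : t₁ ≤ s := le_of_lt hs
    refine (norm_sub_le _ _).trans (add_le_add ?_ ?_)
    · rw [norm_mul, Real.norm_of_nonneg hε.le]
      exact mul_le_mul_of_nonneg_left ((abs_mul_cos_le _ _).trans
        (abs_sq_mul_modeDecay_le hε hκ (β n) n h₁ hs')) hε.le
    · rw [norm_mul, Real.norm_of_nonneg hκ]
      exact mul_le_mul_of_nonneg_left ((abs_mul_cos_le _ _).trans
        (abs_mul_modeDecay_le hε hκ (β n) n (h₁.le.trans hs'))) hκ

end

/-- Passes from an L² second derivative to absolutely convergent series for w and w_x. For n ≠ 0 and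
p = |nπβ_n| one has 2p ≤ (np)² + 1/n²; the mode n = 0 of the first series is added separately. -/
theorem summable_abs_mul_of_sq {β : ℤ → ℝ} (h : Summable fun n : ℤ => ((n * π) ^ 2 * β n) ^ 2) :
    (Summable fun n => |β n|) ∧ Summable fun n : ℤ => |n * π * β n| := by
  have hπ : (1 : ℝ) ≤ π := by linarith [Real.two_le_pi]
  have h1 : Summable fun n : ℤ => |n * π * β n| := by
    refine Summable.of_norm_bounded
      (h.add (Real.summable_one_div_int_pow.2 (by norm_num : 1 < 2))) fun n => ?_
    rw [Real.norm_eq_abs, abs_abs]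
    rcases eq_or_ne n 0 with rfl | hn
    · simp
    have hn' : (n : ℝ) ≠ 0 := by exact_mod_cast hn
    set p := |n * π * β n|
    have hp : p ^ 2 = (n * π * β n) ^ 2 := sq_abs _
    have e : ((n * π) ^ 2 * β n) ^ 2 = π ^ 2 * (n * p) ^ 2 := by rw [mul_pow (n : ℝ) p, hp]; ring
    have h2 : (n * p : ℝ) ^ 2 ≤ π ^ 2 * (n * p) ^ 2 :=
      le_mul_of_one_le_left (sq_nonneg _) (one_le_pow₀ hπ)
    have h3 : 2 * p ≤ (n * p : ℝ) ^ 2 + 1 / (n : ℝ) ^ 2 := by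
      have h4 : (n * p - 1 / n : ℝ) ^ 2 = (n * p) ^ 2 + 1 / (n : ℝ) ^ 2 - 2 * p := by
        field_simp; ring
      linarith [sq_nonneg (n * p - 1 / n : ℝ)]
    rw [e]
    linarith [abs_nonneg (n * π * β n : ℝ)]
  refine ⟨Summable.of_norm_bounded (h1.add (hasSum_ite_eq (0 : ℤ) |β 0|).summable) fun n => ?_, h1⟩
  rw [Real.norm_eq_abs, abs_abs]
  split_ifs with hn
  · rw [hn]; simp
  · rw [add_zero, abs_mul]
    refine le_mul_of_one_le_left (abs_nonneg _) ?_
    rw [abs_mul, abs_of_pos Real.pi_pos]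
    have : (1 : ℝ) ≤ |(n : ℝ)| := by exact_mod_cast Int.one_le_abs hn
    nlinarith

/-- The heat equation with homogeneous Neumann conditions and initial state in `H²`. -/
theorem exists_neumann_heat {ε κ : ℝ} (hε : 0 < ε) (hκ : 0 ≤ κ) (t₀ : ℝ) {w₀ w₀' g : ℝ → ℝ}
    (h₀ : ∀ x ∈ Icc (0 : ℝ) 1, HasDerivWithinAt w₀ (w₀' x) (Icc 0 1) x)
    (hac : AbsolutelyContinuousOnInterval w₀' 0 1)
    (hd : ∀ᵐ x ∂volume.restrict (Ioo 0 1), HasDerivAt w₀' (g x) x)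
    (hg : MemLp g 2 (volume.restrict (Ioo 0 1))) (hb0 : w₀' 0 = 0) (hb1 : w₀' 1 = 0) :
    ∃ w w₁ w₂ : ℝ → ℝ → ℝ, C1Fam (Ici t₀) w w₁ ∧ LinSol ε κ (Ioi t₀) w w₁ w₂ ∧
      (∀ x ∈ Icc (0 : ℝ) 1, w x t₀ = w₀ x) ∧ (∀ t, w₁ 0 t = 0 ∧ w₁ 1 t = 0) ∧
      (∀ t, t₀ ≤ t → AbsolutelyContinuousOnInterval (fun x => w₁ x t) 0 1) ∧
      (∀ t, t₀ ≤ t → ∀ᵐ x ∂volume.restrict (Ioo 0 1), HasDerivAt (fun z => w₁ z t) (w₂ x t) x) ∧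
      (∀ t, t₀ ≤ t → MemLp (fun x => w₂ x t) 2 (volume.restrict (Ioo 0 1))) ∧
      (∀ t, t₀ ≤ t → Tendsto (fun s => ∫ x in (0 : ℝ)..1, (w₂ x s - w₂ x t) ^ 2)
        (𝓝[Ici t₀] t) (𝓝 0)) ∧
      ∀ t, t₀ ≤ t → energy (fun x => w x t) (fun x => w₁ x t)
        ≤ Real.exp (-2 * κ * (t - t₀)) * energy w₀ w₀' := by
  have hc₀' : ContinuousOn w₀' (Icc 0 1) := by
    have := hac.continuousOn; rwa [uIcc_of_le zero_le_one] at this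
  have hc₀ : ContinuousOn w₀ (Icc 0 1) := fun x hx => (h₀ x hx).continuousWithinAt
  set β : ℤ → ℝ := cosCoeff w₀ with hβdef
  have hβe : ∀ n, β (-n) = β n := cosCoeff_neg w₀
  -- The two Neumann conditions make the coefficients of the second derivative those of the formally
  -- differentiated cosine series.
  have hgβ : ∀ n, cosCoeff g n = -(n * π) ^ 2 * β n := fun n => by
    rw [cosCoeff_deriv hac hd hb0 hb1,
      sinCoeff_deriv (ac_of_hasDerivWithinAt h₀ hc₀') (ae_hasDerivAt_of_Icc h₀)]
    ring
  have hg2 : Summable fun n : ℤ => (-(n * π) ^ 2 * β n) ^ 2 := by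
    have := (hasSum_sq_cosCoeff hg).summable
    simpa only [hgβ] using this
  obtain ⟨hβ, hβ₁⟩ := summable_abs_mul_of_sq (β := β) (hg2.congr fun n => by ring)
  have fam := c1Fam_heat (t₀ := t₀) hε hκ hβ hβ₁
  have lin := linSol_heat (t₀ := t₀) hε hκ hβ
  set w := heat ε κ t₀ β
  set w₁ := heat1 ε κ t₀ β
  -- At t₀ the twice differentiated series need not converge pointwise; the given L² function g,
  -- which has the right coefficients, replaces it there.
  set w₂ : ℝ → ℝ → ℝ := fun x t => if t = t₀ then g x else heat2 ε κ t₀ β x t with hw₂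
  have hw₂eq : ∀ t, t₀ < t → ∀ x, heat2 ε κ t₀ β x t = w₂ x t := fun t ht x => by
    rw [hw₂]; simp only [if_neg ht.ne']
  have lin' : LinSol ε κ (Ioi t₀) w w₁ w₂ :=
    ⟨lin.fam, lin.fam₁.congr (fun _ _ _ _ => rfl) fun x _ t ht => (hw₂eq t ht x).symm,
      ⟨fun x hx t ht => by rw [← hw₂eq t ht]; exact lin.time.deriv x hx t ht,
        lin.time.cont.congr fun p hp => by simp only [hw₂eq p.2 hp.2 p.1]⟩⟩
  have hcw : ∀ t, t₀ ≤ t → ∀ n, cosCoeff (fun x => w x t) n = β n * modeDecay ε κ t₀ n t :=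
    fun t ht n => cosCoeff_tsum (β := fun n => β n * modeDecay ε κ t₀ n t)
      (Summable.of_nonneg_of_le (fun _ => abs_nonneg _)
        (fun n => abs_mul_modeDecay_le hε hκ (β n) n ht) hβ)
      (fun n => by rw [hβe, modeDecay_neg]) n
  have hcw₂ : ∀ t, t₀ ≤ t → ∀ n, cosCoeff (fun x => w₂ x t) n
      = -(n * π) ^ 2 * (β n * modeDecay ε κ t₀ n t) := fun t ht n => by
    rcases ht.eq_or_lt with rfl | ht'
    · simp only [hw₂, if_true, modeDecay_self, mul_one]
      exact hgβ n
    · simp only [← hw₂eq t ht']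
      refine cosCoeff_tsum (β := fun n : ℤ => -(n * π) ^ 2 * (β n * modeDecay ε κ t₀ n t))
        (Summable.of_nonneg_of_le (fun _ => abs_nonneg _)
          (fun n => abs_sq_mul_modeDecay_le hε hκ (β n) n ht' le_rfl) (hβ.mul_left _))
        (fun n => ?_) n
      simp only [hβe, modeDecay_neg]; push_cast; ring
  -- Both functions are C¹ on `[0,1]` and have the same cosine coefficients.
  have hinit : ∀ x ∈ Icc (0 : ℝ) 1, w x t₀ = w₀ x := by
    have h1 : ∀ x ∈ Icc (0 : ℝ) 1,
        HasDerivWithinAt (fun z => w z t₀ - w₀ z) (w₁ x t₀ - w₀' x) (Icc 0 1) x :=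
      fun x hx => (fam.deriv t₀ self_mem_Ici x hx).sub (h₀ x hx)
    intro x hx
    refine sub_eq_zero.1 (eqOn_zero_of_cosCoeff h1 ((fam.slice' self_mem_Ici).sub hc₀')
      (fun n => ?_) x hx)
    rw [cosCoeff_sub (memLp_restrict_of_continuousOn (fam.slice self_mem_Ici))
      (memLp_restrict_of_continuousOn hc₀), hcw t₀ le_rfl, modeDecay_self, mul_one, sub_self]
  have hinit' : EqOn w₀' (fun x => w₁ x t₀) (Icc 0 1) := fun x hx => by
    have h1 := (fam.deriv t₀ self_mem_Ici x hx).congr_of_eventuallyEq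
      (f₁ := w₀) (eventually_nhdsWithin_of_forall fun z hz => (hinit z hz).symm)
      (hinit x hx).symm
    exact (uniqueDiffOn_Icc zero_lt_one x hx).eq_deriv _ (h₀ x hx) h1
  have hae : ∀ t, t₀ ≤ t → ∀ᵐ x ∂volume.restrict (Ioo 0 1),
      HasDerivAt (fun z => w₁ z t) (w₂ x t) x := fun t ht => by
    rcases ht.eq_or_lt with rfl | ht'
    · filter_upwards [hd, ae_restrict_mem measurableSet_Ioo] with x hx hxm
      simp only [hw₂, if_true]
      exact hx.congr_of_eventuallyEq (Filter.eventuallyEq_of_mem (Icc_mem_nhds hxm.1 hxm.2)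
        hinit').symm
    · exact ae_hasDerivAt_of_Icc (lin'.fam₁.deriv t ht')
  have hm : ∀ t, t₀ ≤ t → MemLp (fun x => w₂ x t) 2 (volume.restrict (Ioo 0 1)) := fun t ht => by
    rcases ht.eq_or_lt with rfl | ht'
    · simpa only [hw₂, if_true] using hg
    · exact memLp_restrict_of_continuousOn (lin'.fam₁.slice' ht')
  refine ⟨w, w₁, w₂, fam, lin', hinit, fun t => ⟨?_, ?_⟩, fun t ht => ?_, hae, hm,
    fun t ht => ?_, fun t ht => ?_⟩
  · simp [w₁, heat1]
  · simp [w₁, heat1, Real.sin_int_mul_pi]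
  · rcases ht.eq_or_lt with rfl | ht'
    · exact ac_congr hac hinit'
    · exact ac_of_hasDerivWithinAt (lin'.fam₁.deriv t ht') (lin'.fam₁.slice' ht')
  · have hsum : ∀ s, t₀ ≤ s → ∫ x in (0 : ℝ)..1, (w₂ x s - w₂ x t) ^ 2
        = ∑' n : ℤ, (-(n * π) ^ 2 * (β n * modeDecay ε κ t₀ n s)
          - -(n * π) ^ 2 * (β n * modeDecay ε κ t₀ n t)) ^ 2 := fun s hs => by
      have h1 : MemLp (fun x => w₂ x s - w₂ x t) 2 (volume.restrict (Ioo 0 1)) :=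
        (hm s hs).sub (hm t ht)
      rw [← (hasSum_sq_cosCoeff h1).tsum_eq]
      refine tsum_congr fun n => ?_
      rw [cosCoeff_sub (hm s hs) (hm t ht), hcw₂ s hs, hcw₂ t ht]
    have hlim : Tendsto (fun s => ∑' n : ℤ, (-(n * π) ^ 2 * (β n * modeDecay ε κ t₀ n s)
          - -(n * π) ^ 2 * (β n * modeDecay ε κ t₀ n t)) ^ 2) (𝓝[Ici t₀] t)
        (𝓝 (∑' n : ℤ, (0 : ℝ))) := by
      -- After Parseval's identity the L² continuity of w_xx is a limit of sums dominated by the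
      -- squared coefficients of g, valid down to t₀.
      refine tendsto_tsum_of_dominated_convergence hg2 (fun n => ?_) ?_
      · have hcont : Continuous fun s => (-(n * π) ^ 2 * (β n * modeDecay ε κ t₀ n s)
          - -(n * π) ^ 2 * (β n * modeDecay ε κ t₀ n t)) ^ 2 := by
          have := continuous_modeDecay (ε := ε) (κ := κ) (t₀ := t₀) n
          fun_prop
        have := (hcont.tendsto t).mono_left (nhdsWithin_le_nhds (s := Ici t₀))
        simpa using this
      · refine eventually_nhdsWithin_of_forall fun s hs n => ?_
        rw [Real.norm_of_nonneg (sq_nonneg _),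
          show -(n * π) ^ 2 * (β n * modeDecay ε κ t₀ n s)
            - -(n * π) ^ 2 * (β n * modeDecay ε κ t₀ n t)
            = (-(n * π) ^ 2 * β n) * (modeDecay ε κ t₀ n s - modeDecay ε κ t₀ n t) by ring, mul_pow]
        refine mul_le_of_le_one_right (sq_nonneg _) ?_
        rw [sq_le_one_iff_abs_le_one, abs_le]
        have h1 := modeDecay_le_one hε hκ n (mem_Ici.1 hs)
        have h2 := modeDecay_le_one hε hκ n ht
        have h3 := modeDecay_nonneg (ε := ε) (κ := κ) (t₀ := t₀) n s
        have h4 := modeDecay_nonneg (ε := ε) (κ := κ) (t₀ := t₀) n t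
        exact ⟨by linarith, by linarith⟩
    rw [tsum_zero] at hlim
    exact hlim.congr' (eventually_nhdsWithin_of_forall fun s hs => (hsum s hs).symm)
  · have h1 := hasSum_energy (fam.deriv t ht) (fam.slice' ht)
    have h2 := (hasSum_energy h₀ hc₀').mul_left (Real.exp (-2 * κ * (t - t₀)))
    refine hasSum_le (fun n => ?_) h1 h2
    rw [hcw t ht]
    have h3 : modeDecay ε κ t₀ n t ^ 2 ≤ Real.exp (-2 * κ * (t - t₀)) := by
      refine (pow_le_pow_left₀ (modeDecay_nonneg n t) (modeDecay_le hε n ht) 2).trans (le_of_eq ?_)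
      rw [← Real.exp_nat_mul]; congr 1; push_cast; ring
    have h4 : 0 ≤ (1 + (n * π : ℝ) ^ 2) * β n ^ 2 := by positivity
    calc (1 + (n * π : ℝ) ^ 2) * (β n * modeDecay ε κ t₀ n t) ^ 2
        = modeDecay ε κ t₀ n t ^ 2 * ((1 + (n * π : ℝ) ^ 2) * β n ^ 2) := by ring
      _ ≤ _ := mul_le_mul_of_nonneg_right h3 h4

/-! ### The reference trajectory -/

/-- `u` and `u'` agree from the time `t₀` on. -/
theorem SolvesPlant.congr {ε a b t₀ : ℝ} {U₀ U₁ U₀' U₁' : ℝ → ℝ} {u u' : ℝ → ℝ → ℝ}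
    (h : SolvesPlant ε a b t₀ U₀ U₁ u) (hu : ∀ x t, t₀ ≤ t → u' x t = u x t)
    (h₀ : ∀ t, t₀ ≤ t → U₀' t = U₀ t) (h₁ : ∀ t, t₀ ≤ t → U₁' t = U₁ t) :
    SolvesPlant ε a b t₀ U₀' U₁' u' := by
  have hs : ∀ t, t₀ ≤ t → (fun x => u' x t) = fun x => u x t := fun t ht => funext fun x => hu x t ht
  have hd : ∀ x t, t₀ < t → u' x =ᶠ[𝓝 t] u x := fun x t ht => by
    filter_upwards [Ioi_mem_nhds ht] with s hs
    exact hu x s (le_of_lt hs)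
  obtain ⟨⟨a1, a2⟩, ⟨b1, b2, b3, b4, b5, b6, b7⟩, c, d⟩ := h
  refine ⟨⟨fun t ht => by rw [hs t ht]; exact a1 t ht, fun t ht => ?_⟩,
    ⟨fun t ht => by rw [hs t ht.le]; exact b1 t ht, fun t ht => by rw [hs t ht.le]; exact b2 t ht,
      fun x hx => (b3 x hx).congr fun t ht => hu x t (le_of_lt ht),
      b4.congr fun p hp => hu _ _ (le_of_lt hp.2),
      b5.congr fun p hp => by simp only [hs p.2 (le_of_lt hp.2)],
      b6.congr fun p hp => by simp only [hs p.2 (le_of_lt hp.2)],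
      b7.congr fun p hp => (hd _ _ hp.2).deriv_eq⟩,
    fun x hx t ht => ?_, fun t ht => ?_⟩
  · refine (a2 t ht).congr' (eventually_nhdsWithin_of_forall fun s hs' => ?_)
    simp only [hu _ t ht, hu _ s hs']
  · rw [(hd x t ht).deriv_eq, hs t ht.le]; exact c x hx t ht
  · rw [hs t ht, h₀ t ht, h₁ t ht]; exact d t ht

/-- The reference `v^r` is regular, bounded with its derivative, and small. -/
structure SmallReference (ε a b x₀ : ℝ) (y₁ y₂ : ℝ → ℝ) (D : ℝ) : Prop where
  eq : ∀ x t, 0 ≤ t → vRef ε a b x₀ y₁ y₂ x t = vRefD ε a b x₀ y₁ y₂ 0 x t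
  fam : C1Fam (Ici 0) (vRefD ε a b x₀ y₁ y₂ 0) (vRefD ε a b x₀ y₁ y₂ 1)
  fam₁ : C1Fam (Ici 0) (vRefD ε a b x₀ y₁ y₂ 1) (vRefD ε a b x₀ y₁ y₂ 2)
  lin : LinSol ε (a ^ 2 * b ^ 2 / (4 * ε)) (Ioi 0) (vRefD ε a b x₀ y₁ y₂ 0)
    (vRefD ε a b x₀ y₁ y₂ 1) (vRefD ε a b x₀ y₁ y₂ 2)
  half_le : ∀ x ∈ Icc (0 : ℝ) 1, ∀ t, 0 ≤ t →
    1 / 2 ≤ hcArg (a * b / (2 * ε)) (vRefD ε a b x₀ y₁ y₂ 0) x t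
  bound : ∀ x ∈ Icc (0 : ℝ) 1, ∀ t, 0 ≤ t → |vRefD ε a b x₀ y₁ y₂ 0 x t| ≤ D
  bound₁ : ∀ x ∈ Icc (0 : ℝ) 1, ∀ t, 0 ≤ t → |vRefD ε a b x₀ y₁ y₂ 1 x t| ≤ D

section SmallReference

variable {ε a b x₀ D : ℝ} {y₁ y₂ : ℝ → ℝ}

theorem SmallReference.uRef_eq (h : SmallReference ε a b x₀ y₁ y₂ D) (x : ℝ) {t : ℝ} (ht : 0 ≤ t) :
    uRef ε a b x₀ y₁ y₂ x t = hopfCole ε a b (vRefD ε a b x₀ y₁ y₂ 0) x t := by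
  rw [uRef, h.eq x t ht]; rfl

theorem SmallReference.dx_vRef (h : SmallReference ε a b x₀ y₁ y₂ D) {x t : ℝ} (ht : 0 ≤ t)
    (hx : x ∈ Icc (0 : ℝ) 1) :
    dx (fun x => vRef ε a b x₀ y₁ y₂ x t) x = vRefD ε a b x₀ y₁ y₂ 1 x t := by
  rw [dx_congr (fun z _ => h.eq z t ht) hx, h.fam.dx_eq ht hx]

theorem SmallReference.pos (h : SmallReference ε a b x₀ y₁ y₂ D) :
    ∀ x ∈ Icc (0 : ℝ) 1, ∀ t ∈ Ici (0 : ℝ),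
      0 < hcArg (a * b / (2 * ε)) (vRefD ε a b x₀ y₁ y₂ 0) x t :=
  fun x hx t ht => lt_of_lt_of_le one_half_pos (h.half_le x hx t ht)

theorem SmallReference.uRef0_eq (h : SmallReference ε a b x₀ y₁ y₂ D) {t : ℝ} (ht : 0 ≤ t) :
    uRef0 ε a b x₀ y₁ y₂ t = -(ε / a) * (hcArg1 (a * b / (2 * ε)) (vRefD ε a b x₀ y₁ y₂ 0)
      (vRefD ε a b x₀ y₁ y₂ 1) 0 t / hcArg (a * b / (2 * ε)) (vRefD ε a b x₀ y₁ y₂ 0) 0 t) := by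
  rw [uRef0, h.dx_vRef ht (by simp), h.eq 0 t ht, hcArg1, hcArg, mul_zero, Real.exp_zero, one_mul,
    one_mul]
  ring

theorem SmallReference.uRef1_eq (h : SmallReference ε a b x₀ y₁ y₂ D) {t : ℝ} (ht : 0 ≤ t) :
    uRef1 ε a b x₀ y₁ y₂ t = -(ε / a) * (hcArg1 (a * b / (2 * ε)) (vRefD ε a b x₀ y₁ y₂ 0)
      (vRefD ε a b x₀ y₁ y₂ 1) 1 t / hcArg (a * b / (2 * ε)) (vRefD ε a b x₀ y₁ y₂ 0) 1 t) := by
  rw [uRef1, h.dx_vRef ht (by simp), h.eq 1 t ht, hcArg1, hcArg, mul_one]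
  ring

theorem SmallReference.generates (h : SmallReference ε a b x₀ y₁ y₂ D) (hε : 0 < ε) (ha : a ≠ 0)
    (hx₀ : x₀ ∈ Icc (0 : ℝ) 1)
    (hs : ∀ x t : ℝ, 0 ≤ t → Summable (vRefEven ε a b x₀ y₁ x t) ∧
      Summable (vRefOdd ε a b x₀ y₁ y₂ x t)) :
    GeneratesReference ε a b x₀ y₁ y₂ := by
  have hH2 : ContinuousH2 0 (hopfCole ε a b (vRefD ε a b x₀ y₁ y₂ 0)) :=
    continuousH2_hopfCole (w₁ := fun _ _ => 0) (g := fun _ _ => 0) h.fam h.fam₁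
      (fun _ _ _ _ => (add_zero _).symm)
      (fun t _ => ac_of_hasDerivWithinAt (f' := fun _ => 0)
        (fun x _ => hasDerivWithinAt_const _ _ _) continuousOn_const)
      (fun t _ => Eventually.of_forall fun x => hasDerivAt_const x 0)
      (fun t _ => memLp_restrict_of_continuousOn continuousOn_const) (fun t _ => by simpa using tendsto_const_nhds) h.pos
  obtain ⟨hC, hP⟩ := h.lin.hopfCole hε ha fun x hx t ht => h.pos x hx t (Ioi_subset_Ici_self ht)
  have hf := h.fam.hopfCole h.pos
  have hdx := fun {t : ℝ} (ht : 0 ≤ t) {x : ℝ} (hx : x ∈ Icc (0 : ℝ) 1) => hf.dx_eq (t := t) ht hx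
  refine ⟨fun x hx t ht => ⟨(hs x t ht).1, (hs x t ht).2, ?_⟩, ?_, fun t ht => ?_⟩
  · rw [h.eq x t ht]; exact h.pos x hx t ht
  · have : SolvesPlant ε a b 0 (uRef0 ε a b x₀ y₁ y₂) (uRef1 ε a b x₀ y₁ y₂)
        (hopfCole ε a b (vRefD ε a b x₀ y₁ y₂ 0)) := by
      refine ⟨hH2, hC, hP, fun t ht => ⟨?_, ?_⟩⟩
      · rw [h.uRef0_eq ht, hdx ht (by simp)]
      · rw [h.uRef1_eq ht, hdx ht (by simp)]
    exact this.congr (fun x t ht => h.uRef_eq x ht) (fun _ _ => rfl) fun _ _ => rfl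
  · have e : hcArg (a * b / (2 * ε)) (vRefD ε a b x₀ y₁ y₂ 0) x₀ t = Real.exp (-(a / ε) * y₁ t) := by
      rw [← hopfCole_coleHopf (ε := ε) (a := a) (b := b) (fun _ t => y₁ t) x₀ t, hcArg, hcArg,
        vRefD_zero_at]
      rfl
    constructor
    · rw [h.uRef_eq x₀ ht, hopfCole, e, Real.log_exp]
      field_simp
    · rw [dx_congr (fun z _ => h.uRef_eq z ht) hx₀, hdx ht hx₀, e, hcArg1, vRefD_zero_at,
        vRefD_one_at, y1v, y2v]
      have hX : Real.exp (a * b / (2 * ε) * x₀) * Real.exp (-(a * b / (2 * ε)) * x₀) = 1 := by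
        rw [← Real.exp_add, neg_mul, add_neg_cancel, Real.exp_zero]
      have hY := (Real.exp_pos (-(a / ε) * y₁ t)).ne'
      set X := Real.exp (a * b / (2 * ε) * x₀)
      set X' := Real.exp (-(a * b / (2 * ε)) * x₀)
      set Y := Real.exp (-(a / ε) * y₁ t)
      rw [show X * (a * b / (2 * ε) * (X' * (Y - 1)) + X' * (-(a / ε) * Y * y₂ t
        - a * b / (2 * ε) * (Y - 1))) = X * X' * (-(a / ε) * Y * y₂ t) by ring, hX]
      field_simp

end SmallReference

/-- Every bound on v^r on `[0,1] × [0,∞)` is F times a constant depending only on the data fixed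
before F, so one threshold serves all outputs. D, in contrast, only has to be finite. -/
theorem exists_smallReference {ε a b x₀ M γ : ℝ} (hε : 0 < ε) (ha : a ≠ 0)
    (hx₀ : x₀ ∈ Icc (0 : ℝ) 1) (hM : 0 < M) (hγ₁ : 1 ≤ γ) (hγ₂ : γ < 2) :
    ∃ μ₁ : ℝ, 0 < μ₁ ∧ ∀ (F : ℝ) (y₁ y₂ : ℝ → ℝ), F ≤ μ₁ →
      IsGevrey F M γ (Ici 0) y₁ → IsGevrey F M γ (Ici 0) y₂ →
      GeneratesReference ε a b x₀ y₁ y₂ ∧ ∃ D, SmallReference ε a b x₀ y₁ y₂ D := by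
  obtain ⟨μ₀, A, hμ₀, hA, H⟩ := exists_gevBound_outputs ε a b x₀ M γ hε ha hM hγ₁
  set Q := (4 * M + a ^ 2 * b ^ 2 / (4 * ε)) / ε
  have hQ : 0 ≤ Q := by positivity
  have hE := entireBound_refBound hγ₂ hQ
  set T := egf (refBound γ Q) 1
  have hT : 0 ≤ T := tsum_nonneg fun n => by have := hE.nonneg n; positivity
  set β := a * b / (2 * ε)
  -- The argument of the logarithm differs from 1 by at most e^{|β|}AFT ≤ Fm ≤ 1/2; the summand 1
  -- keeps m positive.
  set m := Real.exp |β| * (A * T) + 1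
  have hm : 0 < m := by positivity
  refine ⟨min μ₀ (1 / (2 * m)), by positivity, fun F y₁ y₂ hF h₁ h₂ => ?_⟩
  have hF0 : 0 < F := h₁.1
  obtain ⟨g₁, g₂⟩ := H F y₁ y₂ (hF.trans (min_le_left _ _)) h₁ h₂
  have hB := hE.const_mul (mul_nonneg hA hF0.le)
  have h := fun (n : ℕ) (t : ℝ) (ht : 0 ≤ t) => abs_refC_le (x₀ := x₀) hε hγ₁ (by positivity)
    g₁ g₂ n ht
  have k0 := c1Fam_vRefD hε hB h g₁.1 g₂.1 hx₀ 0
  have k1 := c1Fam_vRefD hε hB h g₁.1 g₂.1 hx₀ 1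
  have b0 := fun (x : ℝ) (hx : x ∈ Icc (0 : ℝ) 1) (t : ℝ) (ht : 0 ≤ t) =>
    abs_vRefD_le hB h hx₀ 0 hx ht
  have b1 := fun (x : ℝ) (hx : x ∈ Icc (0 : ℝ) 1) (t : ℝ) (ht : 0 ≤ t) =>
    abs_vRefD_le hB h hx₀ 1 hx ht
  have eT : egf (fun n => A * F * refBound γ Q (n + 0)) 1 = A * F * T := by
    simp only [T, egf, add_zero, mul_assoc, tsum_mul_left]
  have hS : SmallReference ε a b x₀ y₁ y₂ (max (egf (fun n => A * F * refBound γ Q (n + 0)) 1)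
      (egf (fun n => A * F * refBound γ Q (n + 1)) 1)) := by
    refine ⟨fun x t ht => vRef_eq hB h x ht, k0, k1, linSol_vRefD hε hB h g₁.1 g₂.1 hx₀,
      fun x hx t ht => ?_, fun x hx t ht => (b0 x hx t ht).trans (le_max_left _ _),
      fun x hx t ht => (b1 x hx t ht).trans (le_max_right _ _)⟩
    have h3 := b0 x hx t ht
    rw [eT] at h3
    have h4 : Real.exp (β * x) ≤ Real.exp |β| := Real.exp_le_exp.2 (by
      have : |β * x| ≤ |β| := by
        rw [abs_mul, abs_of_nonneg hx.1]; exact mul_le_of_le_one_right (abs_nonneg _) hx.2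
      exact (le_abs_self _).trans this)
    have h5 : |Real.exp (β * x) * vRefD ε a b x₀ y₁ y₂ 0 x t| ≤ Real.exp |β| * (A * F * T) := by
      rw [abs_mul, abs_of_pos (Real.exp_pos _)]
      exact mul_le_mul h4 h3 (abs_nonneg _) (Real.exp_pos _).le
    have h6 : F * (2 * m) ≤ 1 := (le_div_iff₀ (by positivity)).1 (hF.trans (min_le_right _ _))
    have h7 : Real.exp |β| * (A * F * T) ≤ F * m := by
      have : F * m = Real.exp |β| * (A * F * T) + F := by simp only [m]; ring
      linarith
    have h8 := (abs_le.1 h5).1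
    rw [hcArg]
    linarith
  exact ⟨hS.generates hε ha hx₀ fun x t ht => ⟨summable_vRefEven hB h x ht,
    summable_vRefOdd hB h x ht⟩, _, hS⟩

/-! ### The feedback laws in the linearizing coordinates -/

section Feedback

variable {ε a b x₀ D c₁ : ℝ} {y₁ y₂ : ℝ → ℝ}

/-- The tracking error `v - v^r` in the linearizing coordinates. -/
def vErr (ε a b x₀ : ℝ) (y₁ y₂ : ℝ → ℝ) (u : ℝ → ℝ → ℝ) (x t : ℝ) : ℝ :=
  coleHopf ε a b u x t - vRefD ε a b x₀ y₁ y₂ 0 x t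

/-- The `x`-derivative of `vErr`, for `u_x = u₁`. -/
def vErr1 (ε a b x₀ : ℝ) (y₁ y₂ : ℝ → ℝ) (u u₁ : ℝ → ℝ → ℝ) (x t : ℝ) : ℝ :=
  coleHopf1 ε a b u u₁ x t - vRefD ε a b x₀ y₁ y₂ 1 x t

theorem SmallReference.exp_uRef (h : SmallReference ε a b x₀ y₁ y₂ D) (hε : 0 < ε) (ha : a ≠ 0)
    {x t : ℝ} (hx : x ∈ Icc (0 : ℝ) 1) (ht : 0 ≤ t) :
    Real.exp (-(a / ε) * uRef ε a b x₀ y₁ y₂ x t)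
      = hcArg (a * b / (2 * ε)) (vRefD ε a b x₀ y₁ y₂ 0) x t := by
  rw [h.uRef_eq x ht, hopfCole, show ∀ z, -(a / ε) * (-(ε / a) * z) = z by intro z; field_simp,
    Real.exp_log (h.pos x hx t ht)]

/-- `e^{ab x/(2ε)} ṽ` in terms of the tracking error. -/
theorem exp_mul_vErr (u : ℝ → ℝ → ℝ) (x t : ℝ) :
    Real.exp (a * b / (2 * ε) * x) * vErr ε a b x₀ y₁ y₂ u x t
      = Real.exp (-(a / ε) * u x t) - hcArg (a * b / (2 * ε)) (vRefD ε a b x₀ y₁ y₂ 0) x t := by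
  have h1 := hopfCole_coleHopf (ε := ε) (a := a) (b := b) u x t
  rw [hcArg] at h1 ⊢
  rw [vErr, mul_sub]
  linarith

theorem exp_mul_coleHopf1 (u u₁ : ℝ → ℝ → ℝ) (x t : ℝ) :
    Real.exp (a * b / (2 * ε) * x) * coleHopf1 ε a b u u₁ x t
      = -(a / ε) * Real.exp (-(a / ε) * u x t) * u₁ x t
        - a * b / (2 * ε) * (Real.exp (-(a / ε) * u x t) - 1) := by
  rw [coleHopf1, ← mul_assoc, ← Real.exp_add,
    show a * b / (2 * ε) * x + -(a * b / (2 * ε)) * x = 0 by ring, Real.exp_zero, one_mul]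

/-- The product equals e^{-abx/(2ε)}(e^{-au/ε} - e^{-au^r/ε}), which is v - v^r: the integral terms
of the feedback laws are linear in the new coordinates. -/
theorem SmallReference.feedback_integrand (h : SmallReference ε a b x₀ y₁ y₂ D) (hε : 0 < ε)
    (ha : a ≠ 0) (u : ℝ → ℝ → ℝ) {x t : ℝ} (hx : x ∈ Icc (0 : ℝ) 1) (ht : 0 ≤ t) :
    Real.exp (-(a * b / (2 * ε)) * x - a / ε * uRef ε a b x₀ y₁ y₂ x t) *
      (Real.exp (-(a / ε) * (u x t - uRef ε a b x₀ y₁ y₂ x t)) - 1)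
      = vErr ε a b x₀ y₁ y₂ u x t := by
  have h1 : Real.exp (-(a * b / (2 * ε)) * x) * Real.exp (a * b / (2 * ε) * x) = 1 := by
    rw [← Real.exp_add, neg_mul, neg_add_cancel, Real.exp_zero]
  have h2 := exp_mul_vErr (ε := ε) (a := a) (b := b) (x₀ := x₀) (y₁ := y₁) (y₂ := y₂) u x t
  have h3 := h.exp_uRef hε ha hx ht
  have h4 : Real.exp (-(a / ε) * uRef ε a b x₀ y₁ y₂ x t)
      * Real.exp (-(a / ε) * (u x t - uRef ε a b x₀ y₁ y₂ x t)) = Real.exp (-(a / ε) * u x t) := by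
    rw [← Real.exp_add]; congr 1; ring
  rw [show -(a * b / (2 * ε)) * x - a / ε * uRef ε a b x₀ y₁ y₂ x t
    = -(a * b / (2 * ε)) * x + -(a / ε) * uRef ε a b x₀ y₁ y₂ x t by ring, Real.exp_add, mul_assoc,
    mul_sub, h4, mul_one, h3, ← h2, ← mul_assoc, h1, one_mul]

/-- For z = 0 and z = 1 one has `kernelArg z ξ` = ξ(1-ξ), positive inside the interval; the end
points, where `kernelDx` is not identified, form a null set. -/
theorem SmallReference.feedback_integral (h : SmallReference ε a b x₀ y₁ y₂ D) (hε : 0 < ε)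
    (ha : a ≠ 0) (hc : 0 < c₁) (u : ℝ → ℝ → ℝ) {z t : ℝ} (hz : z = 0 ∨ z = 1) (ht : 0 ≤ t) :
    ∫ ξ in (0 : ℝ)..1, kernelDx ε c₁ z ξ *
      Real.exp (-(a * b / (2 * ε)) * ξ - a / ε * uRef ε a b x₀ y₁ y₂ ξ t) *
      (Real.exp (-(a / ε) * (u ξ t - uRef ε a b x₀ y₁ y₂ ξ t)) - 1)
      = ∫ ξ in (0 : ℝ)..1, kerX (c₁ / (4 * ε)) z ξ * vErr ε a b x₀ y₁ y₂ u ξ t := by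
  refine integral_congr_ae_Ioo ((ae_restrict_iff' measurableSet_Ioo).2
    (Eventually.of_forall fun ξ hξ => ?_))
  have hA : 0 < kernelArg z ξ := by
    rw [kernelArg]
    rcases hz with rfl | rfl <;> nlinarith [hξ.1, hξ.2, mul_pos hξ.1 (sub_pos.2 hξ.2)]
  rw [mul_assoc, h.feedback_integrand hε ha u (Ioo_subset_Icc_self hξ) ht,
    kernelDx_eq_kerX hε hc hA]

/-- The nonlinear law is a disguised homogeneous Neumann condition for the transformed error. With
u₁ arbitrary, the equivalence applies alike to the initial state, to the constructed solution and to
any competing solution. At x = 0 the Volterra integral runs from 1 to 0, hence the sign of the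
integral in the law. -/
theorem SmallReference.feedback0_iff (h : SmallReference ε a b x₀ y₁ y₂ D) (hε : 0 < ε)
    (ha : a ≠ 0) (hc : 0 < c₁) (u u₁ : ℝ → ℝ → ℝ) {t : ℝ} (ht : 0 ≤ t) :
    u₁ 0 t = feedback0 ε a b x₀ c₁ y₁ y₂ t (fun x => u x t) ↔
      trans1 (c₁ / (4 * ε)) (fun x => vErr ε a b x₀ y₁ y₂ u x t)
        (fun x => vErr1 ε a b x₀ y₁ y₂ u u₁ x t) 0 = 0 := by
  have h0 : (0 : ℝ) ∈ Icc (0 : ℝ) 1 := by simp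
  rw [feedback0, h.feedback_integral hε ha hc u (Or.inl rfl) ht, h.uRef0_eq ht, trans1, volt,
    sub_zero, intervalIntegral.integral_symm 0 1, kernel_eq_ker hε hc (by simp [kernelArg]), ker_diag,
    hcArg1]
  set I := ∫ ξ in (0 : ℝ)..1, kerX (c₁ / (4 * ε)) 0 ξ * vErr ε a b x₀ y₁ y₂ u ξ t
  have e1 := exp_mul_vErr (ε := ε) (a := a) (b := b) (x₀ := x₀) (y₁ := y₁) (y₂ := y₂) u 0 t
  have e2 := exp_mul_coleHopf1 (ε := ε) (a := a) (b := b) u u₁ 0 t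
  have e3 := h.exp_uRef hε ha h0 ht
  have hP := h.pos 0 h0 t ht
  have e4 : hcArg (a * b / (2 * ε)) (vRefD ε a b x₀ y₁ y₂ 0) 0 t
      = vRefD ε a b x₀ y₁ y₂ 0 0 t + 1 := by rw [hcArg, mul_zero, Real.exp_zero, one_mul]
  rw [mul_zero (a * b / (2 * ε)), Real.exp_zero, one_mul] at e1 e2 ⊢
  have e5 : Real.exp (-(a / ε) * (u 0 t - uRef ε a b x₀ y₁ y₂ 0 t))
      = Real.exp (-(a / ε) * u 0 t) / hcArg (a * b / (2 * ε)) (vRefD ε a b x₀ y₁ y₂ 0) 0 t := by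
    rw [← e3, ← Real.exp_sub]; congr 1; ring
  have e6 : Real.exp (a / ε * (u 0 t - uRef ε a b x₀ y₁ y₂ 0 t))
      = hcArg (a * b / (2 * ε)) (vRefD ε a b x₀ y₁ y₂ 0) 0 t / Real.exp (-(a / ε) * u 0 t) := by
    rw [← e3, ← Real.exp_sub]; congr 1; ring
  have e7 : Real.exp (a / ε * uRef ε a b x₀ y₁ y₂ 0 t)
      = 1 / hcArg (a * b / (2 * ε)) (vRefD ε a b x₀ y₁ y₂ 0) 0 t := by
    rw [← e3, one_div, ← Real.exp_neg]; congr 1; ring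
  have hY := Real.exp_pos (-(a / ε) * u 0 t)
  rw [e5, e6, e7, vErr1, e2, e1]
  set Y := Real.exp (-(a / ε) * u 0 t)
  set P := hcArg (a * b / (2 * ε)) (vRefD ε a b x₀ y₁ y₂ 0) 0 t
  set R₁ := vRefD ε a b x₀ y₁ y₂ 1 0 t
  rw [show vRefD ε a b x₀ y₁ y₂ 0 0 t = P - 1 by rw [e4]; ring]
  have key : -(ε / a) * (P / Y) * ((-(c₁ / (4 * ε)) * (2 * 0 - 1) + a * b / (2 * ε)) * (Y / P - 1)
      - 1 / P * I) + -(ε / a) * ((a * b / (2 * ε) * (P - 1) + R₁) / P) * (P / Y)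
      = -(ε / a) / Y * ((c₁ / (4 * ε) + a * b / (2 * ε)) * (Y - P) - I
        + a * b / (2 * ε) * (P - 1) + R₁) := by
    field_simp
    ring
  rw [key]
  -- Multiplication by the nonzero number -(a/ε)Y makes u₁(0,t) appear as it does in the derivative
  -- of the Hopf–Cole image.
  have hlin : ∀ Z : ℝ, u₁ 0 t = -(ε / a) / Y * Z ↔ -(a / ε) * Y * u₁ 0 t = Z := fun Z => by
    constructor
    · intro hh; rw [hh]; field_simp
    · intro hh; rw [← hh]; field_simp
  rw [hlin]
  constructor <;> intro hh <;> linarith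

/-- As at x = 0, except that the weight X = e^{ab/(2ε)} is no longer 1. It multiplies the whole
condition and is divided out at the end. -/
theorem SmallReference.feedback1_iff (h : SmallReference ε a b x₀ y₁ y₂ D) (hε : 0 < ε)
    (ha : a ≠ 0) (hc : 0 < c₁) (u u₁ : ℝ → ℝ → ℝ) {t : ℝ} (ht : 0 ≤ t) :
    u₁ 1 t = feedback1 ε a b x₀ c₁ y₁ y₂ t (fun x => u x t) ↔
      trans1 (c₁ / (4 * ε)) (fun x => vErr ε a b x₀ y₁ y₂ u x t)
        (fun x => vErr1 ε a b x₀ y₁ y₂ u u₁ x t) 1 = 0 := by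
  have h1 : (1 : ℝ) ∈ Icc (0 : ℝ) 1 := by simp
  rw [feedback1, h.feedback_integral hε ha hc u (Or.inr rfl) ht, h.uRef1_eq ht, trans1, volt,
    sub_self, kernel_eq_ker hε hc (by simp [kernelArg]), ker_diag, hcArg1]
  set I := ∫ ξ in (0 : ℝ)..1, kerX (c₁ / (4 * ε)) 1 ξ * vErr ε a b x₀ y₁ y₂ u ξ t
  have e1 := exp_mul_vErr (ε := ε) (a := a) (b := b) (x₀ := x₀) (y₁ := y₁) (y₂ := y₂) u 1 t
  have e2 := exp_mul_coleHopf1 (ε := ε) (a := a) (b := b) u u₁ 1 t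
  have e3 := h.exp_uRef hε ha h1 ht
  have hP := h.pos 1 h1 t ht
  have e4 : hcArg (a * b / (2 * ε)) (vRefD ε a b x₀ y₁ y₂ 0) 1 t
      = Real.exp (a * b / (2 * ε)) * vRefD ε a b x₀ y₁ y₂ 0 1 t + 1 := by rw [hcArg, mul_one]
  rw [mul_one (a * b / (2 * ε))] at e1 e2 ⊢
  have hX := Real.exp_pos (a * b / (2 * ε))
  have e5 : Real.exp (-(a / ε) * (u 1 t - uRef ε a b x₀ y₁ y₂ 1 t))
      = Real.exp (-(a / ε) * u 1 t) / hcArg (a * b / (2 * ε)) (vRefD ε a b x₀ y₁ y₂ 0) 1 t := by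
    rw [← e3, ← Real.exp_sub]; congr 1; ring
  have e6 : Real.exp (a / ε * (u 1 t - uRef ε a b x₀ y₁ y₂ 1 t))
      = hcArg (a * b / (2 * ε)) (vRefD ε a b x₀ y₁ y₂ 0) 1 t / Real.exp (-(a / ε) * u 1 t) := by
    rw [← e3, ← Real.exp_sub]; congr 1; ring
  have e7 : Real.exp (a * b / (2 * ε) + a / ε * uRef ε a b x₀ y₁ y₂ 1 t)
      = Real.exp (a * b / (2 * ε))
        / hcArg (a * b / (2 * ε)) (vRefD ε a b x₀ y₁ y₂ 0) 1 t := by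
    rw [← e3, ← Real.exp_sub]; congr 1; ring
  have hY := Real.exp_pos (-(a / ε) * u 1 t)
  rw [e5, e6, e7, vErr1]
  set Y := Real.exp (-(a / ε) * u 1 t)
  set X := Real.exp (a * b / (2 * ε))
  set P := hcArg (a * b / (2 * ε)) (vRefD ε a b x₀ y₁ y₂ 0) 1 t
  set R := vRefD ε a b x₀ y₁ y₂ 0 1 t
  set R₁ := vRefD ε a b x₀ y₁ y₂ 1 1 t
  set e := vErr ε a b x₀ y₁ y₂ u 1 t
  set d := coleHopf1 ε a b u u₁ 1 t
  have key : -(ε / a) * (P / Y) * ((-(c₁ / (4 * ε)) * (2 * 1 - 1) + a * b / (2 * ε)) * (Y / P - 1)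
      + X / P * I) + -(ε / a) * (X * (a * b / (2 * ε) * R + R₁) / P) * (P / Y)
      = -(ε / a) / Y * ((-(c₁ / (4 * ε)) + a * b / (2 * ε)) * (Y - P) + X * I
        + X * (a * b / (2 * ε) * R + R₁)) := by
    field_simp
    ring
  rw [key]
  have hlin : ∀ Z : ℝ, u₁ 1 t = -(ε / a) / Y * Z ↔ -(a / ε) * Y * u₁ 1 t = Z := fun Z => by
    constructor
    · intro hh; rw [hh]; field_simp
    · intro hh; rw [← hh]; field_simp
  rw [hlin, show -(a / ε) * Y * u₁ 1 t = X * d + a * b / (2 * ε) * (Y - 1) by linarith,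
    show Y - 1 = X * e + X * R by linarith, ← e1]
  constructor <;> intro hh
  · have : X * (d - R₁ + c₁ / (4 * ε) * (2 - 1) * e - I) = 0 := by linear_combination hh
    have := (mul_eq_zero.1 this).resolve_left hX.ne'
    linarith
  · linear_combination X * hh

end Feedback

/-! ### The backstepping transformation of solutions -/

theorem C1Fam.trans {S : Set ℝ} {V V₁ : ℝ → ℝ → ℝ} (h : C1Fam S V V₁) (c : ℝ) :
    C1Fam S (fun x t => ViscousHJ.trans c (fun z => V z t) x)
      (fun x t => trans1 c (fun z => V z t) (fun z => V₁ z t) x) :=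
  (h.sub (h.volt_ker c)).congr (fun _ _ _ _ => rfl) fun _ _ _ _ => by rw [trans1]; ring

theorem C1Fam.trans1 {S : Set ℝ} {V V₁ V₂ : ℝ → ℝ → ℝ} (h : C1Fam S V V₁) (h₁ : C1Fam S V₁ V₂)
    (c : ℝ) : C1Fam S (fun x t => ViscousHJ.trans1 c (fun z => V z t) (fun z => V₁ z t) x)
      (fun x t => V₂ x t - volt2 c (fun z => V z t) (fun z => V₁ z t) x) :=
  (h₁.sub (h.volt_ker1 c)).congr (fun _ _ _ _ => by rw [ViscousHJ.trans1]; ring)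
    fun _ _ _ _ => rfl

/-- ∂_t passes under the integral, and `trans_intertwine` rewrites the transform of V_xx as the
second derivative minus 4c times the transform. Thus c = c₁/(4ε) adds the damping c₁, and -c removes
it. -/
theorem LinSol.trans {ε κ : ℝ} {S : Set ℝ} (hS : IsOpen S) {V V₁ V₂ : ℝ → ℝ → ℝ}
    (h : LinSol ε κ S V V₁ V₂) (c : ℝ) :
    LinSol ε (κ + 4 * c * ε) S (fun x t => ViscousHJ.trans c (fun z => V z t) x)
      (fun x t => ViscousHJ.trans1 c (fun z => V z t) (fun z => V₁ z t) x)
      (fun x t => V₂ x t - volt2 c (fun z => V z t) (fun z => V₁ z t) x) := by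
  have ht := h.time.sub (h.time.volt hS h.fam.cont c)
  have key : ∀ x ∈ Icc (0 : ℝ) 1, ∀ t ∈ S,
      ε * (V₂ x t - volt2 c (fun z => V z t) (fun z => V₁ z t) x)
        - (κ + 4 * c * ε) * ViscousHJ.trans c (fun z => V z t) x
      = ε * V₂ x t - κ * V x t - volt (ker c) (fun z => ε * V₂ z t - κ * V z t) x :=
    fun x hx t ht => by
      have c0 := h.fam.slice ht
      have c2 := h.fam₁.slice' ht
      rw [trans_intertwine c (h.fam.deriv t ht) (h.fam₁.deriv t ht) c2 hx,
        volt_sub (continuous_ker c) (c2.const_mul ε) (c0.const_mul κ) hx, volt_const_mul,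
        volt_const_mul, ViscousHJ.trans, ViscousHJ.trans]
      ring
  refine ⟨h.fam.trans c, h.fam.trans1 h.fam₁ c, fun x hx t htS => ?_, ?_⟩
  · exact (ht.deriv x hx t htS).congr_deriv (key x hx t htS).symm
  · exact ht.cont.congr fun p hp => key p.1 hp.1 p.2 hp.2

theorem LinSol.add {ε κ : ℝ} {S : Set ℝ} {V V₁ V₂ W W₁ W₂ : ℝ → ℝ → ℝ} (h : LinSol ε κ S V V₁ V₂)
    (h' : LinSol ε κ S W W₁ W₂) : LinSol ε κ S (fun x t => V x t + W x t)
      (fun x t => V₁ x t + W₁ x t) (fun x t => V₂ x t + W₂ x t) := by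
  have ht := h.time.add h'.time
  exact ⟨h.fam.add h'.fam, h.fam₁.add h'.fam₁, fun x hx t hS =>
    (ht.deriv x hx t hS).congr_deriv (by ring), ht.cont.congr fun p _ => by simp only; ring⟩

theorem LinSol.sub {ε κ : ℝ} {S : Set ℝ} {V V₁ V₂ W W₁ W₂ : ℝ → ℝ → ℝ} (h : LinSol ε κ S V V₁ V₂)
    (h' : LinSol ε κ S W W₁ W₂) : LinSol ε κ S (fun x t => V x t - W x t)
      (fun x t => V₁ x t - W₁ x t) (fun x t => V₂ x t - W₂ x t) := by
  have ht := h.time.sub h'.time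
  exact ⟨h.fam.sub h'.fam, h.fam₁.sub h'.fam₁, fun x hx t hS =>
    (ht.deriv x hx t hS).congr_deriv (by ring), ht.cont.congr fun p _ => by simp only; ring⟩

theorem LinSol.mono {ε κ : ℝ} {S S' : Set ℝ} {V V₁ V₂ : ℝ → ℝ → ℝ} (h : LinSol ε κ S V V₁ V₂)
    (hS : S' ⊆ S) : LinSol ε κ S' V V₁ V₂ := ⟨h.fam.mono hS, h.fam₁.mono hS, h.time.mono hS⟩

/-- Derivatives on `[0,1]` are unique. -/
theorem deriv_unique_Icc {f f' : ℝ → ℝ} (h : EqOn f f' (Icc 0 1)) {d d' x : ℝ}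
    (hx : x ∈ Icc (0 : ℝ) 1) (hd : HasDerivWithinAt f d (Icc 0 1) x)
    (hd' : HasDerivWithinAt f' d' (Icc 0 1) x) : d = d' := by
  rw [← dx_eq_of_hasDerivWithinAt hx hd, ← dx_eq_of_hasDerivWithinAt hx hd', dx_congr h hx]

/-! ### Absolutely continuous functions with square integrable derivative -/

/-- `f` is absolutely continuous with derivative `g ∈ L²(0,1)`. -/
structure HasL2Deriv (f g : ℝ → ℝ) : Prop where
  ac : AbsolutelyContinuousOnInterval f 0 1
  deriv : ∀ᵐ x ∂volume.restrict (Ioo 0 1), HasDerivAt f (g x) x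
  memLp : MemLp g 2 (volume.restrict (Ioo 0 1))

theorem HasL2Deriv.of_c1 {f g : ℝ → ℝ}
    (h : ∀ x ∈ Icc (0 : ℝ) 1, HasDerivWithinAt f (g x) (Icc 0 1) x)
    (hc : ContinuousOn g (Icc 0 1)) : HasL2Deriv f g :=
  ⟨ac_of_hasDerivWithinAt h hc, ae_hasDerivAt_of_Icc h, memLp_restrict_of_continuousOn hc⟩

theorem HasL2Deriv.continuousOn {f g : ℝ → ℝ} (h : HasL2Deriv f g) : ContinuousOn f (Icc 0 1) := by
  have := h.ac.continuousOn; rwa [uIcc_of_le zero_le_one] at this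

theorem HasL2Deriv.add {f g f' g' : ℝ → ℝ} (h : HasL2Deriv f g) (h' : HasL2Deriv f' g') :
    HasL2Deriv (fun x => f x + f' x) (fun x => g x + g' x) :=
  ⟨h.ac.fun_add h'.ac, h.deriv.mp (h'.deriv.mono fun _ a b => b.add a), h.memLp.add h'.memLp⟩

theorem HasL2Deriv.mul {f g f' g' : ℝ → ℝ} (h : HasL2Deriv f g) (h' : HasL2Deriv f' g') :
    HasL2Deriv (fun x => f x * f' x) (fun x => f' x * g x + f x * g' x) :=
  ⟨h.ac.fun_mul h'.ac, h.deriv.mp (h'.deriv.mono fun _ a b => (b.mul a).congr_deriv (by ring)),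
    (memLp_mul_of_continuousOn h'.continuousOn h.memLp).add
      (memLp_mul_of_continuousOn h.continuousOn h'.memLp)⟩

theorem HasL2Deriv.congr {f f' g : ℝ → ℝ} (h : HasL2Deriv f g) (e : EqOn f f' (Icc 0 1)) :
    HasL2Deriv f' g := by
  refine ⟨ac_congr h.ac e, ?_, h.memLp⟩
  filter_upwards [h.deriv, ae_restrict_mem measurableSet_Ioo] with x hx hxm
  exact hx.congr_of_eventuallyEq (Filter.eventuallyEq_of_mem (Icc_mem_nhds hxm.1 hxm.2) e).symm

theorem MemH2.hasL2Deriv {f : ℝ → ℝ} (h : MemH2 f) : HasL2Deriv (dx f) (dx (dx f)) := by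
  refine ⟨h.2.1, ?_, h.2.2⟩
  rw [ae_restrict_iff' measurableSet_Ioo]
  filter_upwards [h.2.1.ae_differentiableAt] with x hx hxm
  have hxI := Ioo_subset_Icc_self hxm
  have hd := (hx (by rwa [uIcc_of_le zero_le_one])).hasDerivAt
  rwa [← dx_eq_of_hasDerivWithinAt hxI hd.hasDerivWithinAt] at hd

/-- A single state viewed as a family over one instant, so that the calculus of families applies to
initial data. -/
theorem MemH2.c1Fam {f : ℝ → ℝ} (h : MemH2 f) (t : ℝ) :
    C1Fam {t} (fun x _ => f x) (fun x _ => dx f x) :=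
  ⟨fun _ _ x hx => (h.1 x hx).hasDerivWithinAt,
    (h.1.continuousOn.comp continuousOn_fst fun _ hp => hp.1),
    h.hasL2Deriv.continuousOn.comp continuousOn_fst fun _ hp => hp.1⟩

section Error

variable {ε a b x₀ D c₁ : ℝ} {y₁ y₂ : ℝ → ℝ}

theorem SmallReference.vErr_fam (h : SmallReference ε a b x₀ y₁ y₂ D) {S : Set ℝ} (hS : S ⊆ Ici 0)
    {u u₁ : ℝ → ℝ → ℝ} (hu : C1Fam S u u₁) :
    C1Fam S (vErr ε a b x₀ y₁ y₂ u) (vErr1 ε a b x₀ y₁ y₂ u u₁) :=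
  hu.coleHopf.sub (h.fam.mono hS)

/-- The regularity of the backstepping transformation of an `H²` state. -/
theorem SmallReference.exists_l2Deriv (h : SmallReference ε a b x₀ y₁ y₂ D) {t : ℝ} (ht : 0 ≤ t)
    {u₀ : ℝ → ℝ} (hu : MemH2 u₀) (c : ℝ) : ∃ g, HasL2Deriv
      (trans1 c (fun x => vErr ε a b x₀ y₁ y₂ (fun x _ => u₀ x) x t)
        (fun x => vErr1 ε a b x₀ y₁ y₂ (fun x _ => u₀ x) (fun x _ => dx u₀ x) x t)) g := by
  have hs : ({t} : Set ℝ) ⊆ Ici 0 := by simpa using ht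
  have mem : t ∈ ({t} : Set ℝ) := rfl
  have fu := hu.c1Fam t
  have fv := h.vErr_fam hs fu
  have fe := fu.exp (-(a / ε))
  have fx := c1Fam_exp {t} (-(a * b / (2 * ε)))
  -- The transformed derivative is p u₀' + q with p and q of class C¹ in x, so only u₀' limits the
  -- regularity.
  have fp := fx.mul (fe.const_mul (-(a / ε)))
  have fq := ((fx.mul ((fe.sub (c1Fam_const {t} 1)).const_mul (-(a * b / (2 * ε))))).sub
    (h.fam₁.mono hs)).sub (fv.volt_ker1 c)
  have lp := HasL2Deriv.of_c1 (fp.deriv t mem) (fp.slice' mem)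
  have lq := HasL2Deriv.of_c1 (fq.deriv t mem) (fq.slice' mem)
  refine ⟨_, ((lp.mul hu.hasL2Deriv).add lq).congr fun x _ => ?_⟩
  simp only [trans1, vErr1, coleHopf1]
  ring

end Error

/-! ### Comparison of the tracking errors -/

theorem sq_add_sq_le_of_abs_le {k₁ k₂ k₃ p q x y : ℝ} (hp : |p| ≤ k₁ * |x|)
    (hq : |q| ≤ k₂ * |x| + k₃ * |y|) :
    p ^ 2 + q ^ 2 ≤ (k₁ ^ 2 + 2 * k₂ ^ 2 + 2 * k₃ ^ 2 + 1) * (x ^ 2 + y ^ 2) := by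
  have h1 : p ^ 2 ≤ k₁ ^ 2 * x ^ 2 := by
    rw [← sq_abs p, ← sq_abs x, ← mul_pow]
    exact pow_le_pow_left₀ (abs_nonneg _) hp 2
  have h2 : q ^ 2 ≤ 2 * (k₂ ^ 2 * x ^ 2) + 2 * (k₃ ^ 2 * y ^ 2) := by
    have : q ^ 2 ≤ (k₂ * |x| + k₃ * |y|) ^ 2 := by
      rw [← sq_abs q]
      exact pow_le_pow_left₀ (abs_nonneg _) hq 2
    rw [← sq_abs x, ← sq_abs y]
    nlinarith [sq_nonneg (k₂ * |x| - k₃ * |y|)]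
  nlinarith [mul_nonneg (sq_nonneg k₁) (sq_nonneg y), mul_nonneg (sq_nonneg k₂) (sq_nonneg y),
    mul_nonneg (sq_nonneg k₃) (sq_nonneg x), sq_nonneg x, sq_nonneg y]

theorem abs_exp_sub_one_le_mul_exp (x : ℝ) : |Real.exp x - 1| ≤ |x| * Real.exp |x| := by
  rcases le_total 0 x with h | h
  · have h1 := Real.add_one_le_exp (-x)
    have h2 : Real.exp x * Real.exp (-x) = 1 := by rw [← Real.exp_add, add_neg_cancel, Real.exp_zero]
    rw [abs_of_nonneg (sub_nonneg.2 (Real.one_le_exp h)), abs_of_nonneg h]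
    nlinarith [Real.exp_pos x]
  · rw [abs_of_nonpos (sub_nonpos.2 (Real.exp_le_one_iff.2 h)), abs_of_nonpos h]
    have h1 := Real.add_one_le_exp x
    have h2 : 1 ≤ Real.exp (-x) := Real.one_le_exp (by linarith)
    nlinarith

theorem abs_log_sub_log_le {m x y : ℝ} (hm : 0 < m) (hx : m ≤ x) (hy : m ≤ y) :
    |Real.log x - Real.log y| ≤ 1 / m * |x - y| := by
  have key : ∀ {x y : ℝ}, m ≤ x → m ≤ y → Real.log x - Real.log y ≤ 1 / m * |x - y| :=
    fun {x y} hx hy => by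
      have hy0 := hm.trans_le hy
      rw [← Real.log_div (hm.trans_le hx).ne' hy0.ne']
      calc Real.log (x / y) ≤ x / y - 1 := Real.log_le_sub_one_of_pos (div_pos (hm.trans_le hx) hy0)
        _ = 1 / y * (x - y) := by field_simp
        _ ≤ 1 / y * |x - y| := mul_le_mul_of_nonneg_left (le_abs_self _) (by positivity)
        _ ≤ 1 / m * |x - y| :=
          mul_le_mul_of_nonneg_right (one_div_le_one_div_of_le hm hy) (abs_nonneg _)
  rw [abs_le]
  refine ⟨?_, key hx hy⟩
  have := key hy hx
  rw [abs_sub_comm] at this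
  linarith

/-- The `x`-derivative of `hopfCole ε a b V`, for `V_x = V₁`. -/
def hopfCole1 (ε a b : ℝ) (V V₁ : ℝ → ℝ → ℝ) (x t : ℝ) : ℝ :=
  -(ε / a) * (hcArg1 (a * b / (2 * ε)) V V₁ x t / hcArg (a * b / (2 * ε)) V x t)

section Comparison

variable {ε a b x₀ D : ℝ} {y₁ y₂ : ℝ → ℝ}

theorem exp_mul_le_exp_abs (β : ℝ) {x : ℝ} (hx : x ∈ Icc (0 : ℝ) 1) :
    Real.exp (β * x) ≤ Real.exp |β| := by
  have : |β * x| ≤ |β| := by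
    rw [abs_mul, abs_of_nonneg hx.1]; exact mul_le_of_le_one_right (abs_nonneg _) hx.2
  exact Real.exp_le_exp.2 ((le_abs_self _).trans this)

theorem SmallReference.hcArg_le (h : SmallReference ε a b x₀ y₁ y₂ D) {x t : ℝ}
    (hx : x ∈ Icc (0 : ℝ) 1) (ht : 0 ≤ t) :
    hcArg (a * b / (2 * ε)) (vRefD ε a b x₀ y₁ y₂ 0) x t ≤ Real.exp |a * b / (2 * ε)| * D + 1 := by
  have h1 := (le_abs_self _).trans (h.bound x hx t ht)
  rw [hcArg]
  have := mul_le_mul_of_nonneg_left h1 (Real.exp_pos (a * b / (2 * ε) * x)).le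
  have h2 := mul_le_mul_of_nonneg_right (exp_mul_le_exp_abs (a * b / (2 * ε)) hx)
    ((abs_nonneg _).trans (h.bound x hx t ht))
  linarith

theorem SmallReference.abs_logDeriv_le (h : SmallReference ε a b x₀ y₁ y₂ D) {x t : ℝ}
    (hx : x ∈ Icc (0 : ℝ) 1) (ht : 0 ≤ t) :
    |hcArg1 (a * b / (2 * ε)) (vRefD ε a b x₀ y₁ y₂ 0) (vRefD ε a b x₀ y₁ y₂ 1) x t /
      hcArg (a * b / (2 * ε)) (vRefD ε a b x₀ y₁ y₂ 0) x t|
      ≤ 2 * (Real.exp |a * b / (2 * ε)| * ((|a * b / (2 * ε)| + 1) * D)) := by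
  set β := a * b / (2 * ε)
  have h1 := h.half_le x hx t ht
  have hD : 0 ≤ D := (abs_nonneg _).trans (h.bound x hx t ht)
  rw [abs_div, abs_of_pos (h.pos x hx t ht), div_le_iff₀ (h.pos x hx t ht), hcArg1, abs_mul,
    abs_of_pos (Real.exp_pos _)]
  have h2 : |β * vRefD ε a b x₀ y₁ y₂ 0 x t + vRefD ε a b x₀ y₁ y₂ 1 x t| ≤ (|β| + 1) * D := by
    refine (abs_add_le _ _).trans ?_
    rw [abs_mul]
    linarith [mul_le_mul_of_nonneg_left (h.bound x hx t ht) (abs_nonneg β), h.bound₁ x hx t ht]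
  have h3 := mul_le_mul (exp_mul_le_exp_abs β hx) h2 (abs_nonneg _) (Real.exp_pos _).le
  have h4 : 0 ≤ Real.exp |β| * ((|β| + 1) * D) := by positivity
  nlinarith

/-- The error in the linearizing coordinates is controlled by a bounded tracking error. -/
theorem SmallReference.exists_vErr_le (h : SmallReference ε a b x₀ y₁ y₂ D) (hε : 0 < ε)
    (ha : a ≠ 0) : ∃ C, 0 < C ∧ ∀ (u u₁ : ℝ → ℝ → ℝ), ∀ x ∈ Icc (0 : ℝ) 1, ∀ t, 0 ≤ t →
      |u x t - uRef ε a b x₀ y₁ y₂ x t| ≤ 1 →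
      vErr ε a b x₀ y₁ y₂ u x t ^ 2 + vErr1 ε a b x₀ y₁ y₂ u u₁ x t ^ 2
        ≤ C * ((u x t - uRef ε a b x₀ y₁ y₂ x t) ^ 2
          + (u₁ x t - hopfCole1 ε a b (vRefD ε a b x₀ y₁ y₂ 0) (vRefD ε a b x₀ y₁ y₂ 1) x t) ^ 2) := by
  set β := a * b / (2 * ε) with hβ
  set r := a / ε with hr
  set L := Real.exp |β|
  have hD : 0 ≤ D := (abs_nonneg _).trans (h.bound 0 (by simp) 0 le_rfl)
  have hL : 0 < L := Real.exp_pos _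
  set Pm := L * D + 1
  have hPm : 0 < Pm := by positivity
  set J := 2 * (L * ((|β| + 1) * D))
  refine ⟨(L * (Pm * (|r| * Real.exp |r|))) ^ 2
    + 2 * (L * ((J + |β|) * (Pm * (|r| * Real.exp |r|)))) ^ 2
    + 2 * (L * (|r| * (Pm * Real.exp |r|))) ^ 2 + 1, by positivity, fun u u₁ x hx t ht hδ => ?_⟩
  have e1 := exp_mul_vErr (ε := ε) (a := a) (b := b) (x₀ := x₀) (y₁ := y₁) (y₂ := y₂) u x t
  have e2 := exp_mul_coleHopf1 (ε := ε) (a := a) (b := b) u u₁ x t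
  have e3 := h.exp_uRef hε ha hx ht
  have hP := h.pos x hx t ht
  have hPle := h.hcArg_le hx ht
  have hQ := h.abs_logDeriv_le hx ht
  have e4 : hcArg β (vRefD ε a b x₀ y₁ y₂ 0) x t
      = Real.exp (β * x) * vRefD ε a b x₀ y₁ y₂ 0 x t + 1 := rfl
  have e5 : hcArg1 β (vRefD ε a b x₀ y₁ y₂ 0) (vRefD ε a b x₀ y₁ y₂ 1) x t
      = Real.exp (β * x) * (β * vRefD ε a b x₀ y₁ y₂ 0 x t + vRefD ε a b x₀ y₁ y₂ 1 x t) := rfl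
  rw [hopfCole1]
  set δ := u x t - uRef ε a b x₀ y₁ y₂ x t
  set P := hcArg β (vRefD ε a b x₀ y₁ y₂ 0) x t
  set P₁ := hcArg1 β (vRefD ε a b x₀ y₁ y₂ 0) (vRefD ε a b x₀ y₁ y₂ 1) x t
  set δ₁ := u₁ x t - -(ε / a) * (P₁ / P)
  have hY : Real.exp (-r * u x t) = P * Real.exp (-r * δ) := by
    rw [← e3, ← Real.exp_add]; congr 1; simp only [δ]; ring
  have hrδ : |-r * δ| ≤ |r| := by
    rw [abs_mul, abs_neg]; exact mul_le_of_le_one_right (abs_nonneg _) hδ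
  have hexp : |Real.exp (-r * δ) - 1| ≤ |r| * Real.exp |r| * |δ| := by
    refine (abs_exp_sub_one_le_mul_exp _).trans ?_
    rw [abs_mul, abs_neg] at hrδ ⊢
    nlinarith [Real.exp_le_exp.2 hrδ, mul_nonneg (abs_nonneg r) (abs_nonneg δ)]
  have hYP : |Real.exp (-r * u x t) - P| ≤ Pm * (|r| * Real.exp |r|) * |δ| := by
    rw [hY, show P * Real.exp (-r * δ) - P = P * (Real.exp (-r * δ) - 1) by ring, abs_mul,
      abs_of_pos hP, mul_assoc]
    exact mul_le_mul hPle hexp (abs_nonneg _) hPm.le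
  have hYle : Real.exp (-r * u x t) ≤ Pm * Real.exp |r| := by
    rw [hY]
    exact mul_le_mul hPle (Real.exp_le_exp.2 ((le_abs_self _).trans hrδ)) (Real.exp_pos _).le hPm.le
  set Y := Real.exp (-r * u x t)
  have hE : ∀ z w : ℝ, Real.exp (β * x) * z = w → |z| ≤ L * |w| := fun z w hzw => by
    have : z = Real.exp (-β * x) * w := by
      rw [← hzw, ← mul_assoc, ← Real.exp_add, neg_mul, neg_add_cancel, Real.exp_zero, one_mul]
    rw [this, abs_mul, abs_of_pos (Real.exp_pos _)]
    refine mul_le_mul_of_nonneg_right ?_ (abs_nonneg _)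
    have := exp_mul_le_exp_abs (-β) hx
    rwa [abs_neg] at this
  refine sq_add_sq_le_of_abs_le ?_ ?_
  · refine (hE _ _ e1).trans ?_
    rw [mul_assoc]
    exact mul_le_mul_of_nonneg_left hYP hL.le
  -- Derivative of e^{βx}ṽ = Y - P, with Y_x = -rYu_x and u^r_x = -(ε/a)P_x/P. The term with -β
  -- comes from differentiating the weight.
  · have e6 : Real.exp (β * x) * vErr1 ε a b x₀ y₁ y₂ u u₁ x t
        = -r * Y * δ₁ + (P₁ / P - β) * (Y - P) := by
      rw [vErr1, mul_sub, e2]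
      have h1 : -r * Y * δ₁ = -r * Y * u₁ x t - Y * (P₁ / P) := by
        simp only [δ₁, hr]; field_simp; ring
      have h2 : (P₁ / P - β) * (Y - P) = Y * (P₁ / P) - P₁ - β * (Y - P) := by
        field_simp
      rw [h1, h2]
      linear_combination e5 - β * e4
    refine (hE _ _ e6).trans ?_
    have h1 : |-r * Y * δ₁| ≤ |r| * (Pm * Real.exp |r|) * |δ₁| := by
      rw [abs_mul, abs_mul, abs_neg, abs_of_pos (Real.exp_pos _)]
      gcongr
    have h2 : |(P₁ / P - β) * (Y - P)| ≤ (J + |β|) * (Pm * (|r| * Real.exp |r|) * |δ|) := by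
      rw [abs_mul]
      exact mul_le_mul ((abs_sub _ _).trans (add_le_add hQ le_rfl)) hYP (abs_nonneg _)
        (by positivity)
    calc L * |-r * Y * δ₁ + (P₁ / P - β) * (Y - P)|
        ≤ L * (|r| * (Pm * Real.exp |r|) * |δ₁| + (J + |β|) * (Pm * (|r| * Real.exp |r|) * |δ|)) :=
          mul_le_mul_of_nonneg_left ((abs_add_le _ _).trans (add_le_add h1 h2)) hL.le
      _ = _ := by ring

/-- The tracking error is controlled by the error in the linearizing coordinates. -/
theorem SmallReference.exists_hopfCole_le (h : SmallReference ε a b x₀ y₁ y₂ D) :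
    ∃ C, 0 < C ∧ ∀ (V V₁ : ℝ → ℝ → ℝ), ∀ x ∈ Icc (0 : ℝ) 1, ∀ t, 0 ≤ t →
      1 / 4 ≤ hcArg (a * b / (2 * ε)) V x t →
      (hopfCole ε a b V x t - uRef ε a b x₀ y₁ y₂ x t) ^ 2 + (hopfCole1 ε a b V V₁ x t
          - hopfCole1 ε a b (vRefD ε a b x₀ y₁ y₂ 0) (vRefD ε a b x₀ y₁ y₂ 1) x t) ^ 2
        ≤ C * ((V x t - vRefD ε a b x₀ y₁ y₂ 0 x t) ^ 2
          + (V₁ x t - vRefD ε a b x₀ y₁ y₂ 1 x t) ^ 2) := by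
  set β := a * b / (2 * ε) with hβ
  set L := Real.exp |β|
  have hL : 0 < L := Real.exp_pos _
  have hD : 0 ≤ D := (abs_nonneg _).trans (h.bound 0 (by simp) 0 le_rfl)
  set J := 2 * (L * ((|β| + 1) * D))
  set q := |-(ε / a)|
  have hq : 0 ≤ q := abs_nonneg _
  refine ⟨(q * (4 * L)) ^ 2 + 2 * (q * (4 * L * |β| + J * (4 * L))) ^ 2 + 2 * (q * (4 * L)) ^ 2 + 1,
    by positivity, fun V V₁ x hx t ht hA => ?_⟩
  have hPh := h.half_le x hx t ht
  have hP := h.pos x hx t ht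
  have hQ := h.abs_logDeriv_le hx ht
  rw [h.uRef_eq x ht, hopfCole1, hopfCole1, hopfCole, hopfCole]
  set P := hcArg β (vRefD ε a b x₀ y₁ y₂ 0) x t
  set P₁ := hcArg1 β (vRefD ε a b x₀ y₁ y₂ 0) (vRefD ε a b x₀ y₁ y₂ 1) x t
  set A := hcArg β V x t
  set A₁ := hcArg1 β V V₁ x t
  have hA0 : 0 < A := by linarith
  set e := V x t - vRefD ε a b x₀ y₁ y₂ 0 x t
  set e₁ := V₁ x t - vRefD ε a b x₀ y₁ y₂ 1 x t
  have hAP : A - P = Real.exp (β * x) * e := by simp only [A, P, e, hcArg]; ring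
  have hAP₁ : A₁ - P₁ = Real.exp (β * x) * (β * e + e₁) := by simp only [A₁, P₁, e, e₁, hcArg1]; ring
  have hXL := exp_mul_le_exp_abs β hx
  set X := Real.exp (β * x)
  have hX : 0 < X := Real.exp_pos _
  have hXe : |X * e / A| ≤ 4 * L * |e| := by
    rw [abs_div, abs_mul, abs_of_pos hX, abs_of_pos hA0, div_le_iff₀ hA0]
    have := mul_le_mul_of_nonneg_right hXL (abs_nonneg e)
    nlinarith [mul_nonneg hL.le (abs_nonneg e)]
  refine sq_add_sq_le_of_abs_le ?_ ?_
  · rw [← mul_sub, abs_mul, mul_assoc]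
    refine mul_le_mul_of_nonneg_left ?_ hq
    refine (abs_log_sub_log_le (m := 1 / 4) (by norm_num) hA (by linarith)).trans ?_
    rw [hAP, abs_mul, abs_of_pos hX]
    nlinarith [mul_le_mul_of_nonneg_right hXL (abs_nonneg e)]
  · rw [← mul_sub, abs_mul]
    -- Written this way, only the lower bound on A and the bound on the logarithmic derivative of
    -- the reference are needed.
    have e6 : A₁ / A - P₁ / P = X * (β * e + e₁) / A - P₁ / P * (X * e / A) := by
      rw [← hAP₁, ← hAP]; field_simp; ring
    have h1 : |X * (β * e + e₁) / A| ≤ 4 * L * (|β| * |e| + |e₁|) := by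
      rw [abs_div, abs_mul, abs_of_pos hX, abs_of_pos hA0, div_le_iff₀ hA0]
      have h2 : |β * e + e₁| ≤ |β| * |e| + |e₁| := by
        rw [← abs_mul]; exact abs_add_le _ _
      have h3 := mul_le_mul hXL h2 (abs_nonneg _) hL.le
      have h4 : 0 ≤ L * (|β| * |e| + |e₁|) := by positivity
      nlinarith
    have h2 : |P₁ / P * (X * e / A)| ≤ J * (4 * L * |e|) := by
      rw [abs_mul]
      exact mul_le_mul hQ hXe (abs_nonneg _) (by positivity)
    calc q * |A₁ / A - P₁ / P|
        ≤ q * (4 * L * (|β| * |e| + |e₁|) + J * (4 * L * |e|)) := by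
          rw [e6]
          exact mul_le_mul_of_nonneg_left ((abs_sub _ _).trans (add_le_add h1 h2)) hq
      _ = _ := by ring

end Comparison

/-! ### The `H¹` norm and the energy -/

theorem h1Norm_bounds {f f₁ : ℝ → ℝ}
    (h : ∀ x ∈ Icc (0 : ℝ) 1, HasDerivWithinAt f (f₁ x) (Icc 0 1) x)
    (hc : ContinuousOn f₁ (Icc 0 1)) :
    energy f f₁ ≤ h1Norm f ^ 2 ∧ h1Norm f ≤ 2 * √(energy f f₁) := by
  have hf : ContinuousOn f (Icc 0 1) := fun x hx => (h x hx).continuousWithinAt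
  have e : ∫ x in (0 : ℝ)..1, dx f x ^ 2 = ∫ x in (0 : ℝ)..1, f₁ x ^ 2 := by
    refine intervalIntegral.integral_congr fun x hx => ?_
    rw [uIcc_of_le zero_le_one] at hx
    simp only [dx_eq_of_hasDerivWithinAt hx (h x hx)]
  have p1 : 0 ≤ ∫ x in (0 : ℝ)..1, f x ^ 2 :=
    intervalIntegral.integral_nonneg zero_le_one fun x _ => sq_nonneg _
  have p2 : 0 ≤ ∫ x in (0 : ℝ)..1, f₁ x ^ 2 :=
    intervalIntegral.integral_nonneg zero_le_one fun x _ => sq_nonneg _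
  rw [energy_eq hf hc, h1Norm, l2Norm, l2Norm, e]
  constructor
  · nlinarith [Real.sq_sqrt p1, Real.sq_sqrt p2, mul_nonneg (Real.sqrt_nonneg
      (∫ x in (0 : ℝ)..1, f x ^ 2)) (Real.sqrt_nonneg (∫ x in (0 : ℝ)..1, f₁ x ^ 2))]
  · have h1 := Real.sqrt_le_sqrt (le_add_of_nonneg_right p2 :
      ∫ x in (0 : ℝ)..1, f x ^ 2 ≤ (∫ x in (0 : ℝ)..1, f x ^ 2) + ∫ x in (0 : ℝ)..1, f₁ x ^ 2)
    have h2 := Real.sqrt_le_sqrt (le_add_of_nonneg_left p1 :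
      ∫ x in (0 : ℝ)..1, f₁ x ^ 2 ≤ (∫ x in (0 : ℝ)..1, f x ^ 2) + ∫ x in (0 : ℝ)..1, f₁ x ^ 2)
    linarith

theorem h1Norm_nonneg (f : ℝ → ℝ) : 0 ≤ h1Norm f := add_nonneg (Real.sqrt_nonneg _)
  (Real.sqrt_nonneg _)

/-! ### The closed loop in the linearizing coordinates -/

/-- Solution, by backstepping, of the linear equation with the boundary conditions
`(trans c v)ₓ = 0` at `x = 0` and `x = 1`. -/
theorem exists_backstepping_solution (c : ℝ) : ∃ K, 0 < K ∧ ∀ {ε κ t₀ : ℝ} {v₀ v₀' g₀ : ℝ → ℝ},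
    0 < ε → 0 ≤ κ → (∀ x ∈ Icc (0 : ℝ) 1, HasDerivWithinAt v₀ (v₀' x) (Icc 0 1) x) →
    ContinuousOn v₀' (Icc 0 1) → HasL2Deriv (trans1 c v₀ v₀') g₀ →
    trans1 c v₀ v₀' 0 = 0 → trans1 c v₀ v₀' 1 = 0 →
    ∃ v v₁ v₂ q q₁ w₁ g : ℝ → ℝ → ℝ, C1Fam (Ici t₀) v v₁ ∧
      LinSol ε (κ + 4 * (-c) * ε) (Ioi t₀) v v₁ v₂ ∧ (∀ x ∈ Icc (0 : ℝ) 1, v x t₀ = v₀ x) ∧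
      (∀ t, t₀ ≤ t → trans1 c (fun x => v x t) (fun x => v₁ x t) 0 = 0 ∧
        trans1 c (fun x => v x t) (fun x => v₁ x t) 1 = 0) ∧
      C1Fam (Ici t₀) q q₁ ∧ (∀ x t, v₁ x t = q x t + w₁ x t) ∧
      (∀ t, t₀ ≤ t → HasL2Deriv (fun x => w₁ x t) fun x => g x t) ∧
      (∀ t, t₀ ≤ t → Tendsto (fun s => ∫ x in (0 : ℝ)..1, (g x s - g x t) ^ 2)
        (𝓝[Ici t₀] t) (𝓝 0)) ∧
      ∀ t, t₀ ≤ t → energy (fun x => v x t) (fun x => v₁ x t)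
        ≤ K * Real.exp (-2 * κ * (t - t₀)) * energy v₀ v₀' := by
  obtain ⟨C, hC0, hC⟩ := exists_trans_energy_bound c
  obtain ⟨C', hC0', hC'⟩ := exists_trans_energy_bound (-c)
  -- The factor C is the cost of transforming the initial state, C' that of transforming the
  -- solution back; both depend on c alone.
  refine ⟨C' * C, by positivity, fun {ε κ t₀ v₀ v₀' g₀} hε hκ hv₀ hc₀' hg₀ hb0 hb1 => ?_⟩
  have hc₀ : ContinuousOn v₀ (Icc 0 1) := fun x hx => (hv₀ x hx).continuousWithinAt
  obtain ⟨w, w₁, w₂, fw, lw, hw0, hwb, hwac, hwd, hwm, hwt, hwe⟩ :=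
    exists_neumann_heat hε hκ t₀ (fun x hx => hasDerivWithinAt_trans c hv₀ hx) hg₀.ac hg₀.deriv
      hg₀.memLp hb0 hb1
  have fv := fw.trans (-c)
  have hinv : ∀ t, t₀ ≤ t → EqOn (trans c fun x => trans (-c) (fun z => w z t) x)
      (fun x => w x t) (Icc 0 1) := fun t ht x hx => by
    have := trans_neg_trans (-c) (fw.slice (t := t) ht) hx
    rwa [neg_neg] at this
  -- The transform of v is w on `[0,1]`, so its derivative is w_x, which vanishes at the ends.
  have hb : ∀ t, t₀ ≤ t → ∀ x ∈ Icc (0 : ℝ) 1, trans1 c (fun x => trans (-c) (fun z => w z t) x)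
      (fun x => trans1 (-c) (fun z => w z t) (fun z => w₁ z t) x) x = w₁ x t := fun t ht x hx =>
    deriv_unique_Icc (hinv t ht) hx (hasDerivWithinAt_trans c (fv.deriv t ht) hx)
      (fw.deriv t ht x hx)
  -- v_x splits as w_x plus minus the derivative of a Volterra integral of w. The latter is again C¹
  -- in x, so v_xx is no worse than w_xx at t₀.
  refine ⟨_, _, _, _, _, w₁, w₂, fv, lw.trans isOpen_Ioi (-c), fun x hx => ?_, fun t ht => ?_,
    (fw.volt_ker1 (-c)).const_mul (-1), fun x t => ?_, fun t ht => ⟨hwac t ht, hwd t ht, hwm t ht⟩,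
    hwt, fun t ht => ?_⟩
  · rw [trans_congr (-c) hw0 hx]
    exact trans_neg_trans c hc₀ hx
  · rw [hb t ht 0 (by simp), hb t ht 1 (by simp)]
    exact hwb t
  · simp only [trans1]; ring
  · have h1 := hC' _ _ (fw.slice (t := t) ht) (fw.slice' (t := t) ht)
    have h2 := hC _ _ hc₀ hc₀'
    have h3 := hwe t ht
    have h4 : Real.exp (-2 * κ * (t - t₀)) * energy (trans c v₀) (trans1 c v₀ v₀')
        ≤ Real.exp (-2 * κ * (t - t₀)) * (C * energy v₀ v₀') :=
      mul_le_mul_of_nonneg_left h2 (Real.exp_pos _).le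
    calc _ ≤ C' * energy (fun x => w x t) (fun x => w₁ x t) := h1
      _ ≤ C' * (Real.exp (-2 * κ * (t - t₀)) * (C * energy v₀ v₀')) :=
        mul_le_mul_of_nonneg_left (h3.trans h4) hC0'.le
      _ = _ := by ring

/-! ### Existence and decay -/

theorem C1Fam.hopfCole1 {ε a b : ℝ} {S : Set ℝ} {V V₁ : ℝ → ℝ → ℝ} (h : C1Fam S V V₁)
    (h0 : ∀ x ∈ Icc (0 : ℝ) 1, ∀ t ∈ S, 0 < ViscousHJ.hcArg (a * b / (2 * ε)) V x t) :
    C1Fam S (ViscousHJ.hopfCole ε a b V) (ViscousHJ.hopfCole1 ε a b V V₁) := h.hopfCole h0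

section Existence

variable {ε a b x₀ D c₁ : ℝ} {y₁ y₂ : ℝ → ℝ}

/-- The solution is the inverse Hopf–Cole image of V = v^r + v, where v is the backstepping solution
started from the initial error. Decay of v in H¹ keeps the argument of the logarithm above 1/4 for
all times, so the solution is global. -/
theorem SmallReference.exists_closedLoop (h : SmallReference ε a b x₀ y₁ y₂ D) (hε : 0 < ε)
    (ha : a ≠ 0) (hc : 0 < c₁) : ∃ μ K, 0 < μ ∧ 0 < K ∧ ∀ (t₀ : ℝ) (u₀ : ℝ → ℝ), 0 ≤ t₀ →
      MemH2 u₀ → Compatible ε a b x₀ c₁ y₁ y₂ t₀ u₀ →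
      h1Norm (fun x => u₀ x - uRef ε a b x₀ y₁ y₂ x t₀) < μ →
      ∃ u, SolvesClosedLoop ε a b x₀ c₁ y₁ y₂ t₀ u₀ u ∧ ∀ t, t₀ ≤ t →
        h1Norm (fun x => u x t - uRef ε a b x₀ y₁ y₂ x t)
          ≤ K * h1Norm (fun x => u₀ x - uRef ε a b x₀ y₁ y₂ x t₀)
            * Real.exp (-(c₁ + a ^ 2 * b ^ 2 / (4 * ε)) * (t - t₀)) := by
  set β := a * b / (2 * ε) with hβ
  set κ := c₁ + a ^ 2 * b ^ 2 / (4 * ε) with hκdef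
  have hκ : 0 ≤ κ := by positivity
  obtain ⟨K, hK, HK⟩ := exists_backstepping_solution (c₁ / (4 * ε))
  obtain ⟨C₁, hC₁, H₁⟩ := h.exists_vErr_le hε ha
  obtain ⟨C₂, hC₂, H₂⟩ := h.exists_hopfCole_le
  set L := Real.exp |β|
  have hL : 0 < L := Real.exp_pos _
  set m := 2 * L ^ 2 * K * C₁
  have hm : 0 < m := by positivity
  -- m is the constant in |e^{βx}v|² ≤ mN². N below this μ gives N < 1/4 and mN ≤ 1/4, so |e^{βx}v|
  -- ≤ 1/4, and also |ũ| ≤ 1 initially, as `exists_vErr_le` requires. In the second constant the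
  -- factor 2 compares the H¹ norm with the root of the energy.
  refine ⟨1 / (4 * (m + 1)), 2 * √(C₂ * K * C₁), by positivity, by positivity,
    fun t₀ u₀ ht₀ hu₀ hcomp hN => ?_⟩
  set N := h1Norm (fun x => u₀ x - uRef ε a b x₀ y₁ y₂ x t₀)
  have hN0 : 0 ≤ N := h1Norm_nonneg _
  have hNm : N * (4 * (m + 1)) < 1 := (lt_div_iff₀ (by positivity)).1 hN
  have hN4 : N < 1 / 4 := by nlinarith
  have hs : ({t₀} : Set ℝ) ⊆ Ici 0 := by simpa using ht₀
  have mem : t₀ ∈ ({t₀} : Set ℝ) := rfl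
  have fu := hu₀.c1Fam t₀
  have fv := h.vErr_fam hs fu
  set R := vRefD ε a b x₀ y₁ y₂ 0
  set R₁ := vRefD ε a b x₀ y₁ y₂ 1
  have fR : C1Fam (Ici 0) (hopfCole ε a b R) (hopfCole1 ε a b R R₁) := h.fam.hopfCole1 h.pos
  have fRu : ∀ t, 0 ≤ t → (fun x => uRef ε a b x₀ y₁ y₂ x t) = fun x => hopfCole ε a b R x t :=
    fun t ht => funext fun x => h.uRef_eq x ht
  have d₀ : ∀ x ∈ Icc (0 : ℝ) 1, HasDerivWithinAt (fun x => u₀ x - uRef ε a b x₀ y₁ y₂ x t₀)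
      (dx u₀ x - hopfCole1 ε a b R R₁ x t₀) (Icc 0 1) x := fun x hx => by
    have h1 := fR.deriv t₀ ht₀ x hx
    rw [← fRu t₀ ht₀] at h1
    exact (fu.deriv t₀ mem x hx).sub h1
  have c₀ : ContinuousOn (fun x => dx u₀ x - hopfCole1 ε a b R R₁ x t₀) (Icc 0 1) :=
    (fu.slice' mem).sub (fR.slice' ht₀)
  have hE₀ := (h1Norm_bounds d₀ c₀).1
  set E₀ := energy (fun x => u₀ x - uRef ε a b x₀ y₁ y₂ x t₀)
    (fun x => dx u₀ x - hopfCole1 ε a b R R₁ x t₀)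
  have hsup : ∀ x ∈ Icc (0 : ℝ) 1, |u₀ x - uRef ε a b x₀ y₁ y₂ x t₀| ≤ 1 := fun x hx => by
    have h1 := sq_le_energy d₀ c₀ hx
    rw [← sq_le_one_iff_abs_le_one]
    nlinarith
  have hEv : energy (fun x => vErr ε a b x₀ y₁ y₂ (fun x _ => u₀ x) x t₀)
      (fun x => vErr1 ε a b x₀ y₁ y₂ (fun x _ => u₀ x) (fun x _ => dx u₀ x) x t₀) ≤ C₁ * E₀ :=
    energy_le_of_pointwise (fv.slice mem) (fv.slice' mem)
      (fun x hx => (d₀ x hx).continuousWithinAt) c₀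
      fun x hx => H₁ (fun x _ => u₀ x) (fun x _ => dx u₀ x) x hx t₀ ht₀ (hsup x hx)
  obtain ⟨g₀, hg₀⟩ := h.exists_l2Deriv ht₀ hu₀ (c₁ / (4 * ε))
  have hb0 := (h.feedback0_iff hε ha hc (fun x _ => u₀ x) (fun x _ => dx u₀ x) ht₀).1 hcomp.1
  have hb1 := (h.feedback1_iff hε ha hc (fun x _ => u₀ x) (fun x _ => dx u₀ x) ht₀).1 hcomp.2
  obtain ⟨v, v₁, v₂, q, q₁, w₁, g, fv', lv, hv0, hvb, fq, hqw, hw₁, hgt, hve⟩ :=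
    HK (t₀ := t₀) hε hκ (fv.deriv t₀ mem) (fv.slice' mem) hg₀ hb0 hb1
  have hsub : Ici t₀ ⊆ Ici (0 : ℝ) := Ici_subset_Ici.2 ht₀
  set V : ℝ → ℝ → ℝ := fun x t => R x t + v x t
  set V₁ : ℝ → ℝ → ℝ := fun x t => R₁ x t + v₁ x t
  have fV : C1Fam (Ici t₀) V V₁ := (h.fam.mono hsub).add fv'
  have eκ : κ + 4 * (-(c₁ / (4 * ε))) * ε = a ^ 2 * b ^ 2 / (4 * ε) := by
    rw [hκdef]; field_simp; ring
  rw [eκ] at lv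
  have lV : LinSol ε (a ^ 2 * b ^ 2 / (4 * ε)) (Ioi t₀) V V₁
      (fun x t => vRefD ε a b x₀ y₁ y₂ 2 x t + v₂ x t) :=
    (h.lin.mono (Ioi_subset_Ioi ht₀)).add lv
  have hvE : ∀ t, t₀ ≤ t → energy (fun x => v x t) (fun x => v₁ x t)
      ≤ K * C₁ * N ^ 2 * Real.exp (-2 * κ * (t - t₀)) := fun t ht => by
    have h1 : energy (fun x => vErr ε a b x₀ y₁ y₂ (fun x _ => u₀ x) x t₀)
      (fun x => vErr1 ε a b x₀ y₁ y₂ (fun x _ => u₀ x) (fun x _ => dx u₀ x) x t₀) ≤ C₁ * N ^ 2 :=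
      hEv.trans (mul_le_mul_of_nonneg_left hE₀ hC₁.le)
    have h2 : 0 ≤ K * Real.exp (-2 * κ * (t - t₀)) := by positivity
    refine (hve t ht).trans ((mul_le_mul_of_nonneg_left h1 h2).trans (le_of_eq ?_))
    ring
  have hquarter : ∀ x ∈ Icc (0 : ℝ) 1, ∀ t, t₀ ≤ t → 1 / 4 ≤ hcArg β V x t := fun x hx t ht => by
    have h1 := sq_le_energy (fv'.deriv t ht) (fv'.slice' (t := t) ht) hx
    have h2 : Real.exp (-2 * κ * (t - t₀)) ≤ 1 := Real.exp_le_one_iff.2 (by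
      nlinarith [mul_nonneg hκ (sub_nonneg.2 ht)])
    have h3 : v x t ^ 2 ≤ 2 * (K * C₁ * N ^ 2) := by
      have : K * C₁ * N ^ 2 * Real.exp (-2 * κ * (t - t₀)) ≤ K * C₁ * N ^ 2 :=
        mul_le_of_le_one_right (by positivity) h2
      linarith [hvE t ht]
    have h4 : |Real.exp (β * x) * v x t| ≤ 1 / 4 := by
      refine abs_le_of_sq_le_sq ?_ (by norm_num)
      have h5 : Real.exp (β * x) ^ 2 ≤ L ^ 2 :=
        pow_le_pow_left₀ (Real.exp_pos _).le (exp_mul_le_exp_abs β hx) 2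
      have h6 := mul_le_mul h5 h3 (sq_nonneg _) (sq_nonneg _)
      rw [mul_pow]
      refine h6.trans ?_
      rw [show L ^ 2 * (2 * (K * C₁ * N ^ 2)) = m * N ^ 2 by simp only [m]; ring]
      have h7 : N * m ≤ 1 / 4 := by nlinarith
      nlinarith
    have h5 := h.half_le x hx t (ht₀.trans ht)
    have h6 : hcArg β V x t = hcArg β R x t + Real.exp (β * x) * v x t := by
      simp only [hcArg, V]; ring
    rw [h6]
    linarith [(abs_le.1 h4).1]
  have hpos : ∀ x ∈ Icc (0 : ℝ) 1, ∀ t ∈ Ici t₀, 0 < hcArg β V x t := fun x hx t ht =>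
    lt_of_lt_of_le (by norm_num) (hquarter x hx t ht)
  have fU : C1Fam (Ici t₀) (hopfCole ε a b V) (hopfCole1 ε a b V V₁) := fV.hopfCole1 hpos
  obtain ⟨hC21, hpde⟩ := lV.hopfCole hε ha fun x hx t ht => hpos x hx t (Ioi_subset_Ici_self ht)
  have hH2 : ContinuousH2 t₀ (hopfCole ε a b V) :=
    continuousH2_hopfCole (R₁ := fun x t => R₁ x t + q x t) (w₁ := w₁) (g := g) fV
      ((h.fam₁.mono hsub).add fq) (fun x _ t _ => by simp only [V₁]; rw [hqw x t]; ring)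
      (fun t ht => (hw₁ t ht).ac) (fun t ht => (hw₁ t ht).deriv) (fun t ht => (hw₁ t ht).memLp) hgt
      hpos
  have hverr : ∀ x ∈ Icc (0 : ℝ) 1, ∀ t, t₀ ≤ t →
      vErr ε a b x₀ y₁ y₂ (hopfCole ε a b V) x t = v x t := fun x hx t ht => by
    rw [vErr, coleHopf_hopfCole hε ha (hpos x hx t ht)]
    exact add_sub_cancel_left _ _
  -- The transforms of the two errors coincide on `[0,1]`, so their derivatives do; no formula for
  -- `vErr1` is needed.
  have hbc : ∀ t, t₀ ≤ t → ∀ x ∈ Icc (0 : ℝ) 1,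
      trans1 (c₁ / (4 * ε)) (fun x => vErr ε a b x₀ y₁ y₂ (hopfCole ε a b V) x t)
        (fun x => vErr1 ε a b x₀ y₁ y₂ (hopfCole ε a b V) (hopfCole1 ε a b V V₁) x t) x
      = trans1 (c₁ / (4 * ε)) (fun x => v x t) (fun x => v₁ x t) x := fun t ht x hx =>
    deriv_unique_Icc (fun z hz => trans_congr _ (fun y hy => hverr y hy t ht) hz) hx
      (hasDerivWithinAt_trans _ ((h.vErr_fam hsub fU).deriv t ht) hx)
      (hasDerivWithinAt_trans _ (fv'.deriv t ht) hx)
  refine ⟨hopfCole ε a b V, ⟨fun x hx => ?_, hH2, hC21, hpde, fun t ht => ⟨?_, ?_⟩⟩, fun t ht => ?_⟩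
  · have h1 : V x t₀ = coleHopf ε a b (fun x _ => u₀ x) x t₀ := by
      simp only [V]; rw [hv0 x hx, vErr]; ring
    have h2 := hopfCole_coleHopf (ε := ε) (a := a) (b := b) (fun x _ => u₀ x) x t₀
    rw [hcArg, ← h1] at h2
    rw [hopfCole, hcArg, h2, Real.log_exp]
    field_simp
  · rw [fU.dx_eq ht (by simp)]
    refine (h.feedback0_iff hε ha hc _ _ (ht₀.trans ht)).2 ?_
    rw [hbc t ht 0 (by simp)]
    exact (hvb t ht).1
  · rw [fU.dx_eq ht (by simp)]
    refine (h.feedback1_iff hε ha hc _ _ (ht₀.trans ht)).2 ?_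
    rw [hbc t ht 1 (by simp)]
    exact (hvb t ht).2
  · have ht0 : 0 ≤ t := ht₀.trans ht
    have d : ∀ x ∈ Icc (0 : ℝ) 1, HasDerivWithinAt
        (fun x => hopfCole ε a b V x t - uRef ε a b x₀ y₁ y₂ x t)
        (hopfCole1 ε a b V V₁ x t - hopfCole1 ε a b R R₁ x t) (Icc 0 1) x := fun x hx => by
      have h1 := fR.deriv t ht0 x hx
      rw [← fRu t ht0] at h1
      exact (fU.deriv t ht x hx).sub h1
    have c : ContinuousOn (fun x => hopfCole1 ε a b V V₁ x t - hopfCole1 ε a b R R₁ x t)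
        (Icc 0 1) := (fU.slice' ht).sub (fR.slice' ht0)
    have h1 := (h1Norm_bounds d c).2
    have h2 : energy (fun x => hopfCole ε a b V x t - uRef ε a b x₀ y₁ y₂ x t)
        (fun x => hopfCole1 ε a b V V₁ x t - hopfCole1 ε a b R R₁ x t)
        ≤ C₂ * energy (fun x => v x t) (fun x => v₁ x t) := by
      refine energy_le_of_pointwise (fun x hx => (d x hx).continuousWithinAt) c
        (fv'.slice ht) (fv'.slice' ht) fun x hx => ?_
      have := H₂ V V₁ x hx t ht0 (hquarter x hx t ht)
      simpa only [V, V₁, R, R₁, add_sub_cancel_left] using this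
    have h3 : √(energy (fun x => hopfCole ε a b V x t - uRef ε a b x₀ y₁ y₂ x t)
        (fun x => hopfCole1 ε a b V V₁ x t - hopfCole1 ε a b R R₁ x t))
        ≤ √(C₂ * K * C₁) * (N * Real.exp (-κ * (t - t₀))) := by
      have h4 : 0 ≤ N * Real.exp (-κ * (t - t₀)) := by positivity
      rw [← Real.sqrt_sq h4, ← Real.sqrt_mul (by positivity)]
      refine Real.sqrt_le_sqrt (h2.trans ((mul_le_mul_of_nonneg_left (hvE t ht) hC₂.le).trans
        (le_of_eq ?_)))
      rw [mul_pow, ← Real.exp_nat_mul, show ((2 : ℕ) : ℝ) * (-κ * (t - t₀)) = -2 * κ * (t - t₀) by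
        push_cast; ring]
      ring
    calc _ ≤ 2 * (√(C₂ * K * C₁) * (N * Real.exp (-κ * (t - t₀)))) := by linarith
      _ = _ := by ring

end Existence

/-! ### Uniqueness -/

/-- By the Sobolev embedding, continuity in time with values in H² is uniform in x. Uniqueness needs
it at t₀, where the classical regularity says nothing. -/
theorem ContinuousH2.continuousOn {t₀ : ℝ} {u : ℝ → ℝ → ℝ} (h : ContinuousH2 t₀ u) :
    ContinuousOn (fun p : ℝ × ℝ => u p.1 p.2) (Icc 0 1 ×ˢ Ici t₀) := by
  rintro ⟨x, t⟩ ⟨hx, ht⟩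
  have ht' : t₀ ≤ t := ht
  have hbound : ∀ s, t₀ ≤ s → ∀ z ∈ Icc (0 : ℝ) 1,
      |u z s - u z t| ≤ 2 * h2Norm (fun x => u x s - u x t) := fun s hs z hz => by
    have fs := (h.1 s hs).c1Fam s
    have ft := (h.1 t ht').c1Fam t
    have d : ∀ y ∈ Icc (0 : ℝ) 1, HasDerivWithinAt (fun x => u x s - u x t)
        (dx (fun x => u x s) y - dx (fun x => u x t) y) (Icc 0 1) y := fun y hy =>
      (fs.deriv s rfl y hy).sub (ft.deriv t rfl y hy)
    have c : ContinuousOn (fun y => dx (fun x => u x s) y - dx (fun x => u x t) y) (Icc 0 1) :=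
      (fs.slice' rfl).sub (ft.slice' rfl)
    have h1 := sq_le_energy d c hz
    have h2 := (h1Norm_bounds d c).1
    have h3 : h1Norm (fun x => u x s - u x t) ≤ h2Norm (fun x => u x s - u x t) :=
      le_add_of_nonneg_right (Real.sqrt_nonneg _)
    have h4 := h1Norm_nonneg (fun x => u x s - u x t)
    refine abs_le_of_sq_le_sq ?_ (by linarith)
    nlinarith
  have e : (fun p : ℝ × ℝ => u p.1 p.2) = fun p => (u p.1 p.2 - u p.1 t) + u p.1 t := by
    funext p; ring
  have hfst : Tendsto (fun p : ℝ × ℝ => u p.1 t) (𝓝[Icc 0 1 ×ˢ Ici t₀] (x, t)) (𝓝 (u x t)) := by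
    rw [nhdsWithin_prod_eq]
    exact ((h.1 t ht').1.continuousOn x hx).tendsto.comp tendsto_fst
  have hsnd : Tendsto (fun p : ℝ × ℝ => 2 * h2Norm (fun x => u x p.2 - u x t))
      (𝓝[Icc 0 1 ×ˢ Ici t₀] (x, t)) (𝓝 0) := by
    rw [nhdsWithin_prod_eq]
    have h1 := (h.2 t ht').const_mul 2
    rw [mul_zero] at h1
    exact h1.comp tendsto_snd
  have hdiff : Tendsto (fun p : ℝ × ℝ => u p.1 p.2 - u p.1 t)
      (𝓝[Icc 0 1 ×ˢ Ici t₀] (x, t)) (𝓝 0) :=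
    squeeze_zero_norm' (eventually_nhdsWithin_of_forall fun p hp => hbound p.2 hp.2 p.1 hp.1) hsnd
  rw [e]
  have := hdiff.add hfst
  simpa [ContinuousWithinAt] using this

/-- Uniqueness for the heat equation with homogeneous Neumann conditions. -/
theorem LinSol.eq_zero_of_neumann {ε κ t₀ : ℝ} (hε : 0 < ε) (hκ : 0 ≤ κ) {z z₁ z₂ : ℝ → ℝ → ℝ}
    (h : LinSol ε κ (Ioi t₀) z z₁ z₂)
    (hc : ContinuousOn (fun p : ℝ × ℝ => z p.1 p.2) (Icc 0 1 ×ˢ Ici t₀))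
    (h0 : ∀ x ∈ Icc (0 : ℝ) 1, z x t₀ = 0) (hb : ∀ t, t₀ < t → z₁ 0 t = 0 ∧ z₁ 1 t = 0) :
    ∀ x ∈ Icc (0 : ℝ) 1, ∀ t, t₀ ≤ t → z x t = 0 := by
  set E : ℝ → ℝ := fun t => ∫ x in (0 : ℝ)..1, z x t ^ 2
  have hEc : ContinuousOn E (Ici t₀) :=
    continuousOn_integral_param zero_le_one (f := fun t x => z x t ^ 2)
      ((hc.comp (f := fun p : ℝ × ℝ => (p.2, p.1)) (by fun_prop) fun p hp => ⟨hp.2, hp.1⟩).pow 2)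
  have hEd : ∀ t, t₀ < t → HasDerivAt E
      (∫ x in (0 : ℝ)..1, 2 * z x t * (ε * z₂ x t - κ * z x t)) t := fun t ht => by
    refine hasDerivAt_integral_param isOpen_Ioi (f := fun t x => z x t ^ 2)
      (f' := fun t x => 2 * z x t * (ε * z₂ x t - κ * z x t)) (fun s hs => ?_) ?_
      (fun s hs ξ hξ => ?_) ht
    · rw [uIcc_of_le zero_le_one]
      exact (h.fam.slice hs).pow 2
    · rw [uIcc_of_le zero_le_one]
      exact (ContinuousOn.mul (h.fam.cont.const_mul 2) h.time.cont).comp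
        (f := fun p : ℝ × ℝ => (p.2, p.1)) (by fun_prop) fun p hp => ⟨hp.2, hp.1⟩
    · rw [uIcc_of_le zero_le_one] at hξ
      exact ((h.time.deriv ξ hξ s hs).pow 2).congr_deriv (by simp)
  have hneg : ∀ t, t₀ < t → ∫ x in (0 : ℝ)..1, 2 * z x t * (ε * z₂ x t - κ * z x t) ≤ 0 :=
    fun t ht => by
      have c0 := h.fam.slice (t := t) ht
      have c1 := h.fam.slice' (t := t) ht
      have c2 := h.fam₁.slice' (t := t) ht
      have ibp : ∫ x in (0 : ℝ)..1, z x t * z₂ x t = z 1 t * z₁ 1 t - z 0 t * z₁ 0 t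
          - ∫ x in (0 : ℝ)..1, z₁ x t * z₁ x t := by
        refine intervalIntegral.integral_mul_deriv_eq_deriv_mul_of_hasDerivWithinAt
          (u := fun x => z x t) (v := fun x => z₁ x t) (fun x hx => ?_) (fun x hx => ?_) (ii_of_continuousOn c1) (ii_of_continuousOn c2)
        · rw [uIcc_of_le zero_le_one] at hx ⊢; exact h.fam.deriv t ht x hx
        · rw [uIcc_of_le zero_le_one] at hx ⊢; exact h.fam₁.deriv t ht x hx
      have e : ∫ x in (0 : ℝ)..1, 2 * z x t * (ε * z₂ x t - κ * z x t)
          = 2 * ε * (∫ x in (0 : ℝ)..1, z x t * z₂ x t)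
            - 2 * κ * ∫ x in (0 : ℝ)..1, z x t * z x t := by
        have i1 : ContinuousOn (fun x => 2 * ε * (z x t * z₂ x t)) (Icc 0 1) :=
          (c0.mul c2).const_mul _
        have i2 : ContinuousOn (fun x => 2 * κ * (z x t * z x t)) (Icc 0 1) :=
          (c0.mul c0).const_mul _
        rw [← intervalIntegral.integral_const_mul, ← intervalIntegral.integral_const_mul,
          ← intervalIntegral.integral_sub (ii_of_continuousOn i1) (ii_of_continuousOn i2)]
        exact intervalIntegral.integral_congr fun x _ => by ring
      have p1 : 0 ≤ ∫ x in (0 : ℝ)..1, z₁ x t * z₁ x t :=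
        intervalIntegral.integral_nonneg zero_le_one fun x _ => mul_self_nonneg _
      have p2 : 0 ≤ ∫ x in (0 : ℝ)..1, z x t * z x t :=
        intervalIntegral.integral_nonneg zero_le_one fun x _ => mul_self_nonneg _
      rw [e, ibp, (hb t ht).1, (hb t ht).2]
      nlinarith [mul_nonneg hε.le p1, mul_nonneg hκ p2]
  -- E is differentiated only for t > t₀; its continuity at t₀ lets the initial value 0 propagate.
  have hanti : AntitoneOn E (Ici t₀) := by
    refine antitoneOn_of_deriv_nonpos (convex_Ici t₀) hEc (fun t ht => ?_) fun t ht => ?_ <;>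
    rw [interior_Ici] at ht
    · exact (hEd t ht).differentiableAt.differentiableWithinAt
    · rw [(hEd t ht).deriv]; exact hneg t ht
  have hE0 : E t₀ = 0 := by
    have : ∀ x ∈ uIcc (0 : ℝ) 1, z x t₀ ^ 2 = 0 := fun x hx => by
      rw [uIcc_of_le zero_le_one] at hx
      rw [h0 x hx]; ring
    simp only [E]
    rw [intervalIntegral.integral_congr this]
    simp
  intro x hx t ht
  have hle : E t ≤ 0 := hE0 ▸ hanti self_mem_Ici ht ht
  have cs : ContinuousOn (fun x => z x t) (Icc 0 1) := slice_continuousOn hc ht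
  by_contra hne
  have hpos : 0 < ∫ x in (0 : ℝ)..1, z x t ^ 2 :=
    intervalIntegral.integral_pos zero_lt_one (cs.pow 2) (fun x _ => sq_nonneg _)
      ⟨x, hx, by positivity⟩
  exact absurd hle (not_le.2 hpos)

section Uniqueness

variable {ε a b x₀ D c₁ : ℝ} {y₁ y₂ : ℝ → ℝ}

/-- The Hopf–Cole map is defined and injective on all states, so no closeness to the reference is
assumed. In the difference W of the images the reference cancels, and the transform of W solves the
Neumann problem with zero initial state. -/
theorem SmallReference.closedLoop_unique (h : SmallReference ε a b x₀ y₁ y₂ D) (hε : 0 < ε)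
    (ha : a ≠ 0) (hc : 0 < c₁) {t₀ : ℝ} (ht₀ : 0 ≤ t₀) {u₀ : ℝ → ℝ} {u u' : ℝ → ℝ → ℝ}
    (hu : SolvesClosedLoop ε a b x₀ c₁ y₁ y₂ t₀ u₀ u)
    (hu' : SolvesClosedLoop ε a b x₀ c₁ y₁ y₂ t₀ u₀ u') :
    ∀ x ∈ Icc (0 : ℝ) 1, ∀ t, t₀ ≤ t → u' x t = u x t := by
  set c := c₁ / (4 * ε)
  have hsub : Ioi t₀ ⊆ Ici (0 : ℝ) := fun t ht => ht₀.trans (le_of_lt ht)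
  have key : ∀ {w : ℝ → ℝ → ℝ}, SolvesClosedLoop ε a b x₀ c₁ y₁ y₂ t₀ u₀ w →
      (∃ V₂, LinSol ε (a ^ 2 * b ^ 2 / (4 * ε)) (Ioi t₀) (coleHopf ε a b w)
        (coleHopf1 ε a b w fun x t => dx (fun z => w z t) x) V₂) ∧
      ContinuousOn (fun p : ℝ × ℝ => coleHopf ε a b w p.1 p.2) (Icc 0 1 ×ˢ Ici t₀) ∧
      C1Fam (Ioi t₀) (vErr ε a b x₀ y₁ y₂ w)
        (vErr1 ε a b x₀ y₁ y₂ w fun x t => dx (fun z => w z t) x) ∧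
      ∀ t, t₀ < t → ∀ x, x = 0 ∨ x = 1 → trans1 c (fun x => vErr ε a b x₀ y₁ y₂ w x t)
        (fun x => vErr1 ε a b x₀ y₁ y₂ w (fun x t => dx (fun z => w z t) x) x t) x = 0 :=
    fun {w} hw => by
      refine ⟨hw.2.2.1.linSol_coleHopf hε hw.2.2.2.1, ?_, h.vErr_fam hsub hw.2.2.1.fam, ?_⟩
      · have := hw.2.1.continuousOn
        exact ContinuousOn.mul (by fun_prop) ((this.const_mul _).rexp.sub continuousOn_const)
      · rintro t ht x (rfl | rfl)
        · exact (h.feedback0_iff hε ha hc w (fun x t => dx (fun z => w z t) x)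
            (ht₀.trans ht.le)).1 (hw.2.2.2.2 t ht.le).1
        · exact (h.feedback1_iff hε ha hc w (fun x t => dx (fun z => w z t) x)
            (ht₀.trans ht.le)).1 (hw.2.2.2.2 t ht.le).2
  obtain ⟨⟨V₂, lV⟩, cV, fV, bV⟩ := key hu
  obtain ⟨⟨V₂', lV'⟩, cV', fV', bV'⟩ := key hu'
  have lW := lV'.sub lV
  have cW := cV'.sub cV
  set W : ℝ → ℝ → ℝ := fun x t => coleHopf ε a b u' x t - coleHopf ε a b u x t
  have cW' : ContinuousOn (fun p : ℝ × ℝ => W p.1 p.2) (Icc 0 1 ×ˢ Ici t₀) := cW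
  have lz := lW.trans isOpen_Ioi c
  have hW : ∀ x t, W x t = vErr ε a b x₀ y₁ y₂ u' x t - vErr ε a b x₀ y₁ y₂ u x t := fun x t => by
    simp only [W, vErr]; ring
  have hbz : ∀ t, t₀ < t → ∀ x, x = 0 ∨ x = 1 → trans1 c (fun x => W x t)
      (fun x => coleHopf1 ε a b u' (fun x t => dx (fun z => u' z t) x) x t
        - coleHopf1 ε a b u (fun x t => dx (fun z => u z t) x) x t) x = 0 := fun t ht x hx => by
    have hxI : x ∈ Icc (0 : ℝ) 1 := by rcases hx with rfl | rfl <;> simp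
    have h1 := (hasDerivWithinAt_trans c (fV'.deriv t ht) hxI).sub
      (hasDerivWithinAt_trans c (fV.deriv t ht) hxI)
    rw [bV t ht x hx, bV' t ht x hx, sub_zero] at h1
    refine deriv_unique_Icc (fun z hz => ?_) hxI
      (hasDerivWithinAt_trans c (lW.fam.deriv t ht) hxI) h1
    rw [Pi.sub_apply, ← trans_sub c (fV'.slice ht) (fV.slice ht) hz]
    exact trans_congr c (fun y _ => hW y t) hz
  have hz0 := lz.eq_zero_of_neumann hε (by positivity)
    (cW'.sub (continuousOn_volt (continuous_ker c) cW')) (fun x hx => ?_)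
    fun t ht => ⟨hbz t ht 0 (Or.inl rfl), hbz t ht 1 (Or.inr rfl)⟩
  · intro x hx t ht
    -- The inverse transformation shows that W vanishes; injectivity of the exponential then
    -- identifies the two solutions.
    have h1 := trans_neg_trans c (slice_continuousOn cW' ht) hx
    rw [trans_congr (-c) (w := fun _ => 0) (fun y hy => hz0 y hy t ht) hx] at h1
    have h2 : coleHopf ε a b u' x t = coleHopf ε a b u x t := by
      have : W x t = 0 := by rw [← h1]; simp [trans, volt]
      exact sub_eq_zero.1 this
    have h3 := mul_left_cancel₀ (Real.exp_pos _).ne' h2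
    have h4 := Real.exp_injective (sub_left_injective h3)
    exact mul_left_cancel₀ (neg_ne_zero.2 (div_ne_zero ha hε.ne')) h4
  · have : ∀ y ∈ Icc (0 : ℝ) 1, W y t₀ = 0 := fun y hy => by
      simp only [W, coleHopf]
      rw [hu.1 y hy, hu'.1 y hy, sub_self]
    rw [trans_congr c (w := fun _ => 0) this hx]
    simp [trans, volt]

end Uniqueness

/-! ### Comparison functions -/

theorem isClassK_mul {K : ℝ} (hK : 0 < K) : IsClassK fun s => K * s :=
  ⟨by fun_prop, fun _ _ _ _ h => mul_lt_mul_of_pos_left h hK, mul_zero K⟩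

theorem isClassKL_mul_exp {K κ : ℝ} (hK : 0 < K) (hκ : 0 < κ) :
    IsClassKL fun s τ => K * s * Real.exp (-κ * τ) := by
  refine ⟨by fun_prop, fun τ _ => ⟨by fun_prop, fun _ _ _ _ h => ?_, by simp⟩,
    fun r hr => ⟨fun τ _ τ' _ h => ?_, ?_⟩⟩
  · exact mul_lt_mul_of_pos_right (mul_lt_mul_of_pos_left h hK) (Real.exp_pos _)
  · refine mul_le_mul_of_nonneg_left (Real.exp_le_exp.2 ?_) (mul_nonneg hK.le hr)
    nlinarith
  · have h1 : Tendsto (fun τ : ℝ => -κ * τ) atTop atBot :=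
      tendsto_id.const_mul_atTop_of_neg (neg_neg_of_pos hκ)
    simpa using (Real.tendsto_exp_atBot.comp h1).const_mul (K * r)

end ViscousHJ

end

theorem theorem2 (ε a b x₀ M γ : ℝ) (hε : 0 < ε) (ha : a ≠ 0) (hx₀ : x₀ ∈ Icc (0 : ℝ) 1)
    (hM : 0 < M) (hγ₁ : 1 ≤ γ) (hγ₂ : γ < 2) :
    ∃ μ₁ : ℝ, 0 < μ₁ ∧ ∀ (F : ℝ) (y₁ y₂ : ℝ → ℝ), F ≤ μ₁ →
      IsGevrey F M γ (Ici 0) y₁ → IsGevrey F M γ (Ici 0) y₂ →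
      GeneratesReference ε a b x₀ y₁ y₂ ∧
      ∀ c₁ : ℝ, 0 < c₁ →
        ∃ (μ : ℝ) (β : ℝ → ℝ → ℝ), 0 < μ ∧ IsClassKL β ∧
          (∃ α : ℝ → ℝ, IsClassK α ∧ ∀ s τ : ℝ, 0 ≤ s → 0 ≤ τ →
            β s τ = α s * Real.exp (-(c₁ + a ^ 2 * b ^ 2 / (4 * ε)) * τ)) ∧
          ∀ (t₀ : ℝ) (u₀ : ℝ → ℝ), 0 ≤ t₀ → MemH2 u₀ →
            Compatible ε a b x₀ c₁ y₁ y₂ t₀ u₀ →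
            h1Norm (fun x => u₀ x - uRef ε a b x₀ y₁ y₂ x t₀) < μ →
            ∃ u : ℝ → ℝ → ℝ,
              SolvesClosedLoop ε a b x₀ c₁ y₁ y₂ t₀ u₀ u ∧
              (∀ t, t₀ ≤ t →
                h1Norm (fun x => u x t - uRef ε a b x₀ y₁ y₂ x t) ≤
                  β (h1Norm (fun x => u₀ x - uRef ε a b x₀ y₁ y₂ x t₀)) (t - t₀)) ∧
              ∀ u' : ℝ → ℝ → ℝ, SolvesClosedLoop ε a b x₀ c₁ y₁ y₂ t₀ u₀ u' →
                ∀ x ∈ Icc (0 : ℝ) 1, ∀ t, t₀ ≤ t → u' x t = u x t := by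
  obtain ⟨μ₁, hμ₁, H⟩ := exists_smallReference hε ha hx₀ hM hγ₁ hγ₂
  refine ⟨μ₁, hμ₁, fun F y₁ y₂ hF h₁ h₂ => ?_⟩
  obtain ⟨hgen, D, hS⟩ := H F y₁ y₂ hF h₁ h₂
  refine ⟨hgen, fun c₁ hc₁ => ?_⟩
  obtain ⟨μ, K, hμ, hK, hex⟩ := hS.exists_closedLoop hε ha hc₁
  have hκ : 0 < c₁ + a ^ 2 * b ^ 2 / (4 * ε) := by positivity
  -- The function α is linear with slope K; μ and K depend on the reference and on c₁, but not on t₀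
  -- or u₀.
  refine ⟨μ, _, hμ, isClassKL_mul_exp hK hκ, ⟨fun s => K * s, isClassK_mul hK,
    fun _ _ _ _ => rfl⟩, fun t₀ u₀ ht₀ hu₀ hcomp hN => ?_⟩
  obtain ⟨u, hu, hdecay⟩ := hex t₀ u₀ ht₀ hu₀ hcomp hN
  exact ⟨u, hu, hdecay, fun u' hu' => hS.closedLoop_unique hε ha hc₁ ht₀ hu hu'⟩
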